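/- **Setting.** Let $p=p(n)$ and $m=m(n)\ge 1$ be integer sequences with $n/p\to\gamma_0\in(0,\infty)$ as $n\to\infty$ (the proportional high-dimensional asymptotic setting, PHAS). For each $n$ let $\mathcal D=\{(y_i,\bm x_i)\}_{i\le n}\subset\mathbb R\times\mathbb R^p$ be an i.i.d. sample. Fix $\lambda,\nu,C,s,C_X>0$, $C_{y,s}$ and $\epsilon>0$ (independent of $n$) and a real $c$. A function is $O(\mathrm{polylog}(n))$ if it is $O((\log n)^k)$ for some $k$. Assume: * A1–A3: the regularizer is separable, $r(\bm\beta)=\sum_{k\le p}r_k(\beta_k)$ (it may depend on $n$), nonnegative with $r(\bm 0)=0$, twice differentiable and $\nu$-strongly convex; the loss $\ell(y|z)\ge 0$ is convex in $z$ and three times differentiable in $z$. * B1: $\bm x_i\sim\mathcal N(\bm 0,\bm\Sigma)$ with $\lambda_{\max}(\bm\Sigma)\le C_X/p$. * B2: $\max\{\ell(y|z),|\partial_z\ell(y|z)|,|\partial_z^3\ell(y|z)|\}\le C(1+|y|^s+|z|^s)$, and $\nabla^2 r$ is $C_{rr}(n)$-Lipschitz in Frobenius norm with $C_{rr}(n)=O(\mathrm{polylog}(n))$.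 * B3: $\mathbb P(|y_i|>C_y(n))\le q_n^{(y)}$ with $C_y(n)=O(\mathrm{polylog}(n))$ and $q_n^{(y)}=o(n^{-1})$, and $\mathbb E|y_i|^{2s}\le C_{y,s}$. For $\mathcal M\subset[n]$ let $L_{\backslash\mathcal M}(\bm\beta)=\sum_{i\notin\mathcal M}\ell(y_i|\bm x_i^\top\bm\beta)+\lambda r(\bm\beta)$, $\hat{\bm\beta}_{\backslash\mathcal M}=\arg\min L_{\backslash\mathcal M}$, $\hat{\bm\beta}=\hat{\bm\beta}_{\backslash\emptyset}$. Let $\tilde{\bm\beta}^{(t)}_{\backslash\mathcal M}$ be the result of $t$ Newton steps for $L_{\backslash\mathcal M}$ started at $\hat{\bm\beta}$, and $\tilde{\bm\beta}^{R,t}_{\backslash\mathcal M}=\tilde{\bm\beta}^{(t)}_{\backslash\mathcal M}+\bm b$, where $\bm b$ is independent with density proportional to $e^{-\frac{\epsilon}{r_{t,n}}\|\bm b\|}$ and $$r_{t,n}=[C_1(n)]^{2^{t-1}}\Big(\frac{C_2(n)m^3}{2\lambda\nu n}\Big)^{2^{t-2}}.$$ For a fresh observation $(y_0,\bm x_0)$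 independent of $\mathcal D$ and $\bm b$ and distributed as the data, put $$\mathrm{GED}_t(\mathcal M)=\mathbb E\big(|\ell(y_0|\bm x_0^\top\hat{\bm\beta}_{\backslash\mathcal M})-\ell(y_0|\bm x_0^\top\tilde{\bm\beta}^{R,t}_{\backslash\mathcal M})|\,\big|\,\mathcal D\big),\qquad R_{t,n}=\Big(\frac{2\sqrt p}{\epsilon}+\frac1{\sqrt p}\Big)r_{t,n}\sqrt{2m+2s}.$$ **Theorem.** There are positive threshold functions $c_1(n),c_2(n)=O(\mathrm{polylog}(n))$ and measurable sets $\mathcal X_n$ of data sets (depending neither on $t$, $\epsilon$ nor on $C_1,C_2$) with $$\mathbb P(\mathcal D\in\mathcal X_n)\ge 1-(n+1)q_n^{(y)}-14n^{1-c}-ne^{-p/2}-2e^{-p}-e^{-(1-\log 2)p},$$ such that for all $C_1(n),C_2(n)=O(\mathrm{polylog}(n))$ with $C_1\ge c_1$, $C_2\ge c_2$ for all large $n$, and every $\epsilon>0$: 1. Let $t_0\ge1$ be such that $R_{t_0,n}=O(\mathrm{polylog}(n))$ (for $m=O(1)$ this holds with $t_0=1$). Then there is a function $\mathrm{polylog}(n)$,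 independent of $t$ and $\mathcal M$, such that for all large $n$, all $\mathcal D\in\mathcal X_n$, all $|\mathcal M|\le m$ and all $t\ge t_0$, $$\mathrm{GED}_t(\mathcal M)\le\Big(\frac{2\sqrt p}{\epsilon}+\frac1{\sqrt p}\Big)r_{t,n}\sqrt{2m+2s}\cdot\mathrm{polylog}(n).$$ 2. Let $\alpha=\log(m+1)/\log n$ and $T=1+\log_2\frac{1+\alpha}{1-3\alpha}$. If a fixed $t$ satisfies $\alpha<1/3$ and $t>T$ for all large $n$, then $\mathrm{GED}_t(\mathcal M)\to0$ uniformly over $\mathcal D\in\mathcal X_n$ and $|\mathcal M|\le m$; if moreover $c>1$, then $\max_{|\mathcal M|\le m}\mathrm{GED}_t(\mathcal M)\to0$ in probability. 3. In particular, if $m=O(1)$, the conclusion of 2 holds with $t=2$ (two steps suffice). Moreover $T>1$ for all $n\ge 2$ with $\alpha<1/3$ (recall $m\ge1$), so a single step never meets the criterion $t>T$. -/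

import Mathlib

open MeasureTheory ProbabilityTheory Filter Topology Asymptotics
open scoped ENNReal Gradient

noncomputable section

namespace Unlearning

/-- The parameter space `ℝᵖ` with its Euclidean norm. -/
abbrev Param (p : ℕ) : Type := EuclideanSpace ℝ (Fin p)

/-- A single observation `(y, x)`: a real response and a feature vector. -/
abbrev Obs (p : ℕ) : Type := ℝ × Param p

/-- A data set of `n` observations. -/
abbrev Dataset (n p : ℕ) : Type := Fin n → Obs p

/-- `f(n) = O(polylog(n))`: `f` grows at most like a power of `log n`. -/
def IsPolylog (f : ℕ → ℝ) : Prop :=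
  ∃ k : ℕ, f =O[atTop] fun n : ℕ => Real.log n ^ k

/-- The separable regularizer `r(β) = ∑ₖ rₖ(βₖ)`. -/
def regularizer {p : ℕ} (r : Fin p → ℝ → ℝ) (β : Param p) : ℝ :=
  ∑ k, r k (β k)

/-- The regularized empirical risk with the observations in `M` removed,
`∑_{i ∉ M} ℓ(yᵢ | xᵢᵀβ) + λ r(β)`. -/
def risk {n p : ℕ} (ℓ : ℝ → ℝ → ℝ) (r : Fin p → ℝ → ℝ) (lam : ℝ)
    (D : Dataset n p) (M : Finset (Fin n)) (β : Param p) : ℝ :=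
  ∑ i ∈ Mᶜ, ℓ (D i).1 (inner ℝ (D i).2 β) + lam * regularizer r β

/-- A minimizer of `f` over the parameter space (it is unique for the risks considered here). -/
def argmin {p : ℕ} (f : Param p → ℝ) : Param p :=
  Classical.epsilon fun β => IsMinOn f Set.univ β

/-- The regularized empirical risk minimizer trained without the observations in `M`;
`M = ∅` gives the original estimator, and general `M` gives exact removal. -/
def estimator {n p : ℕ} (ℓ : ℝ → ℝ → ℝ) (r : Fin p → ℝ → ℝ) (lam : ℝ)
    (D : Dataset n p) (M : Finset (Fin n)) : Param p :=
  argmin (risk ℓ r lam D M)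

/-- One Newton step `β ↦ β - (∇² f(β))⁻¹ ∇ f(β)` for the minimization of `f`. -/
def newtonStep {p : ℕ} (f : Param p → ℝ) (β : Param p) : Param p :=
  β - (fderiv ℝ (gradient f) β).inverse (gradient f β)

/-- The `t`-step Newton estimator: `t` Newton steps for the risk without the observations in
`M`, started at the estimator trained on all the data. -/
def newtonEstimator {n p : ℕ} (ℓ : ℝ → ℝ → ℝ) (r : Fin p → ℝ → ℝ) (lam : ℝ)
    (D : Dataset n p) (M : Finset (Fin n)) (t : ℕ) : Param p :=
  (newtonStep (risk ℓ r lam D M))^[t] (estimator ℓ r lam D ∅)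

/-- The unnormalized isotropic Laplace measure, with density `exp(-κ ‖b‖)`. -/
def laplaceWeight (p : ℕ) (κ : ℝ) : Measure (Param p) :=
  volume.withDensity fun b => ENNReal.ofReal (Real.exp (-κ * ‖b‖))

/-- The isotropic Laplace distribution on `ℝᵖ`, with density proportional to `exp(-κ ‖b‖)`. -/
def isotropicLaplace (p : ℕ) (κ : ℝ) : Measure (Param p) :=
  (laplaceWeight p κ Set.univ)⁻¹ • laplaceWeight p κ

/-- The generalization error divergence, given the data `D`, between exact removal of `M` and
the `t`-step Newton estimator perturbed by isotropic Laplace noise `b` of rate `κ`: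
`E( |ℓ(y₀ | x₀ᵀ β̂) - ℓ(y₀ | x₀ᵀ (β̃ + b))| | D )`, where `(y₀, x₀)` is a fresh observation
with law `P` and `b` is independent of it.  The value is in `[0, ∞]`. -/
def ged {n p : ℕ} (ℓ : ℝ → ℝ → ℝ) (r : Fin p → ℝ → ℝ) (lam : ℝ) (P : Measure (Obs p))
    (κ : ℝ) (t : ℕ) (D : Dataset n p) (M : Finset (Fin n)) : ℝ≥0∞ :=
  ∫⁻ w : Obs p × Param p,
    ENNReal.ofReal |ℓ w.1.1 (inner ℝ w.1.2 (estimator ℓ r lam D M)) -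
      ℓ w.1.1 (inner ℝ w.1.2 (newtonEstimator ℓ r lam D M t + w.2))|
    ∂(P.prod (isotropicLaplace p κ))

/-- The perturbation scale
`r_{t,n} = C₁^(2^(t-1)) (C₂ m³ / (2 λ ν n))^(2^(t-2))`. -/
def noiseScale (C₁ C₂ lam ν : ℝ) (m n t : ℕ) : ℝ :=
  C₁ ^ ((2 : ℝ) ^ ((t : ℝ) - 1)) *
    (C₂ * (m : ℝ) ^ 3 / (2 * lam * ν * n)) ^ ((2 : ℝ) ^ ((t : ℝ) - 2))

/-- The rate `(2 √p / ε + 1 / √p) ρ √(2 m + 2 s)`, to be used with `ρ = r_{t,n}`. -/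
def gedRate (p m : ℕ) (ε s ρ : ℝ) : ℝ :=
  (2 * √(p : ℝ) / ε + 1 / √(p : ℝ)) * ρ * √(2 * m + 2 * s)

/-- `α = log(m + 1) / log n`. -/
def removalExponent (m n : ℕ) : ℝ := Real.log (m + 1) / Real.log n

/-- `T = 1 + log₂((α + 1) / (1 - 3 α))`. -/
def stepThreshold (α : ℝ) : ℝ := 1 + Real.logb 2 ((α + 1) / (1 - 3 * α))

/-- The assumptions on the loss `ℓ(y, z)`; all derivatives are in `z`. -/
structure LossAssumptions (ℓ : ℝ → ℝ → ℝ) (C s : ℝ) : Prop where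
  C_pos : 0 < C
  s_pos : 0 < s
  measurable : Measurable (Function.uncurry ℓ)
  nonneg : ∀ y z, 0 ≤ ℓ y z
  /-- `ℓ` is three times differentiable in `z`. -/
  differentiable : ∀ y, ∀ k < 3, Differentiable ℝ (iteratedDeriv k (ℓ y))
  convex : ∀ y, ConvexOn ℝ Set.univ (ℓ y)
  growth : ∀ y z, max (ℓ y z) (max |deriv (ℓ y) z| |iteratedDeriv 3 (ℓ y) z|) ≤
    C * (1 + |y| ^ s + |z| ^ s)

/-- The assumptions on the separable regularizer with components `r k`: it is nonnegative with
minimum value `0` at the origin, twice differentiable and `ν`-strongly convex, and its Hessian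
`diag(r̈ₖ(βₖ))` is `Crr`-Lipschitz in the Frobenius norm. -/
structure RegularizerAssumptions {p : ℕ} (r : Fin p → ℝ → ℝ) (ν Crr : ℝ) : Prop where
  nonneg : ∀ β, 0 ≤ regularizer r β
  zero : regularizer r 0 = 0
  differentiable : ∀ k, Differentiable ℝ (r k) ∧ Differentiable ℝ (deriv (r k))
  strongConvex : StrongConvexOn Set.univ ν (regularizer r)
  hessian_lipschitz : ∀ β β' : Param p,
    √(∑ k, (deriv (deriv (r k)) (β k) - deriv (deriv (r k)) (β' k)) ^ 2) ≤ Crr * ‖β - β'‖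

/-- The assumptions on the law `P` of one observation `(y, x)`: `x` is a centred Gaussian vector
whose covariance has largest eigenvalue at most `CX / p`, `P(|y| > Cy) ≤ q`, and
`E |y|^(2s) ≤ Cys`.  Nothing is assumed on the conditional law of `y` given `x`. -/
structure DataAssumptions {p : ℕ} (P : Measure (Obs p)) (CX s Cy q Cys : ℝ) : Prop where
  isProbability : IsProbabilityMeasure P
  gaussian : ∃ (S : Matrix (Fin p) (Fin p) ℝ) (hS : S.PosSemidef),
    (∀ i, hS.isHermitian.eigenvalues i ≤ CX / p) ∧
      P.map Prod.snd = multivariateGaussian 0 S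
  tail : P.real {z | Cy < |z.1|} ≤ q
  moment : ∫⁻ z, ENNReal.ofReal (|z.1| ^ (2 * s)) ∂P ≤ ENNReal.ofReal Cys

/-- The law of a data set of `n` independent observations with law `P`. -/
def datasetLaw {p : ℕ} (n : ℕ) (P : Measure (Obs p)) : Measure (Dataset n p) :=
  Measure.pi fun _ => P

/-- `G n D M → 0` as `n → ∞`, uniformly over the data sets `D ∈ 𝒳 n` and over all removal
sets `M` with at most `m n` elements. -/
def VanishesOn {p : ℕ → ℕ} (m : ℕ → ℕ) (𝒳 : ∀ n, Set (Dataset n (p n)))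
    (G : ∀ n, Dataset n (p n) → Finset (Fin n) → ℝ≥0∞) : Prop :=
  ∀ η > (0 : ℝ), ∀ᶠ n in atTop, ∀ D ∈ 𝒳 n, ∀ M : Finset (Fin n), M.card ≤ m n →
    G n D M ≤ ENNReal.ofReal η

/-- The maximum of `G n D M` over all removal sets `M` with at most `m n` elements tends to `0`
in probability as `n → ∞`, when `D` is an i.i.d. sample of size `n` from `P n`. -/
def VanishesInProbability {p : ℕ → ℕ} (m : ℕ → ℕ) (P : ∀ n, Measure (Obs (p n)))
    (G : ∀ n, Dataset n (p n) → Finset (Fin n) → ℝ≥0∞) : Prop :=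
  ∀ η > (0 : ℝ), Tendsto (fun n => datasetLaw n (P n)
    {D | ∃ M : Finset (Fin n), M.card ≤ m n ∧ ENNReal.ofReal η < G n D M}) atTop (𝓝 0)

end Unlearning

end

open MeasureTheory ProbabilityTheory Filter Topology Asymptotics
open scoped ENNReal Gradient

noncomputable section

namespace Unlearning

/-! ### The loss and the regularizer -/

section Components

variable {ℓ : ℝ → ℝ → ℝ} {C s : ℝ}

/-! The minimizer of the risk without `M`, and its Hessian `H_M` there, depend only on the
observations outside `M`, so the Gaussian features `x_j`, `j ∈ M`, are independent of them. For a
vector `u` built from the outside observations, `∑_{j ∈ M} ⟨x_j, u⟩²` is therefore at most of order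
`(|M| + 1) (log n) ‖u‖² / p` (`measure_lt_sum_sq_inner_le`). The choices `u = H_M⁻¹ x_k` with `k ∉
M` and `u = H_M⁻¹ e_k` show that removed observations barely influence any single remaining
prediction or coordinate. The tails are light enough for a union bound over all subsets `M` at once.
With bounds for the responses and for the design matrix, this shows that most data sets are tame
(`measure_not_isTame_le`); the sets `𝒳 n` consist of such data sets for large `n`.

What follows on a tame data set is deterministic. For `N ⊆ M`, the estimators without `N` and
without `M` differ by `w - v`, where `v = H_M⁻¹ ∑ g_j x_j` is the linear response and `w` a
second-order remainder (`exists_estimator_sub_eq`). The Euclidean norm of `v` is only bounded by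
order `√m`, but its pairings with the remaining features and its coordinates are of order `m / √n`,
up to polylogarithmic factors. The error of a Newton step is bilinear in this difference, and one
factor can be measured in the sup norm and the other in the Euclidean norm: the first step has error
of order `√(m³ / n)`, whereas quadratic convergence in the Euclidean norm alone would give order
`m`. This needs bounded predictors after up to `m` removals, which follow by removing observations
one at a time (`IsTame.abs_inner_estimator_le`). Later steps square the error, just as `r_{t,n}` is
squared when `t` grows by one (`IsTame.norm_newtonEstimator_sub_le`, `noiseScale_succ`).

A fresh feature vector sees an independent vector of norm `√p ρ` at size `ρ`. Laplace noise of rate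
`ε / r` has norm of order `p r / ε`, so the predictor is perturbed by about `√p r / ε`, and the
divergence is of that order (`lintegral_abs_loss_sub_le`). The criterion `t > T` makes `√n √(m³ /
n)^(2^(t-1))` polynomially small, uniformly even if `α` tends to zero (`rates_of_stepThreshold_lt`).
For the first claim, a polylogarithmic rate already forces `m³ / n` to be polynomially small, so the
deterministic part applies. -/

lemma LossAssumptions.differentiable_loss (hℓ : LossAssumptions ℓ C s) (y : ℝ) :
    Differentiable ℝ (ℓ y) := by
  simpa using hℓ.differentiable y 0 (by norm_num)

lemma LossAssumptions.differentiable_deriv (hℓ : LossAssumptions ℓ C s) (y : ℝ) :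
    Differentiable ℝ (deriv (ℓ y)) := by
  simpa [iteratedDeriv_one] using hℓ.differentiable y 1 (by norm_num)

lemma LossAssumptions.differentiable_deriv_deriv (hℓ : LossAssumptions ℓ C s) (y : ℝ) :
    Differentiable ℝ (deriv (deriv (ℓ y))) := by
  simpa [iteratedDeriv_succ, iteratedDeriv_zero] using hℓ.differentiable y 2 (by norm_num)

lemma LossAssumptions.deriv_deriv_nonneg (hℓ : LossAssumptions ℓ C s) (y z : ℝ) :
    0 ≤ deriv (deriv (ℓ y)) z := by
  have h : MonotoneOn (deriv (ℓ y)) Set.univ :=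
    (hℓ.convex y).monotoneOn_deriv fun x _ => hℓ.differentiable_loss y x
  exact (monotoneOn_univ.mp h).deriv_nonneg

/-- The growth bound `C (1 + |y|^s + Z^s)` for the loss and its derivatives on `|z| ≤ Z`. -/
def growthBound (C s Y Z : ℝ) : ℝ := C * (1 + Y ^ s + Z ^ s)

lemma growthBound_nonneg {C s Y Z : ℝ} (hC : 0 < C) (hY : 0 ≤ Y) (hZ : 0 ≤ Z) :
    0 ≤ growthBound C s Y Z := by
  unfold growthBound
  positivity

lemma growthBound_mono {C s Y Z Y' Z' : ℝ} (hC : 0 < C) (hs : 0 < s) (hY : 0 ≤ Y) (hZ : 0 ≤ Z)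
    (hYY : Y ≤ Y') (hZZ : Z ≤ Z') : growthBound C s Y Z ≤ growthBound C s Y' Z' := by
  unfold growthBound
  gcongr

lemma LossAssumptions.loss_le (hℓ : LossAssumptions ℓ C s) {y z Y Z : ℝ} (hy : |y| ≤ Y)
    (hz : |z| ≤ Z) : ℓ y z ≤ growthBound C s Y Z :=
  ((le_max_left _ _).trans (hℓ.growth y z)).trans
    (growthBound_mono hℓ.C_pos hℓ.s_pos (abs_nonneg _) (abs_nonneg _) hy hz)

lemma LossAssumptions.abs_deriv_le (hℓ : LossAssumptions ℓ C s) {y z Y Z : ℝ} (hy : |y| ≤ Y)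
    (hz : |z| ≤ Z) : |deriv (ℓ y) z| ≤ growthBound C s Y Z :=
  (((le_max_left _ _).trans (le_max_right _ _)).trans (hℓ.growth y z)).trans
    (growthBound_mono hℓ.C_pos hℓ.s_pos (abs_nonneg _) (abs_nonneg _) hy hz)

lemma LossAssumptions.abs_deriv_three_le (hℓ : LossAssumptions ℓ C s) {y z Y Z : ℝ} (hy : |y| ≤ Y)
    (hz : |z| ≤ Z) : |deriv (deriv (deriv (ℓ y))) z| ≤ growthBound C s Y Z := by
  have h := (((le_max_right _ _).trans (le_max_right _ _)).trans (hℓ.growth y z)).trans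
    (growthBound_mono hℓ.C_pos hℓ.s_pos (abs_nonneg _) (abs_nonneg _) hy hz)
  simpa [iteratedDeriv_succ, iteratedDeriv_zero] using h

lemma LossAssumptions.abs_sub_le (hℓ : LossAssumptions ℓ C s) {y a b Y Z : ℝ} (hy : |y| ≤ Y)
    (ha : |a| ≤ Z) (hb : |b| ≤ Z) :
    |ℓ y a - ℓ y b| ≤ growthBound C s Y Z * |a - b| := by
  have := Convex.norm_image_sub_le_of_norm_deriv_le (𝕜 := ℝ) (f := ℓ y) (s := Set.Icc (-Z) Z)
    (x := b) (y := a) (C := growthBound C s Y Z)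
    (fun z _ => hℓ.differentiable_loss y z)
    (fun z hz => hℓ.abs_deriv_le hy (abs_le.mpr hz)) (convex_Icc _ _) (abs_le.mp hb) (abs_le.mp ha)
  simpa [Real.norm_eq_abs] using this

lemma LossAssumptions.abs_deriv_deriv_sub_le (hℓ : LossAssumptions ℓ C s) {y a b Y Z : ℝ}
    (hy : |y| ≤ Y) (ha : |a| ≤ Z) (hb : |b| ≤ Z) :
    |deriv (deriv (ℓ y)) a - deriv (deriv (ℓ y)) b| ≤ growthBound C s Y Z * |a - b| := by
  have := Convex.norm_image_sub_le_of_norm_deriv_le (𝕜 := ℝ) (f := deriv (deriv (ℓ y)))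
    (s := Set.Icc (-Z) Z) (x := b) (y := a) (C := growthBound C s Y Z)
    (fun z _ => hℓ.differentiable_deriv_deriv y z)
    (fun z hz => hℓ.abs_deriv_three_le hy (abs_le.mpr hz)) (convex_Icc _ _) (abs_le.mp hb)
    (abs_le.mp ha)
  simpa [Real.norm_eq_abs] using this

variable {p : ℕ} {r : Fin p → ℝ → ℝ} {ν Crr : ℝ}

/-- Along the `k`-th axis every other component contributes a constant, so strong convexity of the
sum restricts to convexity of `r k t - ν / 2 * t ^ 2`, whose derivative is then monotone. -/
lemma RegularizerAssumptions.le_deriv_deriv (hr : RegularizerAssumptions r ν Crr) (k : Fin p)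
    (t : ℝ) : ν ≤ deriv (deriv (r k)) t := by
  have hconv := strongConvexOn_iff_convex.mp hr.strongConvex
  have h1 : ConvexOn ℝ Set.univ (fun t : ℝ => r k t - ν / 2 * t ^ 2) := by
    have h2 := hconv.comp_linearMap
      (LinearMap.toSpanSingleton ℝ (Param p) (EuclideanSpace.single k 1))
    rw [Set.preimage_univ] at h2
    have h3 := h2.add (convexOn_const (-∑ j ∈ Finset.univ.erase k, r j 0) convex_univ)
    refine h3.congr fun t _ => ?_
    have hk : regularizer r (t • EuclideanSpace.single k (1 : ℝ)) =
        r k t + ∑ j ∈ Finset.univ.erase k, r j 0 := by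
      rw [regularizer, ← Finset.add_sum_erase _ _ (Finset.mem_univ k)]
      congr 1
      · simp
      · refine Finset.sum_congr rfl fun j hj => ?_
        simp [Finset.ne_of_mem_erase hj]
    simp [Function.comp, LinearMap.toSpanSingleton_apply, hk, norm_smul]
    ring
  have hd : Differentiable ℝ (fun t : ℝ => r k t - ν / 2 * t ^ 2) :=
    (hr.differentiable k).1.sub (by fun_prop)
  have hmono := monotoneOn_univ.mp (h1.monotoneOn_deriv fun x _ => hd x)
  have hderiv : deriv (fun t : ℝ => r k t - ν / 2 * t ^ 2) = fun t => deriv (r k) t - ν * t := by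
    funext t
    have h4 : HasDerivAt (fun t : ℝ => ν / 2 * t ^ 2) (ν * t) t := by
      have := (hasDerivAt_pow 2 t).const_mul (ν / 2)
      convert! this using 1
      simp
      ring
    exact (((hr.differentiable k).1 t).hasDerivAt.sub h4).deriv
  rw [hderiv] at hmono
  have h5 := hmono.deriv_nonneg (x := t)
  have h6 : HasDerivAt (fun t => deriv (r k) t - ν * t) (deriv (deriv (r k)) t - ν) t := by
    have h7 : HasDerivAt (fun t : ℝ => ν * t) ν t := by
      simpa using (hasDerivAt_id t).const_mul ν
    exact ((hr.differentiable k).2 t).hasDerivAt.sub h7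
  rw [h6.deriv] at h5
  linarith

/-- Two points on one axis differ in a single Hessian entry, so the Frobenius bound becomes
entrywise. The absolute value keeps later constants nonnegative without a sign condition on `Crr`.
-/
lemma RegularizerAssumptions.abs_deriv_deriv_sub_le (hr : RegularizerAssumptions r ν Crr)
    (k : Fin p) (a b : ℝ) :
    |deriv (deriv (r k)) a - deriv (deriv (r k)) b| ≤ |Crr| * |a - b| := by
  have h := hr.hessian_lipschitz (EuclideanSpace.single k a) (EuclideanSpace.single k b)
  have h1 : ‖(EuclideanSpace.single k a - EuclideanSpace.single k b : Param p)‖ = |a - b| := by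
    rw [← dist_eq_norm, EuclideanSpace.single, EuclideanSpace.single, PiLp.dist_single_same,
      Real.dist_eq]
  have h2 : |deriv (deriv (r k)) a - deriv (deriv (r k)) b| ≤
      √(∑ j, (deriv (deriv (r j)) ((EuclideanSpace.single k a : Param p) j) -
        deriv (deriv (r j)) ((EuclideanSpace.single k b : Param p) j)) ^ 2) := by
    refine Real.le_sqrt_of_sq_le ?_
    refine le_trans (le_of_eq ?_) (Finset.single_le_sum (fun j _ => sq_nonneg _)
      (Finset.mem_univ k))
    simp
  rw [h1] at h
  exact (h2.trans h).trans (by gcongr; exact le_abs_self _)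

/-- A strongly convex function grows quadratically away from its minimizer. -/
lemma StrongConvexOn.sq_norm_sub_le {E : Type*} [NormedAddCommGroup E] [NormedSpace ℝ E]
    {f : E → ℝ} {κ : ℝ} (hf : StrongConvexOn Set.univ κ f) {b : E} (hb : IsMinOn f Set.univ b)
    (β : E) : κ / 2 * ‖β - b‖ ^ 2 ≤ f β - f b := by
  -- Strong convexity on the segment from `b` towards `β`, divided by `t`, leaves a factor `1 - t`
  -- that disappears as `t → 0`.
  have h : ∀ t : ℝ, 0 < t → t < 1 → κ / 2 * ‖β - b‖ ^ 2 * (1 - t) ≤ f β - f b := by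
    intro t ht ht1
    have h := hf.2 (Set.mem_univ β) (Set.mem_univ b) ht.le (sub_nonneg.mpr ht1.le) (by ring)
    have h0 : f b ≤ f (t • β + (1 - t) • b) := hb (Set.mem_univ _)
    simp only [smul_eq_mul] at h
    have : t * (κ / 2 * ‖β - b‖ ^ 2 * (1 - t)) ≤ t * (f β - f b) := by linarith
    exact le_of_mul_le_mul_left this ht
  have hlim : Tendsto (fun t : ℝ => κ / 2 * ‖β - b‖ ^ 2 * (1 - t)) (𝓝[>] 0)
      (𝓝 (κ / 2 * ‖β - b‖ ^ 2 * (1 - 0))) :=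
    ((continuous_const.mul (continuous_const.sub continuous_id)).tendsto 0).mono_left
      nhdsWithin_le_nhds
  rw [sub_zero, mul_one] at hlim
  refine le_of_tendsto hlim ?_
  filter_upwards [Ioo_mem_nhdsGT (zero_lt_one' ℝ)] with t ht using h t ht.1 ht.2

lemma RegularizerAssumptions.quadratic_le (hr : RegularizerAssumptions r ν Crr) (β : Param p) :
    ν / 2 * ‖β‖ ^ 2 ≤ regularizer r β := by
  have hmin : IsMinOn (regularizer r) Set.univ 0 := fun β _ => by
    rw [Set.mem_ofPred_eq, hr.zero]
    exact hr.nonneg β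
  simpa [hr.zero] using StrongConvexOn.sq_norm_sub_le hr.strongConvex hmin β

end Components

/-! ### Curvature operators -/

section Curvature

variable {ι : Type*} {p : ℕ}

/-- The operator `u ↦ ∑_{i ∈ S} aᵢ ⟨xᵢ, u⟩ xᵢ + diag(b) u`. -/
def curvature (x : ι → Param p) (S : Finset ι) (a : ι → ℝ) (b : Fin p → ℝ) :
    Param p →L[ℝ] Param p :=
  ∑ i ∈ S, a i • (innerSL ℝ (x i)).smulRight (x i) +
    ∑ k, b k • (EuclideanSpace.proj k : Param p →L[ℝ] ℝ).smulRight (EuclideanSpace.single k (1 : ℝ))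

variable {x : ι → Param p} {S : Finset ι} {a a' : ι → ℝ} {b b' : Fin p → ℝ}

lemma curvature_apply (u : Param p) : curvature x S a b u =
    ∑ i ∈ S, (a i * inner ℝ (x i) u) • x i + WithLp.toLp 2 (fun k => b k * u k) := by
  simp only [curvature, add_apply, sum_apply, smul_apply,
    ContinuousLinearMap.smulRight_apply, innerSL_apply_apply,
    smul_smul]
  congr 1
  ext k
  simp [Finset.sum_apply, Pi.single_apply]

lemma inner_curvature (u v : Param p) : inner ℝ (curvature x S a b u) v =
    ∑ i ∈ S, a i * inner ℝ (x i) u * inner ℝ (x i) v + ∑ k, b k * u k * v k := by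
  rw [curvature_apply, inner_add_left, sum_inner]
  congr 1
  · exact Finset.sum_congr rfl fun i _ => by rw [real_inner_smul_left]
  · rw [PiLp.inner_apply]
    exact Finset.sum_congr rfl fun k _ => by simp [mul_comm]

lemma inner_curvature_comm (u v : Param p) :
    inner ℝ (curvature x S a b u) v = inner ℝ u (curvature x S a b v) := by
  rw [real_inner_comm (curvature x S a b v) u, inner_curvature, inner_curvature]
  congr 1 <;> exact Finset.sum_congr rfl fun _ _ => by ring

/-- Differences of Hessians are again curvature operators over the same vectors, so they can be
estimated entry by entry with `GramBound.norm_curvature_le`. -/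
lemma curvature_sub_apply (u : Param p) : curvature x S a b u - curvature x S a' b' u =
    curvature x S (fun i => a i - a' i) (fun k => b k - b' k) u := by
  refine ext_inner_right ℝ fun v => ?_
  rw [inner_sub_left, inner_curvature, inner_curvature, inner_curvature, add_sub_add_comm,
    ← Finset.sum_sub_distrib, ← Finset.sum_sub_distrib]
  congr 1 <;> exact Finset.sum_congr rfl fun _ _ => by ring

lemma sq_norm_le_inner_curvature {κ : ℝ} (ha : ∀ i ∈ S, 0 ≤ a i) (hb : ∀ k, κ ≤ b k)
    (u : Param p) : κ * ‖u‖ ^ 2 ≤ inner ℝ (curvature x S a b u) u := by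
  rw [inner_curvature, EuclideanSpace.real_norm_sq_eq, Finset.mul_sum]
  have h1 : 0 ≤ ∑ i ∈ S, a i * inner ℝ (x i) u * inner ℝ (x i) u :=
    Finset.sum_nonneg fun i hi => by
      rw [mul_assoc]; exact mul_nonneg (ha i hi) (mul_self_nonneg _)
  have h2 : ∑ k, κ * u k ^ 2 ≤ ∑ k, b k * u k * u k :=
    Finset.sum_le_sum fun k _ => by nlinarith [hb k, sq_nonneg (u k)]
  linarith

lemma norm_le_norm_curvature {κ : ℝ} (ha : ∀ i ∈ S, 0 ≤ a i) (hb : ∀ k, κ ≤ b k)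
    (u : Param p) : κ * ‖u‖ ≤ ‖curvature x S a b u‖ := by
  rcases (norm_nonneg u).eq_or_lt with h | h
  · rw [← h, mul_zero]; exact norm_nonneg _
  · have h1 := (sq_norm_le_inner_curvature (x := x) ha hb u).trans (real_inner_le_norm _ _)
    rw [pow_two, ← mul_assoc] at h1
    exact le_of_mul_le_mul_right h1 h

/-- `ContinuousLinearMap.inverse` takes the value zero at non-invertible operators, so invertibility
must be established: the lower bound gives injectivity, and finite dimension does the rest. -/
lemma curvature_apply_inverse {κ : ℝ} (hκ : 0 < κ) (ha : ∀ i ∈ S, 0 ≤ a i) (hb : ∀ k, κ ≤ b k)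
    (w : Param p) : curvature x S a b ((curvature x S a b).inverse w) = w := by
  have hinj : Function.Injective (curvature x S a b).toLinearMap := by
    rw [← LinearMap.ker_eq_bot, LinearMap.ker_eq_bot']
    intro u hu
    have h := norm_le_norm_curvature (x := x) ha hb u
    rw [show curvature x S a b u = 0 from hu, norm_zero] at h
    exact norm_le_zero_iff.mp (nonpos_of_mul_nonpos_right h hκ)
  let e : Param p ≃L[ℝ] Param p :=
    (LinearEquiv.ofInjectiveEndo _ hinj).toContinuousLinearEquiv
  have he : (e : Param p →L[ℝ] Param p) = curvature x S a b := by
    ext1 u; rfl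
  rw [← he, ContinuousLinearMap.inverse_equiv]
  exact e.apply_symm_apply w

lemma norm_le_of_forall_inner_le {w : Param p} {c : ℝ} (hc : 0 ≤ c)
    (h : ∀ v, inner ℝ w v ≤ c * ‖v‖) : ‖w‖ ≤ c := by
  rcases (norm_nonneg w).eq_or_lt with h0 | h0
  · rwa [← h0]
  · have h1 := h w
    rw [real_inner_self_eq_norm_sq, pow_two] at h1
    exact le_of_mul_le_mul_right h1 h0

/-- The Gram form of the vectors `xᵢ`, `i ∈ S`, is bounded by `K²`. -/
def GramBound (x : ι → Param p) (S : Finset ι) (K : ℝ) : Prop :=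
  ∀ v : Param p, ∑ i ∈ S, inner ℝ (x i) v ^ 2 ≤ K ^ 2 * ‖v‖ ^ 2

lemma GramBound.mono {T : Finset ι} {K : ℝ} (h : GramBound x S K) (hT : T ⊆ S) :
    GramBound x T K := fun v =>
  (Finset.sum_le_sum_of_subset_of_nonneg hT fun _ _ _ => sq_nonneg _).trans (h v)

lemma GramBound.abs_inner_le {K : ℝ} (h : GramBound x S K) (hK : 0 ≤ K) {i : ι} (hi : i ∈ S)
    (v : Param p) : |inner ℝ (x i) v| ≤ K * ‖v‖ := by
  refine abs_le_of_sq_le_sq ?_ (by positivity)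
  rw [mul_pow]
  exact (Finset.single_le_sum (f := fun i => inner ℝ (x i) v ^ 2) (fun _ _ => sq_nonneg _) hi).trans
    (h v)

lemma GramBound.sum_mul_inner_le {K : ℝ} (h : GramBound x S K) (hK : 0 ≤ K) {g : ι → ℝ} {Γ : ℝ}
    (hΓ : 0 ≤ Γ) (hg : ∑ i ∈ S, g i ^ 2 ≤ Γ ^ 2) (v : Param p) :
    ∑ i ∈ S, g i * inner ℝ (x i) v ≤ K * Γ * ‖v‖ := by
  refine (Real.sum_mul_le_sqrt_mul_sqrt _ _ _).trans ?_
  have h1 : √(∑ i ∈ S, g i ^ 2) ≤ Γ := Real.sqrt_le_iff.mpr ⟨hΓ, hg⟩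
  have h2 : √(∑ i ∈ S, inner ℝ (x i) v ^ 2) ≤ K * ‖v‖ :=
    Real.sqrt_le_iff.mpr ⟨by positivity, by rw [mul_pow]; exact h v⟩
  calc _ ≤ Γ * (K * ‖v‖) := by gcongr
    _ = _ := by ring

/-- A matrix and its transpose have the same norm: the Gram bound controls `v ↦ (⟨xᵢ, v⟩)ᵢ`, and by
duality also `g ↦ ∑ gᵢ xᵢ`. -/
lemma GramBound.norm_sum_smul_le {K : ℝ} (h : GramBound x S K) (hK : 0 ≤ K) {g : ι → ℝ} {Γ : ℝ}
    (hΓ : 0 ≤ Γ) (hg : ∑ i ∈ S, g i ^ 2 ≤ Γ ^ 2) : ‖∑ i ∈ S, g i • x i‖ ≤ K * Γ := by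
  refine norm_le_of_forall_inner_le (by positivity) fun v => ?_
  rw [sum_inner]
  simp only [real_inner_smul_left]
  exact h.sum_mul_inner_le hK hΓ hg v

/-- The operator norm of a curvature operator whose entries, multiplied by those of `u`, are
dominated by the entries of `w`. -/
lemma GramBound.norm_curvature_le {K c c' : ℝ} (h : GramBound x S K) (hK : 0 ≤ K) (hc : 0 ≤ c)
    (hc' : 0 ≤ c') {u w : Param p}
    (ha : ∀ i ∈ S, |a i * inner ℝ (x i) u| ≤ c * |inner ℝ (x i) w|)
    (hb : ∀ k, |b k * u k| ≤ c' * |w k|) :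
    ‖curvature x S a b u‖ ≤ (K ^ 2 * c + c') * ‖w‖ := by
  rw [curvature_apply]
  refine (norm_add_le _ _).trans ?_
  rw [add_mul]
  refine add_le_add ?_ ?_
  · have h1 : ∑ i ∈ S, (a i * inner ℝ (x i) u) ^ 2 ≤ (c * K * ‖w‖) ^ 2 := by
      calc ∑ i ∈ S, (a i * inner ℝ (x i) u) ^ 2
          ≤ ∑ i ∈ S, c ^ 2 * inner ℝ (x i) w ^ 2 := Finset.sum_le_sum fun i hi => by
            rw [← sq_abs, ← sq_abs (inner ℝ (x i) w), ← mul_pow]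
            exact pow_le_pow_left₀ (abs_nonneg _) (ha i hi) 2
        _ = c ^ 2 * ∑ i ∈ S, inner ℝ (x i) w ^ 2 := by rw [Finset.mul_sum]
        _ ≤ c ^ 2 * (K ^ 2 * ‖w‖ ^ 2) := by gcongr; exact h w
        _ = _ := by ring
    refine (h.norm_sum_smul_le hK (by positivity) h1).trans (le_of_eq (by ring))
  · rw [EuclideanSpace.norm_eq]
    refine Real.sqrt_le_iff.mpr ⟨by positivity, ?_⟩
    rw [mul_pow, EuclideanSpace.real_norm_sq_eq, Finset.mul_sum]
    refine Finset.sum_le_sum fun k _ => ?_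
    rw [← sq_abs (w k), ← mul_pow, Real.norm_eq_abs]
    exact pow_le_pow_left₀ (abs_nonneg _) (hb k) 2

end Curvature

/-! ### Derivatives of the risk -/

section Risk

variable {n p : ℕ} {ℓ : ℝ → ℝ → ℝ} {C s : ℝ} {r : Fin p → ℝ → ℝ} {ν Crr lam : ℝ}
  {D : Dataset n p} {M N : Finset (Fin n)}

/-- The gradient of the risk. -/
def riskGrad (ℓ : ℝ → ℝ → ℝ) (r : Fin p → ℝ → ℝ) (lam : ℝ)
    (D : Dataset n p) (M : Finset (Fin n)) (β : Param p) : Param p :=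
  ∑ i ∈ Mᶜ, deriv (ℓ (D i).1) (inner ℝ (D i).2 β) • (D i).2 +
    WithLp.toLp 2 (fun k => lam * deriv (r k) (β k))

/-- The Hessian of the risk. -/
def riskHess (ℓ : ℝ → ℝ → ℝ) (r : Fin p → ℝ → ℝ) (lam : ℝ)
    (D : Dataset n p) (M : Finset (Fin n)) (β : Param p) : Param p →L[ℝ] Param p :=
  curvature (fun i => (D i).2) Mᶜ
    (fun i => deriv (deriv (ℓ (D i).1)) (inner ℝ (D i).2 β))
    (fun k => lam * deriv (deriv (r k)) (β k))

lemma hasFDerivAt_regularizer (hr : RegularizerAssumptions r ν Crr) (β : Param p) :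
    HasFDerivAt (regularizer r)
      (∑ k, deriv (r k) (β k) • (EuclideanSpace.proj k : Param p →L[ℝ] ℝ)) β := by
  refine HasFDerivAt.fun_sum fun k _ => ?_
  exact (((hr.differentiable k).1 (β k)).hasDerivAt).comp_hasFDerivAt β
    (EuclideanSpace.proj k : Param p →L[ℝ] ℝ).hasFDerivAt

lemma hasGradientAt_risk (hℓ : LossAssumptions ℓ C s) (hr : RegularizerAssumptions r ν Crr)
    (β : Param p) : HasGradientAt (risk ℓ r lam D M) (riskGrad ℓ r lam D M β) β := by
  rw [hasGradientAt_iff_hasFDerivAt]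
  have h1 : HasFDerivAt (fun β : Param p => ∑ i ∈ Mᶜ, ℓ (D i).1 (inner ℝ (D i).2 β))
      (∑ i ∈ Mᶜ, deriv (ℓ (D i).1) (inner ℝ (D i).2 β) • innerSL ℝ (D i).2) β := by
    refine HasFDerivAt.fun_sum fun i _ => ?_
    exact ((hℓ.differentiable_loss (D i).1 _).hasDerivAt).comp_hasFDerivAt β
      (innerSL ℝ (D i).2).hasFDerivAt
  refine (h1.add ((hasFDerivAt_regularizer hr β).const_mul lam)).congr_fderiv ?_
  ext v
  simp only [riskGrad, add_apply, sum_apply, smul_apply, innerSL_apply_apply, smul_eq_mul,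
    InnerProductSpace.toDual_apply_apply, inner_add_left, sum_inner, real_inner_smul_left]
  congr 1
  rw [PiLp.inner_apply, Finset.mul_sum]
  exact Finset.sum_congr rfl fun k _ => by simp; ring

lemma gradient_risk (hℓ : LossAssumptions ℓ C s) (hr : RegularizerAssumptions r ν Crr) :
    gradient (risk ℓ r lam D M) = riskGrad ℓ r lam D M :=
  funext fun β => (hasGradientAt_risk hℓ hr β).gradient

lemma continuous_risk (hℓ : LossAssumptions ℓ C s) (hr : RegularizerAssumptions r ν Crr) :
    Continuous (risk ℓ r lam D M) :=
  continuous_iff_continuousAt.mpr fun β => (hasGradientAt_risk hℓ hr β).continuousAt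

lemma hasFDerivAt_riskGrad (hℓ : LossAssumptions ℓ C s) (hr : RegularizerAssumptions r ν Crr)
    (β : Param p) : HasFDerivAt (riskGrad ℓ r lam D M) (riskHess ℓ r lam D M β) β := by
  refine HasFDerivAt.add (HasFDerivAt.fun_sum fun i _ => ?_) ?_
  · have h := ((hℓ.differentiable_deriv (D i).1 (inner ℝ (D i).2 β)).hasDerivAt).comp_hasFDerivAt
      β (innerSL ℝ (D i).2).hasFDerivAt
    refine (h.smul_const (D i).2).congr_fderiv ?_
    ext1 v
    simp [smul_smul]
  · have h : HasFDerivAt (fun β : Param p => ∑ k, (lam * deriv (r k) (β k)) •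
        (EuclideanSpace.single k (1 : ℝ) : Param p))
        (∑ k, (lam * deriv (deriv (r k)) (β k)) •
          (EuclideanSpace.proj k : Param p →L[ℝ] ℝ).smulRight (EuclideanSpace.single k (1 : ℝ)))
        β := by
      refine HasFDerivAt.fun_sum fun k _ => ?_
      have h1 := (((hr.differentiable k).2 (β k)).hasDerivAt).comp_hasFDerivAt β
        (EuclideanSpace.proj k : Param p →L[ℝ] ℝ).hasFDerivAt
      refine ((h1.const_mul lam).smul_const
        (EuclideanSpace.single k (1 : ℝ) : Param p)).congr_fderiv ?_
      ext1 v
      simp [smul_smul, mul_assoc]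
    refine h.congr_of_eventuallyEq (Eventually.of_forall fun β => ?_)
    ext k
    simp [Finset.sum_apply, Pi.single_apply]

lemma newtonStep_risk (hℓ : LossAssumptions ℓ C s) (hr : RegularizerAssumptions r ν Crr)
    (β : Param p) : newtonStep (risk ℓ r lam D M) β =
      β - (riskHess ℓ r lam D M β).inverse (riskGrad ℓ r lam D M β) := by
  rw [newtonStep, gradient_risk hℓ hr, (hasFDerivAt_riskGrad hℓ hr β).fderiv]

lemma norm_le_norm_riskHess (hℓ : LossAssumptions ℓ C s) (hr : RegularizerAssumptions r ν Crr)
    (hlam : 0 < lam) (β u : Param p) : lam * ν * ‖u‖ ≤ ‖riskHess ℓ r lam D M β u‖ :=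
  norm_le_norm_curvature (fun _ _ => hℓ.deriv_deriv_nonneg _ _)
    (fun k => mul_le_mul_of_nonneg_left (hr.le_deriv_deriv k _) hlam.le) u

lemma riskHess_apply_inverse (hℓ : LossAssumptions ℓ C s) (hr : RegularizerAssumptions r ν Crr)
    (hlam : 0 < lam) (hν : 0 < ν) (β w : Param p) :
    riskHess ℓ r lam D M β ((riskHess ℓ r lam D M β).inverse w) = w :=
  curvature_apply_inverse (mul_pos hlam hν) (fun _ _ => hℓ.deriv_deriv_nonneg _ _)
    (fun k => mul_le_mul_of_nonneg_left (hr.le_deriv_deriv k _) hlam.le) w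

lemma exists_deriv_mul_sub_eq {f : ℝ → ℝ} (hf : Differentiable ℝ f) (a b : ℝ) :
    ∃ ξ ∈ Set.uIcc a b, f a - f b = deriv f ξ * (a - b) := by
  rcases lt_trichotomy a b with h | rfl | h
  · obtain ⟨c, hc, hc'⟩ := exists_deriv_eq_slope f h hf.continuous.continuousOn
      hf.differentiableOn
    refine ⟨c, Set.Icc_subset_uIcc (Set.Ioo_subset_Icc_self hc), ?_⟩
    rw [hc']
    field_simp [(sub_pos.mpr h).ne']
    ring
  · exact ⟨a, Set.left_mem_uIcc, by simp⟩
  · obtain ⟨c, hc, hc'⟩ := exists_deriv_eq_slope f h hf.continuous.continuousOn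
      hf.differentiableOn
    refine ⟨c, Set.Icc_subset_uIcc' (Set.Ioo_subset_Icc_self hc), ?_⟩
    rw [hc', div_mul_cancel₀ _ (sub_pos.mpr h).ne']

/-- The mean value theorem for the gradient of the risk. -/
lemma exists_riskGrad_sub_eq (hℓ : LossAssumptions ℓ C s) (hr : RegularizerAssumptions r ν Crr)
    (lam : ℝ) (D : Dataset n p) (M : Finset (Fin n)) (β β' : Param p) :
    ∃ (ξ : Fin n → ℝ) (ζ : Fin p → ℝ),
      (∀ i, ξ i ∈ Set.uIcc (inner ℝ (D i).2 β) (inner ℝ (D i).2 β')) ∧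
      (∀ k, ζ k ∈ Set.uIcc (β k) (β' k)) ∧
      riskGrad ℓ r lam D M β - riskGrad ℓ r lam D M β' =
        curvature (fun i => (D i).2) Mᶜ (fun i => deriv (deriv (ℓ (D i).1)) (ξ i))
          (fun k => lam * deriv (deriv (r k)) (ζ k)) (β - β') := by
  -- Each summand gets its own intermediate point. The averaged Hessian is then a curvature operator
  -- whose entries can be compared individually with those of a true Hessian.
  choose ξ hξ hξ' using fun i => exists_deriv_mul_sub_eq (hℓ.differentiable_deriv (D i).1)
    (inner ℝ (D i).2 β) (inner ℝ (D i).2 β')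
  choose ζ hζ hζ' using fun k => exists_deriv_mul_sub_eq (hr.differentiable k).2 (β k) (β' k)
  refine ⟨ξ, ζ, hξ, hζ, ?_⟩
  rw [curvature_apply, riskGrad, riskGrad, add_sub_add_comm, ← Finset.sum_sub_distrib]
  congr 1
  · refine Finset.sum_congr rfl fun i _ => ?_
    rw [← sub_smul, hξ', inner_sub_right]
  · ext k
    simp only [PiLp.sub_apply]
    rw [← mul_sub, hζ']
    ring

lemma norm_sub_le_norm_riskGrad_sub (hℓ : LossAssumptions ℓ C s)
    (hr : RegularizerAssumptions r ν Crr) (hlam : 0 < lam) (β β' : Param p) :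
    lam * ν * ‖β - β'‖ ≤ ‖riskGrad ℓ r lam D M β - riskGrad ℓ r lam D M β'‖ := by
  obtain ⟨ξ, ζ, -, -, h⟩ := exists_riskGrad_sub_eq hℓ hr lam D M β β'
  rw [h]
  exact norm_le_norm_curvature (fun _ _ => hℓ.deriv_deriv_nonneg _ _)
    (fun k => mul_le_mul_of_nonneg_left (hr.le_deriv_deriv k _) hlam.le) _

/-! ### The estimator -/

lemma quadratic_le_risk (hℓ : LossAssumptions ℓ C s) (hr : RegularizerAssumptions r ν Crr)
    (hlam : 0 < lam) (D : Dataset n p) (M : Finset (Fin n)) (β : Param p) :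
    lam * ν / 2 * ‖β‖ ^ 2 ≤ risk ℓ r lam D M β := by
  have h1 : 0 ≤ ∑ i ∈ Mᶜ, ℓ (D i).1 (inner ℝ (D i).2 β) :=
    Finset.sum_nonneg fun i _ => hℓ.nonneg _ _
  have h2 := mul_le_mul_of_nonneg_left (hr.quadratic_le β) hlam.le
  unfold risk
  linarith

lemma isMinOn_estimator (hℓ : LossAssumptions ℓ C s) (hr : RegularizerAssumptions r ν Crr)
    (hlam : 0 < lam) (hν : 0 < ν) (D : Dataset n p) (M : Finset (Fin n)) :
    IsMinOn (risk ℓ r lam D M) Set.univ (estimator ℓ r lam D M) := by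
  have hlim : Tendsto (risk ℓ r lam D M) (cocompact (Param p)) atTop := by
    refine tendsto_atTop_mono (quadratic_le_risk hℓ hr hlam D M) ?_
    exact ((tendsto_pow_atTop two_ne_zero).comp
      (tendsto_norm_cocompact_atTop (E := Param p))).const_mul_atTop (by positivity)
  obtain ⟨β, hβ⟩ := (continuous_risk hℓ hr).exists_forall_le hlim
  exact Classical.epsilon_spec (p := fun β => IsMinOn (risk ℓ r lam D M) Set.univ β)
    ⟨β, fun β' _ => hβ β'⟩

lemma riskGrad_estimator (hℓ : LossAssumptions ℓ C s) (hr : RegularizerAssumptions r ν Crr)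
    (hlam : 0 < lam) (hν : 0 < ν) (D : Dataset n p) (M : Finset (Fin n)) :
    riskGrad ℓ r lam D M (estimator ℓ r lam D M) = 0 := by
  have h := (isMinOn_estimator hℓ hr hlam hν D M).isLocalMin univ_mem
  have h' := h.hasFDerivAt_eq_zero
    (hasGradientAt_iff_hasFDerivAt.mp (hasGradientAt_risk hℓ hr (estimator ℓ r lam D M)))
  exact (map_eq_zero_iff _ (InnerProductSpace.toDual ℝ (Param p)).injective).mp h'

/-- Comparison with the risk at `0`, where the regularizer vanishes. The squared norm is of order
`n`, which the covariance scale `1 / p` turns into predictions of polylogarithmic size. -/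
lemma sq_norm_estimator_le (hℓ : LossAssumptions ℓ C s) (hr : RegularizerAssumptions r ν Crr)
    (hlam : 0 < lam) (hν : 0 < ν) {Y : ℝ} (hY : 0 ≤ Y) (hy : ∀ i, |(D i).1| ≤ Y)
    (M : Finset (Fin n)) :
    lam * ν / 2 * ‖estimator ℓ r lam D M‖ ^ 2 ≤ n * growthBound C s Y 0 := by
  have h0 : 0 ≤ growthBound C s Y 0 := growthBound_nonneg hℓ.C_pos hY le_rfl
  calc _ ≤ risk ℓ r lam D M (estimator ℓ r lam D M) := quadratic_le_risk hℓ hr hlam D M _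
    _ ≤ risk ℓ r lam D M 0 := isMinOn_estimator hℓ hr hlam hν D M (Set.mem_univ 0)
    _ = ∑ i ∈ Mᶜ, ℓ (D i).1 0 := by simp [risk, hr.zero]
    _ ≤ ∑ i ∈ Mᶜ, growthBound C s Y 0 :=
        Finset.sum_le_sum fun i _ => hℓ.loss_le (hy i) (by simp)
    _ ≤ ∑ i : Fin n, growthBound C s Y 0 :=
        Finset.sum_le_sum_of_subset_of_nonneg (Finset.subset_univ _) fun _ _ _ => h0
    _ = _ := by simp

lemma riskGrad_eq_add_of_subset (hNM : N ⊆ M) (β : Param p) :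
    riskGrad ℓ r lam D N β = riskGrad ℓ r lam D M β +
      ∑ j ∈ M \ N, deriv (ℓ (D j).1) (inner ℝ (D j).2 β) • (D j).2 := by
  have h : Nᶜ = Mᶜ ∪ (M \ N) := by
    ext i
    simp only [Finset.mem_compl, Finset.mem_union, Finset.mem_sdiff]
    have := @hNM i
    tauto
  have hd : Disjoint Mᶜ (M \ N) := Finset.disjoint_left.mpr fun i hi hi' =>
    (Finset.mem_compl.mp hi) (Finset.mem_sdiff.mp hi').1
  rw [riskGrad, h, Finset.sum_union hd, riskGrad]
  abel

lemma sum_sq_le_of_abs_le {ι : Type*} {S : Finset ι} {g : ι → ℝ} {B : ℝ}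
    (hg : ∀ j ∈ S, |g j| ≤ B) : ∑ j ∈ S, g j ^ 2 ≤ (B * √(S.card)) ^ 2 := by
  rw [mul_pow, Real.sq_sqrt (Nat.cast_nonneg _), mul_comm, ← nsmul_eq_mul]
  refine Finset.sum_le_card_nsmul _ _ _ fun j hj => ?_
  rw [← sq_abs]
  exact pow_le_pow_left₀ (abs_nonneg _) (hg j hj) 2

/-- Stability of the estimator under further removals; the derivatives of the loss at the removed
observations are bounded at the first estimator. -/
lemma norm_estimator_sub_le (hℓ : LossAssumptions ℓ C s) (hr : RegularizerAssumptions r ν Crr)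
    (hlam : 0 < lam) (hν : 0 < ν) {K B : ℝ} (hK : 0 ≤ K) (hB : 0 ≤ B)
    (hX : GramBound (fun i => (D i).2) Finset.univ K) (hNM : N ⊆ M)
    (hg : ∀ j ∈ M \ N, |deriv (ℓ (D j).1) (inner ℝ (D j).2 (estimator ℓ r lam D N))| ≤ B) :
    lam * ν * ‖estimator ℓ r lam D N - estimator ℓ r lam D M‖ ≤
      K * (B * √((M \ N).card)) := by
  refine (norm_sub_le_norm_riskGrad_sub (D := D) (M := M) hℓ hr hlam _ _).trans ?_
  have h1 := riskGrad_eq_add_of_subset (ℓ := ℓ) (r := r) (lam := lam) (D := D) hNM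
    (estimator ℓ r lam D N)
  rw [riskGrad_estimator hℓ hr hlam hν D N] at h1
  rw [riskGrad_estimator hℓ hr hlam hν D M, sub_zero, eq_neg_of_add_eq_zero_left h1.symm, norm_neg]
  exact (hX.mono (Finset.subset_univ _)).norm_sum_smul_le hK (by positivity)
    (sum_sq_le_of_abs_le hg)

/-- Stability of the estimator under further removals; the derivatives of the loss at the removed
observations are bounded at the second estimator. -/
lemma norm_estimator_sub_le' (hℓ : LossAssumptions ℓ C s) (hr : RegularizerAssumptions r ν Crr)
    (hlam : 0 < lam) (hν : 0 < ν) {K B : ℝ} (hK : 0 ≤ K) (hB : 0 ≤ B)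
    (hX : GramBound (fun i => (D i).2) Finset.univ K) (hNM : N ⊆ M)
    (hg : ∀ j ∈ M \ N, |deriv (ℓ (D j).1) (inner ℝ (D j).2 (estimator ℓ r lam D M))| ≤ B) :
    lam * ν * ‖estimator ℓ r lam D M - estimator ℓ r lam D N‖ ≤
      K * (B * √((M \ N).card)) := by
  refine (norm_sub_le_norm_riskGrad_sub (D := D) (M := N) hℓ hr hlam _ _).trans ?_
  have h1 := riskGrad_eq_add_of_subset (ℓ := ℓ) (r := r) (lam := lam) (D := D) hNM
    (estimator ℓ r lam D M)
  rw [riskGrad_estimator hℓ hr hlam hν D M, zero_add] at h1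
  rw [riskGrad_estimator hℓ hr hlam hν D N, sub_zero, h1]
  exact (hX.mono (Finset.subset_univ _)).norm_sum_smul_le hK (by positivity)
    (sum_sq_le_of_abs_le hg)

end Risk

/-! ### Removal of observations and Newton steps on a well-behaved data set -/

section Removal

variable {n p : ℕ} {ℓ : ℝ → ℝ → ℝ} {C s : ℝ} {r : Fin p → ℝ → ℝ} {ν Crr lam : ℝ}
  {D : Dataset n p} {M N : Finset (Fin n)}

/-- `H⁻¹ w` for the Hessian `H` of the risk without `M` at its minimizer. -/
def influence (ℓ : ℝ → ℝ → ℝ) (r : Fin p → ℝ → ℝ) (lam : ℝ)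
    (D : Dataset n p) (M : Finset (Fin n)) (w : Param p) : Param p :=
  (riskHess ℓ r lam D M (estimator ℓ r lam D M)).inverse w

/-- The constant in the perturbation bounds for Hessians, relative to the strong convexity
constant. -/
def hessianRatio (K G lam ν Crr : ℝ) : ℝ := (K ^ 2 * G + lam * |Crr|) / (lam * ν)

lemma hessianRatio_nonneg {K G : ℝ} (hlam : 0 < lam) (hν : 0 < ν) (hG : 0 ≤ G) :
    0 ≤ hessianRatio K G lam ν Crr := by
  unfold hessianRatio
  positivity

lemma abs_le_of_mem_uIcc {a b z Z : ℝ} (hz : z ∈ Set.uIcc a b) (ha : |a| ≤ Z) (hb : |b| ≤ Z) :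
    |z| ≤ Z :=
  abs_le.mpr (Set.uIcc_subset_Icc (abs_le.mp ha) (abs_le.mp hb) hz)

lemma EuclideanSpace.abs_apply_le_norm (u : Param p) (k : Fin p) : |u k| ≤ ‖u‖ := by
  simpa using PiLp.norm_apply_le u k

/-- The difference of the estimators without `N` and without `M ⊇ N` is, up to a small remainder,
the influence of the observations in `M \ N`. -/
lemma exists_estimator_sub_eq (hℓ : LossAssumptions ℓ C s) (hr : RegularizerAssumptions r ν Crr)
    (hlam : 0 < lam) (hν : 0 < ν) {K B Y Z η : ℝ} (hK : 0 ≤ K) (hB : 0 ≤ B) (hη : 0 ≤ η)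
    (hY : 0 ≤ Y) (hZ : 0 ≤ Z) (hy : ∀ i, |(D i).1| ≤ Y)
    (hX : GramBound (fun i => (D i).2) Finset.univ K) (hNM : N ⊆ M)
    (hN : ∀ i ∉ M, |inner ℝ (D i).2 (estimator ℓ r lam D N)| ≤ Z)
    (hM : ∀ i ∉ M, |inner ℝ (D i).2 (estimator ℓ r lam D M)| ≤ Z)
    (hg : ∀ j ∈ M \ N, |deriv (ℓ (D j).1) (inner ℝ (D j).2 (estimator ℓ r lam D N))| ≤ B)
    (hobs : ∀ k ∉ M, ∑ j ∈ M, inner ℝ (D j).2 (influence ℓ r lam D M (D k).2) ^ 2 ≤ η ^ 2)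
    (hcoord : ∀ k, ∑ j ∈ M, inner ℝ (D j).2
      (influence ℓ r lam D M (EuclideanSpace.single k 1)) ^ 2 ≤ η ^ 2) :
    ∃ v w : Param p, estimator ℓ r lam D N - estimator ℓ r lam D M = w - v ∧
      (∀ k ∉ M, |inner ℝ (D k).2 v| ≤ η * (B * √((M \ N).card))) ∧
      (∀ k, |v k| ≤ η * (B * √((M \ N).card))) ∧
      ‖w‖ ≤ hessianRatio K (growthBound C s Y Z) lam ν Crr *
        (K * (B * √((M \ N).card)) / (lam * ν)) * (η * (B * √((M \ N).card))) := by
  set Γ := B * √((M \ N).card) with hΓ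
  have hΛ : 0 < lam * ν := mul_pos hlam hν
  have hΓ0 : 0 ≤ Γ := by positivity
  set G := growthBound C s Y Z
  have hG : 0 ≤ G := growthBound_nonneg hℓ.C_pos hY hZ
  set β := estimator ℓ r lam D N
  set β' := estimator ℓ r lam D M
  set g : Fin n → ℝ := fun j => deriv (ℓ (D j).1) (inner ℝ (D j).2 β)
  set x : Fin n → Param p := fun i => (D i).2
  set y : Param p := ∑ j ∈ M \ N, g j • x j
  -- The linear response to the removal. The Hessian is taken at the second estimator, which does
  -- not involve the observations in `M`.
  set v : Param p := (riskHess ℓ r lam D M β').inverse y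
  have hv : riskHess ℓ r lam D M β' v = y := riskHess_apply_inverse hℓ hr hlam hν β' y
  -- pairing with `v` is controlled by the influence vectors
  have hpair : ∀ (z : Param p), ∑ j ∈ M, inner ℝ (x j) (influence ℓ r lam D M z) ^ 2 ≤ η ^ 2 →
      |inner ℝ z v| ≤ η * Γ := by
    intro z hz
    set u := influence ℓ r lam D M z
    have hu : riskHess ℓ r lam D M β' u = z := riskHess_apply_inverse hℓ hr hlam hν β' z
    -- Symmetry of the Hessian moves the inverse from the removed features to `z`; Cauchy–Schwarz
    -- then separates the slopes `g` from the influences.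
    have h1 : inner ℝ z v = ∑ j ∈ M \ N, g j * inner ℝ (x j) u := by
      rw [← hu, riskHess, inner_curvature_comm, ← riskHess, hv, real_inner_comm, sum_inner]
      exact Finset.sum_congr rfl fun j _ => by rw [real_inner_smul_left]
    rw [h1]
    refine abs_le_of_sq_le_sq ?_ (by positivity)
    refine (Finset.sum_mul_sq_le_sq_mul_sq _ _ _).trans ?_
    rw [mul_pow, mul_comm]
    have h2 : ∑ j ∈ M \ N, inner ℝ (x j) u ^ 2 ≤ η ^ 2 :=
      (Finset.sum_le_sum_of_subset_of_nonneg Finset.sdiff_subset fun _ _ _ => sq_nonneg _).trans hz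
    have h3 : ∑ j ∈ M \ N, g j ^ 2 ≤ Γ ^ 2 := sum_sq_le_of_abs_le hg
    exact mul_le_mul h2 h3 (Finset.sum_nonneg fun _ _ => sq_nonneg _) (sq_nonneg _)
  have hv1 : ∀ k ∉ M, |inner ℝ (x k) v| ≤ η * Γ := fun k hk => hpair _ (hobs k hk)
  have hv2 : ∀ k, |v k| ≤ η * Γ := fun k => by
    simpa [EuclideanSpace.inner_single_left] using hpair _ (hcoord k)
  refine ⟨v, β - β' + v, by abel, hv1, hv2, ?_⟩
  obtain ⟨ξ, ζ, hξ, hζ, hmv⟩ := exists_riskGrad_sub_eq hℓ hr lam D M β β'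
  have hgrad : riskGrad ℓ r lam D M β = -y := by
    have h1 := riskGrad_eq_add_of_subset (ℓ := ℓ) (r := r) (lam := lam) (D := D) hNM β
    rw [riskGrad_estimator hℓ hr hlam hν D N] at h1
    exact eq_neg_of_add_eq_zero_left h1.symm
  rw [hgrad, riskGrad_estimator hℓ hr hlam hν D M, sub_zero] at hmv
  set Hbar := curvature x Mᶜ (fun i => deriv (deriv (ℓ (D i).1)) (ξ i))
    (fun k => lam * deriv (deriv (r k)) (ζ k))
  have hδ : lam * ν * ‖β - β'‖ ≤ K * Γ := norm_estimator_sub_le hℓ hr hlam hν hK hB hX hNM hg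
  -- The averaged Hessian sends `β - β'` to `-y` and the Hessian at `β'` sends `v` to `y`, so only
  -- the change of the Hessian acting on `v` is left.
  have hw : Hbar (β - β' + v) = Hbar v - riskHess ℓ r lam D M β' v := by
    rw [map_add, ← hmv, hv]
    abel
  have hw' : lam * ν * ‖β - β' + v‖ ≤ (K ^ 2 * (G * (η * Γ)) + lam * |Crr| * (η * Γ)) *
      ‖β - β'‖ := by
    refine (norm_le_norm_curvature (x := x) (S := Mᶜ) (fun i _ => hℓ.deriv_deriv_nonneg (D i).1 (ξ i))
      (fun k => mul_le_mul_of_nonneg_left (hr.le_deriv_deriv k (ζ k)) hlam.le) _).trans ?_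
    change ‖Hbar _‖ ≤ _
    rw [hw, riskHess, curvature_sub_apply]
    -- The Hessian entries change in proportion to the predictors and coordinates of `β - β'`, and
    -- those of `v` are uniformly at most `η * Γ`. The product costs one sup norm and one Euclidean
    -- norm.
    refine (hX.mono (Finset.subset_univ _)).norm_curvature_le hK (by positivity) (by positivity)
      (fun i hi => ?_) (fun k => ?_)
    · have hiM := Finset.mem_compl.mp hi
      have h1 : |deriv (deriv (ℓ (D i).1)) (ξ i) - deriv (deriv (ℓ (D i).1)) (inner ℝ (D i).2 β')| ≤
          G * |inner ℝ (x i) (β - β')| := by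
        refine (hℓ.abs_deriv_deriv_sub_le (hy i)
          (abs_le_of_mem_uIcc (hξ i) (hN i hiM) (hM i hiM)) (hM i hiM)).trans ?_
        refine mul_le_mul_of_nonneg_left ?_ (by positivity)
        rw [inner_sub_right, abs_sub_comm, abs_sub_comm (inner ℝ (x i) β)]
        exact Set.abs_sub_right_of_mem_uIcc (hξ i)
      rw [abs_mul]
      calc _ ≤ G * |inner ℝ (x i) (β - β')| * (η * Γ) :=
            mul_le_mul h1 (hv1 i hiM) (abs_nonneg _) (by positivity)
        _ = _ := by ring
    · have h1 : |lam * deriv (deriv (r k)) (ζ k) - lam * deriv (deriv (r k)) (β' k)| ≤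
          lam * |Crr| * |(β - β') k| := by
        rw [← mul_sub, abs_mul, abs_of_pos hlam, mul_assoc]
        gcongr
        refine (hr.abs_deriv_deriv_sub_le k _ _).trans ?_
        refine mul_le_mul_of_nonneg_left ?_ (by positivity)
        rw [PiLp.sub_apply, abs_sub_comm, abs_sub_comm (β k)]
        exact Set.abs_sub_right_of_mem_uIcc (hζ k)
      rw [abs_mul]
      calc _ ≤ lam * |Crr| * |(β - β') k| * (η * Γ) :=
            mul_le_mul h1 (hv2 k) (abs_nonneg _) (by positivity)
        _ = _ := by ring
  have hδ' : ‖β - β'‖ ≤ K * Γ / (lam * ν) := (le_div_iff₀' hΛ).mpr hδ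
  have h3 : ‖β - β' + v‖ ≤ ((K ^ 2 * (G * (η * Γ)) + lam * |Crr| * (η * Γ)) *
      ‖β - β'‖) / (lam * ν) := (le_div_iff₀' hΛ).mpr hw'
  calc _ ≤ _ := h3
    _ ≤ ((K ^ 2 * (G * (η * Γ)) + lam * |Crr| * (η * Γ)) * (K * Γ / (lam * ν))) / (lam * ν) := by
        gcongr
    _ = _ := by unfold hessianRatio; ring

/-- The error of a Newton step in terms of a small curvature operator. -/
lemma exists_newtonStep_sub_le (hℓ : LossAssumptions ℓ C s) (hr : RegularizerAssumptions r ν Crr)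
    (hlam : 0 < lam) (hν : 0 < ν) {Y Z : ℝ} (hy : ∀ i, |(D i).1| ≤ Y) (hY : 0 ≤ Y) (hZ : 0 ≤ Z)
    {β : Param p} (hβ : ∀ i ∉ M, |inner ℝ (D i).2 β| ≤ Z)
    (hM : ∀ i ∉ M, |inner ℝ (D i).2 (estimator ℓ r lam D M)| ≤ Z) :
    ∃ (d : Fin n → ℝ) (e : Fin p → ℝ),
      (∀ i ∈ Mᶜ, |d i| ≤ growthBound C s Y Z *
        |inner ℝ (D i).2 (β - estimator ℓ r lam D M)|) ∧
      (∀ k, |e k| ≤ lam * |Crr| * |(β - estimator ℓ r lam D M) k|) ∧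
      lam * ν * ‖newtonStep (risk ℓ r lam D M) β - estimator ℓ r lam D M‖ ≤
        ‖curvature (fun i => (D i).2) Mᶜ d e (β - estimator ℓ r lam D M)‖ := by
  have hG : 0 ≤ growthBound C s Y Z := growthBound_nonneg hℓ.C_pos hY hZ
  set β' := estimator ℓ r lam D M
  obtain ⟨ξ, ζ, hξ, hζ, hmv⟩ := exists_riskGrad_sub_eq hℓ hr lam D M β β'
  refine ⟨fun i => deriv (deriv (ℓ (D i).1)) (inner ℝ (D i).2 β) - deriv (deriv (ℓ (D i).1)) (ξ i),
    fun k => lam * deriv (deriv (r k)) (β k) - lam * deriv (deriv (r k)) (ζ k), ?_, ?_, ?_⟩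
  · intro i hi
    have hiM := Finset.mem_compl.mp hi
    refine (hℓ.abs_deriv_deriv_sub_le (hy i) (hβ i hiM)
      (abs_le_of_mem_uIcc (hξ i) (hβ i hiM) (hM i hiM))).trans ?_
    refine mul_le_mul_of_nonneg_left ?_ (by positivity)
    rw [inner_sub_right, abs_sub_comm, abs_sub_comm (inner ℝ (D i).2 β) (inner ℝ (D i).2 β')]
    exact Set.abs_sub_left_of_mem_uIcc (hξ i)
  · intro k
    beta_reduce
    rw [← mul_sub, abs_mul, abs_of_pos hlam, mul_assoc]
    gcongr
    refine (hr.abs_deriv_deriv_sub_le k _ _).trans ?_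
    refine mul_le_mul_of_nonneg_left ?_ (by positivity)
    rw [PiLp.sub_apply, abs_sub_comm, abs_sub_comm (β k) (β' k)]
    exact Set.abs_sub_left_of_mem_uIcc (hζ k)
  -- As the gradient vanishes at `β'`, the Hessian at `β` maps the new error to the difference of
  -- that Hessian and the averaged one, applied to the old error.
  · rw [← curvature_sub_apply, ← hmv, riskGrad_estimator hℓ hr hlam hν D M, sub_zero,
      newtonStep_risk hℓ hr]
    refine (norm_le_norm_riskHess (D := D) (M := M) hℓ hr hlam β _).trans (le_of_eq ?_)
    rw [sub_right_comm, map_sub, riskHess_apply_inverse hℓ hr hlam hν, riskHess]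

/-- Quadratic convergence of Newton's method. -/
lemma norm_newtonStep_sub_le (hℓ : LossAssumptions ℓ C s) (hr : RegularizerAssumptions r ν Crr)
    (hlam : 0 < lam) (hν : 0 < ν) {K Y Z : ℝ} (hK : 1 ≤ K) (hy : ∀ i, |(D i).1| ≤ Y)
    (hX : GramBound (fun i => (D i).2) Finset.univ K) (hY : 0 ≤ Y) (hZ : 0 ≤ Z)
    {β : Param p} (hβ : ∀ i ∉ M, |inner ℝ (D i).2 β| ≤ Z)
    (hM : ∀ i ∉ M, |inner ℝ (D i).2 (estimator ℓ r lam D M)| ≤ Z) :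
    ‖newtonStep (risk ℓ r lam D M) β - estimator ℓ r lam D M‖ ≤
      K * hessianRatio K (growthBound C s Y Z) lam ν Crr * ‖β - estimator ℓ r lam D M‖ ^ 2 := by
  have hG : 0 ≤ growthBound C s Y Z := growthBound_nonneg hℓ.C_pos hY hZ
  have hΛ : 0 < lam * ν := mul_pos hlam hν
  have hK0 : 0 ≤ K := zero_le_one.trans hK
  obtain ⟨d, e, hd, he, h⟩ := exists_newtonStep_sub_le hℓ hr hlam hν hy hY hZ hβ hM
  set β' := estimator ℓ r lam D M
  -- The assumption `1 ≤ K` allows the same bound `K * ‖β - β'‖` for the predictors and for the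
  -- coordinates of the error.
  have h1 : ‖curvature (fun i => (D i).2) Mᶜ d e (β - β')‖ ≤
      (K ^ 2 * (growthBound C s Y Z * (K * ‖β - β'‖)) + lam * |Crr| * (K * ‖β - β'‖)) *
        ‖β - β'‖ := by
    refine (hX.mono (Finset.subset_univ _)).norm_curvature_le hK0 (by positivity) (by positivity)
      (fun i hi => ?_) (fun k => ?_)
    · rw [abs_mul]
      gcongr
      refine (hd i hi).trans ?_
      gcongr
      exact hX.abs_inner_le hK0 (Finset.mem_univ i) _
    · rw [abs_mul]
      gcongr
      refine (he k).trans ?_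
      gcongr
      exact (EuclideanSpace.abs_apply_le_norm _ k).trans (le_mul_of_one_le_left (norm_nonneg _) hK)
  have h2 := (le_div_iff₀' hΛ).mpr (h.trans h1)
  refine h2.trans (le_of_eq ?_)
  unfold hessianRatio
  ring

/-- The error of the first Newton step, when the difference of the starting point and the estimator
is `w - v` with `v` spread out and `w` small. -/
lemma norm_newtonStep_sub_le_of_eq_sub (hℓ : LossAssumptions ℓ C s)
    (hr : RegularizerAssumptions r ν Crr) (hlam : 0 < lam) (hν : 0 < ν) {K Y Z θ : ℝ} (hK : 1 ≤ K)
    (hθ : 0 ≤ θ) (hy : ∀ i, |(D i).1| ≤ Y)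
    (hX : GramBound (fun i => (D i).2) Finset.univ K) (hY : 0 ≤ Y) (hZ : 0 ≤ Z)
    {β : Param p} (hβ : ∀ i ∉ M, |inner ℝ (D i).2 β| ≤ Z)
    (hM : ∀ i ∉ M, |inner ℝ (D i).2 (estimator ℓ r lam D M)| ≤ Z) {v w : Param p}
    (hvw : β - estimator ℓ r lam D M = w - v) (hv : ∀ i ∉ M, |inner ℝ (D i).2 v| ≤ θ)
    (hv' : ∀ k, |v k| ≤ θ) :
    ‖newtonStep (risk ℓ r lam D M) β - estimator ℓ r lam D M‖ ≤
      hessianRatio K (growthBound C s Y Z) lam ν Crr *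
        ((θ + K * ‖w‖) * ‖w‖ + θ * ‖β - estimator ℓ r lam D M‖) := by
  have hG : 0 ≤ growthBound C s Y Z := growthBound_nonneg hℓ.C_pos hY hZ
  have hΛ : 0 < lam * ν := mul_pos hlam hν
  have hK0 : 0 ≤ K := zero_le_one.trans hK
  obtain ⟨d, e, hd, he, h⟩ := exists_newtonStep_sub_le hℓ hr hlam hν hy hY hZ hβ hM
  set β' := estimator ℓ r lam D M
  have hδ1 : ∀ i ∉ M, |inner ℝ (D i).2 (β - β')| ≤ θ + K * ‖w‖ := fun i hi => by
    rw [hvw, inner_sub_right]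
    have h1 := hX.abs_inner_le hK0 (Finset.mem_univ i) w
    exact (abs_sub _ _).trans (by linarith [hv i hi])
  have hδ2 : ∀ k, |(β - β') k| ≤ θ + K * ‖w‖ := fun k => by
    rw [hvw, PiLp.sub_apply]
    have h1 := (EuclideanSpace.abs_apply_le_norm w k).trans
      (le_mul_of_one_le_left (norm_nonneg w) hK)
    exact (abs_sub _ _).trans (by linarith [hv' k])
  have hXM := hX.mono (Finset.subset_univ Mᶜ)
  -- The small part `w` is measured in the Euclidean norm against the sup norm of the error; for the
  -- spread-out part `v` below, the roles are exchanged.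
  have h1 : ‖curvature (fun i => (D i).2) Mᶜ d e w‖ ≤
      (K ^ 2 * (growthBound C s Y Z * (θ + K * ‖w‖)) + lam * |Crr| * (θ + K * ‖w‖)) * ‖w‖ := by
    refine hXM.norm_curvature_le hK0 (by positivity) (by positivity)
      (fun i hi => ?_) (fun k => ?_)
    · rw [abs_mul]
      gcongr
      refine (hd i hi).trans ?_
      gcongr
      exact hδ1 i (Finset.mem_compl.mp hi)
    · rw [abs_mul]
      gcongr
      refine (he k).trans ?_
      gcongr
      exact hδ2 k
  have h2 : ‖curvature (fun i => (D i).2) Mᶜ d e v‖ ≤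
      (K ^ 2 * (growthBound C s Y Z * θ) + lam * |Crr| * θ) * ‖β - β'‖ := by
    refine hXM.norm_curvature_le hK0 (by positivity) (by positivity)
      (fun i hi => ?_) (fun k => ?_)
    · rw [abs_mul]
      calc _ ≤ growthBound C s Y Z * |inner ℝ (D i).2 (β - β')| * θ :=
            mul_le_mul (hd i hi) (hv i (Finset.mem_compl.mp hi)) (abs_nonneg _) (by positivity)
        _ = _ := by ring
    · rw [abs_mul]
      calc _ ≤ lam * |Crr| * |(β - β') k| * θ :=
            mul_le_mul (he k) (hv' k) (abs_nonneg _) (by positivity)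
        _ = _ := by ring
  have h3 : ‖curvature (fun i => (D i).2) Mᶜ d e (β - β')‖ ≤
      ‖curvature (fun i => (D i).2) Mᶜ d e w‖ + ‖curvature (fun i => (D i).2) Mᶜ d e v‖ := by
    rw [hvw, map_sub]
    exact norm_sub_le _ _
  have h4 := (le_div_iff₀' hΛ).mpr (h.trans (h3.trans (add_le_add h1 h2)))
  refine h4.trans (le_of_eq ?_)
  unfold hessianRatio
  ring

end Removal

/-! ### Tame data sets: bounded predictors after removal and the error of Newton's method -/

section Tame

variable {n p : ℕ} {ℓ : ℝ → ℝ → ℝ} {C s : ℝ} {r : Fin p → ℝ → ℝ} {ν Crr lam : ℝ}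
  {D : Dataset n p} {M N : Finset (Fin n)}

/-- A data set with bounded responses and design matrix, bounded leave-one-out predictors, and
for which removed observations have little influence in the direction of the remaining ones and
of the coordinate axes. -/
structure IsTame (ℓ : ℝ → ℝ → ℝ) (r : Fin p → ℝ → ℝ) (lam K Y A θ : ℝ) (D : Dataset n p) :
    Prop where
  response_le : ∀ i, |(D i).1| ≤ Y
  gram : GramBound (fun i => (D i).2) Finset.univ K
  leaveOneOut_le : ∀ i, |inner ℝ (D i).2 (estimator ℓ r lam D {i})| ≤ A
  influence_obs_le : ∀ M : Finset (Fin n), ∀ k ∉ M,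
    ∑ j ∈ M, inner ℝ (D j).2 (influence ℓ r lam D M (D k).2) ^ 2 ≤ θ ^ 2 * (M.card + 1)
  influence_coord_le : ∀ (M : Finset (Fin n)) (k : Fin p),
    ∑ j ∈ M, inner ℝ (D j).2 (influence ℓ r lam D M (EuclideanSpace.single k 1)) ^ 2 ≤
      θ ^ 2 * (M.card + 1)

/-- A bound for the fitted values on a tame data set. -/
def fitBound (C s lam ν K Y A : ℝ) : ℝ := A + K * (K * growthBound C s Y A) / (lam * ν) + 1

/-- A bound for the derivatives of the loss at the fitted values on a tame data set. -/
def slopeBound (C s lam ν K Y A : ℝ) : ℝ := growthBound C s Y (fitBound C s lam ν K Y A)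

/-- A bound for the linear predictors near the estimators on a tame data set. -/
def rangeBound (C s lam ν K Y A : ℝ) : ℝ :=
  fitBound C s lam ν K Y A + K * (K * slopeBound C s lam ν K Y A) / (lam * ν) + K

/-- The relative perturbation constant for Hessians on a tame data set. -/
def ratioBound (C s lam ν K Y A Crr : ℝ) : ℝ :=
  hessianRatio K (growthBound C s Y (rangeBound C s lam ν K Y A)) lam ν Crr

/-- The amplification of predictors along a chain of removals. -/
def chainFactor (C s lam ν K Y A Crr : ℝ) : ℝ :=
  slopeBound C s lam ν K Y A + K ^ 2 * ratioBound C s lam ν K Y A Crr *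
    slopeBound C s lam ν K Y A ^ 2 / (lam * ν)

/-- The factor in the error of Newton's method. -/
def newtonFactor (C s lam ν K Y A Crr : ℝ) : ℝ :=
  (K * ratioBound C s lam ν K Y A Crr + 1) *
    (ratioBound C s lam ν K Y A Crr * (K * slopeBound C s lam ν K Y A ^ 2 / (lam * ν)) *
      ((1 + K) * ratioBound C s lam ν K Y A Crr + 1))

/-! ### Signs and ordering of the constants of a tame data set -/

section Bounds

variable {K Y A : ℝ}

lemma le_fitBound (hC : 0 < C) (hlam : 0 < lam) (hν : 0 < ν) (hK : 1 ≤ K) (hY : 0 ≤ Y)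
    (hA : 0 ≤ A) : A + K * (K * growthBound C s Y A) / (lam * ν) + 1 ≤ fitBound C s lam ν K Y A ∧
      1 ≤ fitBound C s lam ν K Y A := by
  have := growthBound_nonneg (s := s) hC hY hA
  refine ⟨le_rfl, ?_⟩
  have h1 : 0 ≤ A + K * (K * growthBound C s Y A) / (lam * ν) := by positivity
  unfold fitBound
  linarith

lemma slopeBound_nonneg (hC : 0 < C) (hlam : 0 < lam) (hν : 0 < ν) (hK : 1 ≤ K) (hY : 0 ≤ Y)
    (hA : 0 ≤ A) : 0 ≤ slopeBound C s lam ν K Y A :=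
  growthBound_nonneg hC hY (zero_le_one.trans (le_fitBound hC hlam hν hK hY hA).2)

lemma le_rangeBound (hC : 0 < C) (hlam : 0 < lam) (hν : 0 < ν) (hK : 1 ≤ K) (hY : 0 ≤ Y)
    (hA : 0 ≤ A) :
    fitBound C s lam ν K Y A + K * (K * slopeBound C s lam ν K Y A) / (lam * ν) ≤
      rangeBound C s lam ν K Y A ∧
    fitBound C s lam ν K Y A + K ≤ rangeBound C s lam ν K Y A ∧
    fitBound C s lam ν K Y A ≤ rangeBound C s lam ν K Y A ∧
    0 ≤ rangeBound C s lam ν K Y A := by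
  have h1 := slopeBound_nonneg (s := s) hC hlam hν hK hY hA
  have h2 := (le_fitBound (s := s) hC hlam hν hK hY hA).2
  have h3 : 0 ≤ K * (K * slopeBound C s lam ν K Y A) / (lam * ν) := by positivity
  unfold rangeBound
  exact ⟨by linarith, by linarith, by linarith, by linarith⟩

lemma ratioBound_nonneg (hC : 0 < C) (hlam : 0 < lam) (hν : 0 < ν) (hK : 1 ≤ K) (hY : 0 ≤ Y)
    (hA : 0 ≤ A) : 0 ≤ ratioBound C s lam ν K Y A Crr :=
  hessianRatio_nonneg hlam hν
    (growthBound_nonneg hC hY (le_rangeBound hC hlam hν hK hY hA).2.2.2)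

lemma chainFactor_nonneg (hC : 0 < C) (hlam : 0 < lam) (hν : 0 < ν) (hK : 1 ≤ K) (hY : 0 ≤ Y)
    (hA : 0 ≤ A) : 0 ≤ chainFactor C s lam ν K Y A Crr := by
  have h1 := slopeBound_nonneg (s := s) hC hlam hν hK hY hA
  have h2 := ratioBound_nonneg (s := s) (Crr := Crr) hC hlam hν hK hY hA
  unfold chainFactor
  positivity

lemma newtonFactor_nonneg (hC : 0 < C) (hlam : 0 < lam) (hν : 0 < ν) (hK : 1 ≤ K) (hY : 0 ≤ Y)
    (hA : 0 ≤ A) : 0 ≤ newtonFactor C s lam ν K Y A Crr := by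
  have h1 := slopeBound_nonneg (s := s) hC hlam hν hK hY hA
  have h2 := ratioBound_nonneg (s := s) (Crr := Crr) hC hlam hν hK hY hA
  unfold newtonFactor
  positivity

end Bounds

variable {K Y A θ : ℝ} {m : ℕ}

/-- The source of the factors `√2` in the smallness conditions: `m + 1 ≤ 2 m`. -/
lemma sqrt_add_one_mul_sqrt_le (hm : 1 ≤ m) : √((m : ℝ) + 1) * √m ≤ √2 * m := by
  have h1 : (1 : ℝ) ≤ m := by exact_mod_cast hm
  calc √((m : ℝ) + 1) * √m ≤ √(2 * m) * √m := by gcongr; linarith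
    _ = _ := by
      rw [Real.sqrt_mul (by norm_num), mul_assoc, Real.mul_self_sqrt (by positivity)]

/-- On a tame data set the predictors for the remaining observations stay bounded when up to `m`
observations are removed. -/
lemma IsTame.abs_inner_estimator_le (hD : IsTame ℓ r lam K Y A θ D)
    (hℓ : LossAssumptions ℓ C s) (hr : RegularizerAssumptions r ν Crr)
    (hlam : 0 < lam) (hν : 0 < ν) (hK : 1 ≤ K) (hY : 0 ≤ Y) (hA : 0 ≤ A) (hθ : 0 ≤ θ)
    (hm : 1 ≤ m) (hsmall : √2 * θ * (m * √m) * chainFactor C s lam ν K Y A Crr ≤ 1) :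
    (∀ i, |inner ℝ (D i).2 (estimator ℓ r lam D ∅)| ≤ fitBound C s lam ν K Y A) ∧
    ∀ M : Finset (Fin n), M.card ≤ m → ∀ i ∉ M,
      |inner ℝ (D i).2 (estimator ℓ r lam D M)| ≤ fitBound C s lam ν K Y A := by
  have hΛ : 0 < lam * ν := mul_pos hlam hν
  have hK0 : 0 ≤ K := zero_le_one.trans hK
  set F := fitBound C s lam ν K Y A with hF
  set B := slopeBound C s lam ν K Y A with hBdef
  set Q := ratioBound C s lam ν K Y A Crr with hQdef
  have hB : 0 ≤ B := slopeBound_nonneg hℓ.C_pos hlam hν hK hY hA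
  have hQ : 0 ≤ Q := ratioBound_nonneg hℓ.C_pos hlam hν hK hY hA
  obtain ⟨hR1, -, hR3, hR0⟩ := le_rangeBound (s := s) hℓ.C_pos hlam hν hK hY hA
  have hg0 : 0 ≤ growthBound C s Y A := growthBound_nonneg hℓ.C_pos hY hA
  -- the full estimator
  have hfull : ∀ i, |inner ℝ (D i).2 (estimator ℓ r lam D ∅)| ≤ F - 1 := by
    intro i
    -- The slope at observation `i` is evaluated at the leave-one-out estimator, the only one whose
    -- prediction is controlled so far.
    have h1 := norm_estimator_sub_le' (D := D) (N := ∅) (M := {i}) hℓ hr hlam hν hK0 hg0 hD.gram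
      (Finset.empty_subset _) (fun j hj => by
        have : j = i := by simpa using hj
        subst this
        exact hℓ.abs_deriv_le (hD.response_le j) (hD.leaveOneOut_le j))
    simp only [Finset.sdiff_empty, Finset.card_singleton, Nat.cast_one, Real.sqrt_one,
      mul_one] at h1
    rw [← le_div_iff₀' hΛ] at h1
    have h2 := hD.gram.abs_inner_le hK0 (Finset.mem_univ i)
      (estimator ℓ r lam D {i} - estimator ℓ r lam D ∅)
    have h3 : K * ‖estimator ℓ r lam D {i} - estimator ℓ r lam D ∅‖ ≤
        K * (K * growthBound C s Y A) / (lam * ν) := by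
      rw [mul_div_assoc]; gcongr
    rw [inner_sub_right] at h2
    have h4 := abs_sub_abs_le_abs_sub (inner ℝ (D i).2 (estimator ℓ r lam D ∅))
      (inner ℝ (D i).2 (estimator ℓ r lam D {i}))
    rw [abs_sub_comm] at h4
    have h5 := hD.leaveOneOut_le i
    rw [hF, fitBound]
    linarith
  set η := θ * √((m : ℝ) + 1) with hη
  have hη0 : 0 ≤ η := by positivity
  -- The change of a remaining predictor caused by one removal: the linear response, plus `K` times
  -- the norm of the remainder.
  set step := η * B + K * (Q * (K * B / (lam * ν)) * (η * B)) with hstep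
  have hstep0 : 0 ≤ step := by positivity
  -- With `m = √m * √m`, the factor `m * √(m + 1)` becomes `√m * (√(m + 1) * √m)`, which is at most
  -- `√2 * (m * √m)`.
  have hmstep : m * step ≤ 1 := by
    refine le_trans (le_of_eq_of_le ?_ (mul_le_mul_of_nonneg_right (mul_le_mul_of_nonneg_left
      (mul_le_mul_of_nonneg_right (sqrt_add_one_mul_sqrt_le hm) (Real.sqrt_nonneg (m : ℝ))) hθ)
      (chainFactor_nonneg (s := s) (Crr := Crr) hℓ.C_pos hlam hν hK hY hA))) (le_of_eq_of_le ?_ hsmall)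
    · rw [chainFactor, hstep, hη]
      linear_combination (θ * √((m : ℝ) + 1) * (B + K ^ 2 * Q * B ^ 2 / (lam * ν))) *
        (-Real.mul_self_sqrt (Nat.cast_nonneg (α := ℝ) m))
    · ring
  refine ⟨fun i => (hfull i).trans (by linarith), ?_⟩
  -- Observations are removed one at a time. Before its removal, `j` is still a remaining
  -- observation, so the induction hypothesis bounds its slope. The total drift is at most the slack
  -- `1` built into `fitBound`.
  have key : ∀ M : Finset (Fin n), M.card ≤ m → ∀ i ∉ M,
      |inner ℝ (D i).2 (estimator ℓ r lam D M)| ≤ F - 1 + M.card * step := by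
    intro M
    induction M using Finset.induction_on with
    | empty => intro _ i _; simpa using hfull i
    | insert j M hj ih =>
      intro hcard i hi
      rw [Finset.card_insert_of_notMem hj] at hcard ⊢
      have ih' := ih (by omega)
      have hMm : (M.card : ℝ) * step ≤ 1 :=
        le_trans (by gcongr; omega) hmstep
      have ihF : ∀ i ∉ M, |inner ℝ (D i).2 (estimator ℓ r lam D M)| ≤ F := fun i hi =>
        (ih' i hi).trans (by linarith)
      have hiM : i ∉ M := fun h => hi (Finset.mem_insert_of_mem h)
      have hsd : insert j M \ M = {j} := by
        ext a
        simp only [Finset.mem_sdiff, Finset.mem_insert, Finset.mem_singleton]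
        constructor
        · tauto
        · rintro rfl; exact ⟨Or.inl rfl, hj⟩
      have hgj : ∀ a ∈ insert j M \ M,
          |deriv (ℓ (D a).1) (inner ℝ (D a).2 (estimator ℓ r lam D M))| ≤ B := by
        intro a ha
        rw [hsd, Finset.mem_singleton] at ha
        subst ha
        exact hℓ.abs_deriv_le (hD.response_le a) (ihF a hj)
      have hδ := norm_estimator_sub_le (D := D) hℓ hr hlam hν hK0 hB hD.gram
        (Finset.subset_insert j M) hgj
      have hcard1 : √(((insert j M \ M).card : ℕ) : ℝ) = 1 := by simp [hsd]
      rw [hcard1, mul_one, ← le_div_iff₀' hΛ] at hδ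
      have hpred : ∀ a, |inner ℝ (D a).2 (estimator ℓ r lam D M - estimator ℓ r lam D (insert j M))| ≤
          K * (K * B) / (lam * ν) := fun a => by
        refine (hD.gram.abs_inner_le hK0 (Finset.mem_univ a) _).trans ?_
        rw [mul_div_assoc]
        gcongr
      -- A crude bound from the operator norm of the design; it only confines the predictors to the
      -- range where the third derivative is controlled, and is sharpened below.
      have hins : ∀ a ∉ insert j M, |inner ℝ (D a).2 (estimator ℓ r lam D (insert j M))| ≤
          rangeBound C s lam ν K Y A := fun a ha => by
        have h1 := hpred a
        rw [inner_sub_right, abs_sub_comm] at h1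
        have h2 := abs_sub_abs_le_abs_sub (inner ℝ (D a).2 (estimator ℓ r lam D (insert j M)))
          (inner ℝ (D a).2 (estimator ℓ r lam D M))
        have h3 := ihF a fun h => ha (Finset.mem_insert_of_mem h)
        linarith
      have hηcard : θ ^ 2 * (((insert j M).card : ℝ) + 1) ≤ η ^ 2 := by
        rw [hη, mul_pow, Real.sq_sqrt (by positivity), Finset.card_insert_of_notMem hj]
        have : ((M.card + 1 : ℕ) : ℝ) ≤ m := by exact_mod_cast hcard
        gcongr
      obtain ⟨v, w, hvw, hv, -, hw⟩ := exists_estimator_sub_eq (D := D) hℓ hr hlam hν hK0 hB hη0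
        hY hR0 hD.response_le hD.gram (Finset.subset_insert j M)
        (fun a ha => (ihF a fun h => ha (Finset.mem_insert_of_mem h)).trans hR3) hins hgj
        (fun k hk => (hD.influence_obs_le _ k hk).trans hηcard)
        (fun k => (hD.influence_coord_le _ k).trans hηcard)
      rw [hcard1, mul_one] at hw
      have hv' := hv i hi
      rw [hcard1, mul_one] at hv'
      have h1 : |inner ℝ (D i).2 (estimator ℓ r lam D M - estimator ℓ r lam D (insert j M))| ≤
          step := by
        rw [hvw, inner_sub_right]
        refine (abs_sub _ _).trans ?_
        have h2 := (hD.gram.abs_inner_le hK0 (Finset.mem_univ i) w).trans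
          (mul_le_mul_of_nonneg_left hw hK0)
        change _ ≤ K * (Q * _ * _) at h2
        linarith
      rw [inner_sub_right, abs_sub_comm] at h1
      have h2 := abs_sub_abs_le_abs_sub (inner ℝ (D i).2 (estimator ℓ r lam D (insert j M)))
          (inner ℝ (D i).2 (estimator ℓ r lam D M))
      have h3 := ih' i hiM
      push_cast
      linarith
  intro M hM i hi
  refine (key M hM i hi).trans ?_
  have : (M.card : ℝ) * step ≤ 1 := le_trans (by gcongr) hmstep
  linarith

/-- The smallness condition makes `η * Γ` and `w` at most `1`, so one factor in each product can be
replaced by a constant. What survives is linear in `η * Γ * Γ`, of order `θ m^(3/2)`. -/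
lemma first_newton_error_le {K Q B Λ η Γ w δ : ℝ} (hK : 1 ≤ K) (hQ : 0 ≤ Q) (hB : 0 ≤ B)
    (hΛ : 0 < Λ) (hθ : 0 ≤ θ) (hm : 1 ≤ m) (hη : η = θ * √((m : ℝ) + 1)) (hΓ0 : 0 ≤ Γ)
    (hΓ : Γ ≤ B * √m) (hw0 : 0 ≤ w) (hw : w ≤ Q * (K * Γ / Λ) * (η * Γ)) (hδ : δ ≤ K * Γ / Λ)
    (hsmall : √2 * θ * (m * √m) * (B + K ^ 2 * Q * B ^ 2 / Λ) ≤ 1) :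
    (η * Γ + K * w) * w + η * Γ * δ ≤
      (1 + K) * (√2 * θ * (m * √m) * (K * B ^ 2 / Λ * Q)) +
        √2 * θ * (m * √m) * (K * B ^ 2 / Λ) := by
  have hm1 : (1 : ℝ) ≤ m := by exact_mod_cast hm
  have hsm := sqrt_add_one_mul_sqrt_le hm
  have hη0 : 0 ≤ η := by rw [hη]; positivity
  have hηΓΓ : η * Γ * Γ ≤ √2 * θ * (m * √m) * B ^ 2 := by
    calc η * Γ * Γ ≤ η * (B * √m) * (B * √m) := by gcongr
      _ = θ * (√((m : ℝ) + 1) * √m) * √m * B ^ 2 := by rw [hη]; ring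
      _ ≤ θ * (√2 * m) * √m * B ^ 2 := by gcongr
      _ = _ := by ring
  have hηΓ : η * Γ ≤ √2 * θ * (m * √m) * B := by
    calc η * Γ ≤ η * (B * √m) := by gcongr
      _ = θ * (√((m : ℝ) + 1) * √m) * 1 * B := by rw [hη]; ring
      _ ≤ θ * (√2 * m) * √m * B := by
        gcongr
        exact Real.one_le_sqrt.mpr hm1
      _ = _ := by ring
  set μ := √2 * θ * (m * √m) with hμ
  have hμ0 : 0 ≤ μ := by positivity
  have hKB : K * B ^ 2 / Λ * Q ≤ K ^ 2 * Q * B ^ 2 / Λ := by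
    rw [div_mul_eq_mul_div]
    gcongr ?_ / _
    calc K * B ^ 2 * Q = K * 1 * Q * B ^ 2 := by ring
      _ ≤ K * K * Q * B ^ 2 := by gcongr
      _ = _ := by ring
  have hW : w ≤ μ * (K * B ^ 2 / Λ * Q) := by
    refine hw.trans ?_
    calc Q * (K * Γ / Λ) * (η * Γ) = K * Q / Λ * (η * Γ * Γ) := by ring
      _ ≤ K * Q / Λ * (μ * B ^ 2) := by gcongr
      _ = _ := by ring
  rw [mul_add] at hsmall
  have hQB : 0 ≤ μ * (K ^ 2 * Q * B ^ 2 / Λ) := by positivity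
  have hμB : 0 ≤ μ * B := by positivity
  have hW1 : w ≤ 1 := by
    have := mul_le_mul_of_nonneg_left hKB hμ0
    linarith
  have hηΓ1 : η * Γ ≤ 1 := by linarith
  refine add_le_add ?_ ?_
  · have h1 : η * Γ + K * w ≤ 1 + K := by
      have := mul_le_mul_of_nonneg_left hW1 (zero_le_one.trans hK)
      linarith
    exact mul_le_mul h1 hW hw0 (by linarith)
  · calc η * Γ * δ ≤ η * Γ * (K * Γ / Λ) := by gcongr
      _ = K / Λ * (η * Γ * Γ) := by ring
      _ ≤ K / Λ * (μ * B ^ 2) := by gcongr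
      _ = _ := by ring

/-- The error of the first Newton step on a tame data set. -/
lemma IsTame.norm_newtonStep_estimator_sub_le (hD : IsTame ℓ r lam K Y A θ D)
    (hℓ : LossAssumptions ℓ C s) (hr : RegularizerAssumptions r ν Crr)
    (hlam : 0 < lam) (hν : 0 < ν) (hK : 1 ≤ K) (hY : 0 ≤ Y) (hA : 0 ≤ A) (hθ : 0 ≤ θ)
    (hm : 1 ≤ m) (hsmall : √2 * θ * (m * √m) * chainFactor C s lam ν K Y A Crr ≤ 1)
    (hM : M.card ≤ m) :
    (K * ratioBound C s lam ν K Y A Crr + 1) *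
      ‖newtonStep (risk ℓ r lam D M) (estimator ℓ r lam D ∅) - estimator ℓ r lam D M‖ ≤
      newtonFactor C s lam ν K Y A Crr * (√2 * θ * (m * √m)) := by
  obtain ⟨hfit, hfitM⟩ := hD.abs_inner_estimator_le hℓ hr hlam hν hK hY hA hθ hm hsmall
  have hΛ : 0 < lam * ν := mul_pos hlam hν
  have hK0 : 0 ≤ K := zero_le_one.trans hK
  have hm1 : (1 : ℝ) ≤ m := by exact_mod_cast hm
  set F := fitBound C s lam ν K Y A with hF
  set B := slopeBound C s lam ν K Y A with hBdef
  set Q := ratioBound C s lam ν K Y A Crr with hQdef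
  have hB : 0 ≤ B := slopeBound_nonneg hℓ.C_pos hlam hν hK hY hA
  have hQ : 0 ≤ Q := ratioBound_nonneg hℓ.C_pos hlam hν hK hY hA
  obtain ⟨hR1, -, hR3, hR0⟩ := le_rangeBound (s := s) hℓ.C_pos hlam hν hK hY hA
  set η := θ * √((m : ℝ) + 1) with hη
  have hη0 : 0 ≤ η := by positivity
  have hηcard : θ ^ 2 * ((M.card : ℝ) + 1) ≤ η ^ 2 := by
    rw [hη, mul_pow, Real.sq_sqrt (by positivity)]
    gcongr
  have hg : ∀ j ∈ M \ ∅,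
      |deriv (ℓ (D j).1) (inner ℝ (D j).2 (estimator ℓ r lam D ∅))| ≤ B := fun j _ =>
    hℓ.abs_deriv_le (hD.response_le j) (hfit j)
  have hZ0 : ∀ i ∉ M, |inner ℝ (D i).2 (estimator ℓ r lam D ∅)| ≤ rangeBound C s lam ν K Y A :=
    fun i _ => (hfit i).trans hR3
  have hZM : ∀ i ∉ M, |inner ℝ (D i).2 (estimator ℓ r lam D M)| ≤ rangeBound C s lam ν K Y A :=
    fun i hi => (hfitM M hM i hi).trans hR3
  have hδ := norm_estimator_sub_le (D := D) hℓ hr hlam hν hK0 hB hD.gram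
    (Finset.empty_subset M) hg
  obtain ⟨v, w, hvw, hv, hv', hw⟩ := exists_estimator_sub_eq (D := D) hℓ hr hlam hν hK0 hB hη0
    hY hR0 hD.response_le hD.gram (Finset.empty_subset M) hZ0 hZM hg
    (fun k hk => (hD.influence_obs_le _ k hk).trans hηcard)
    (fun k => (hD.influence_coord_le _ k).trans hηcard)
  have h1 := norm_newtonStep_sub_le_of_eq_sub hℓ hr hlam hν hK (by positivity) hD.response_le
    hD.gram hY hR0 hZ0 hZM hvw hv hv'
  rw [← le_div_iff₀' hΛ] at hδ
  simp only [Finset.sdiff_empty] at hδ hw h1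
  have h2 := first_newton_error_le hK hQ hB hΛ hθ hm hη (by positivity : 0 ≤ B * √(M.card : ℝ))
    (by gcongr) (norm_nonneg w) hw hδ hsmall
  have h3 := h1.trans (mul_le_mul_of_nonneg_left h2 hQ)
  refine (mul_le_mul_of_nonneg_left h3 (by positivity)).trans (le_of_eq ?_)
  change (K * Q + 1) * (Q * _) = (K * Q + 1) * (Q * (K * B ^ 2 / (lam * ν)) * ((1 + K) * Q + 1)) * _
  ring

/-- The error of Newton's method on a tame data set. -/
theorem IsTame.norm_newtonEstimator_sub_le (hD : IsTame ℓ r lam K Y A θ D)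
    (hℓ : LossAssumptions ℓ C s) (hr : RegularizerAssumptions r ν Crr)
    (hlam : 0 < lam) (hν : 0 < ν) (hK : 1 ≤ K) (hY : 0 ≤ Y) (hA : 0 ≤ A) (hθ : 0 ≤ θ)
    (hm : 1 ≤ m) (hsmall : √2 * θ * (m * √m) * chainFactor C s lam ν K Y A Crr ≤ 1)
    (hsmall' : newtonFactor C s lam ν K Y A Crr * (√2 * θ * (m * √m)) ≤ 1)
    (hM : M.card ≤ m) (t : ℕ) :
    ‖newtonEstimator ℓ r lam D M (t + 1) - estimator ℓ r lam D M‖ ≤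
      (newtonFactor C s lam ν K Y A Crr * (√2 * θ * (m * √m))) ^ 2 ^ t := by
  obtain ⟨-, hfitM⟩ := hD.abs_inner_estimator_le hℓ hr hlam hν hK hY hA hθ hm hsmall
  have hK0 : 0 ≤ K := zero_le_one.trans hK
  have hQ : 0 ≤ ratioBound C s lam ν K Y A Crr := ratioBound_nonneg hℓ.C_pos hlam hν hK hY hA
  have hB : 0 ≤ slopeBound C s lam ν K Y A := slopeBound_nonneg hℓ.C_pos hlam hν hK hY hA
  obtain ⟨-, hR2, hR3, hR0⟩ := le_rangeBound (s := s) hℓ.C_pos hlam hν hK hY hA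
  set V := K * ratioBound C s lam ν K Y A Crr + 1 with hV
  have hV1 : 1 ≤ V := by rw [hV]; nlinarith [mul_nonneg hK0 hQ]
  set ρ := newtonFactor C s lam ν K Y A Crr * (√2 * θ * (m * √m)) with hρ
  have hρ0 : 0 ≤ ρ := by
    rw [hρ, newtonFactor]
    positivity
  -- The weight `V = K Q + 1` dominates the constant of quadratic convergence, so a step squares the
  -- weighted error; since `V ≥ 1`, the weighted error also bounds the error itself.
  have key : V * ‖newtonEstimator ℓ r lam D M (t + 1) - estimator ℓ r lam D M‖ ≤ ρ ^ 2 ^ t := by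
    induction t with
    | zero =>
      rw [pow_zero, pow_one]
      exact hD.norm_newtonStep_estimator_sub_le hℓ hr hlam hν hK hY hA hθ hm hsmall hM
    | succ t ih =>
      have hstep : newtonEstimator ℓ r lam D M (t + 1 + 1) =
          newtonStep (risk ℓ r lam D M) (newtonEstimator ℓ r lam D M (t + 1)) := by
        rw [newtonEstimator, Function.iterate_succ_apply', newtonEstimator]
      rw [hstep]
      set β := newtonEstimator ℓ r lam D M (t + 1)
      set e := ‖β - estimator ℓ r lam D M‖ with he
      have he0 : 0 ≤ e := norm_nonneg _
      -- An error of at most `1` moves predictors by at most `K`, which is the last summand of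
      -- `rangeBound`; the iterate thus stays in the range of the derivative bounds.
      have he1 : e ≤ 1 := by
        refine le_trans ?_ (ih.trans (pow_le_one₀ hρ0 hsmall'))
        exact le_mul_of_one_le_left he0 hV1
      have h1 := norm_newtonStep_sub_le (D := D) (M := M) (β := β) hℓ hr hlam hν hK hD.response_le hD.gram hY hR0
        (fun i hi => by
          have h2 := hD.gram.abs_inner_le hK0 (Finset.mem_univ i) (β - estimator ℓ r lam D M)
          rw [inner_sub_right] at h2
          have h3 := abs_sub_abs_le_abs_sub (inner ℝ (D i).2 β)
            (inner ℝ (D i).2 (estimator ℓ r lam D M))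
          have h4 := hfitM M hM i hi
          have h5 : K * e ≤ K := mul_le_of_le_one_right hK0 he1
          linarith)
        (fun i hi => (hfitM M hM i hi).trans hR3)
      change _ ≤ K * ratioBound C s lam ν K Y A Crr * e ^ 2 at h1
      have h2 : K * ratioBound C s lam ν K Y A Crr ≤ V := by rw [hV]; linarith
      calc _ ≤ V * (V * e ^ 2) := by
            gcongr
            exact h1.trans (by gcongr)
        _ = (V * e) ^ 2 := by ring
        _ ≤ (ρ ^ 2 ^ t) ^ 2 := by gcongr
        _ = _ := by rw [← pow_mul, pow_succ]
  exact le_trans (le_mul_of_one_le_left (norm_nonneg _) hV1) key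

end Tame

/-! ### Concentration of the design -/

section Concentration

variable {n p : ℕ} {P : Measure (Obs p)} {CX s Cy q Cys : ℝ}

lemma dotProduct_mulVec_le_of_eigenvalues_le {S : Matrix (Fin p) (Fin p) ℝ} (hS : S.IsHermitian)
    {κ : ℝ} (hκ : ∀ i, hS.eigenvalues i ≤ κ) (u : Param p) :
    u.ofLp ⬝ᵥ S.mulVec u.ofLp ≤ κ * ‖u‖ ^ 2 := by
  set b := hS.eigenvectorBasis
  have hb : ∀ i, Matrix.toEuclideanCLM (𝕜 := ℝ) S (b i) = hS.eigenvalues i • b i := fun i => by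
    refine (WithLp.ofLp_injective 2) ?_
    simpa using hS.mulVec_eigenvectorBasis i
  have hsymm : ∀ i, inner ℝ (b i) (Matrix.toEuclideanCLM (𝕜 := ℝ) S u) =
      hS.eigenvalues i * inner ℝ (b i) u := fun i => by
    have h1 : inner ℝ (b i) (Matrix.toEuclideanCLM (𝕜 := ℝ) S u) =
        inner ℝ u (Matrix.toEuclideanCLM (𝕜 := ℝ) S (b i)) := by
      rw [Matrix.inner_toEuclideanCLM, Matrix.inner_toEuclideanCLM, Matrix.dotProduct_mulVec,
        ← Matrix.mulVec_transpose, dotProduct_comm]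
      have : S.transpose = S := by simpa [Matrix.IsHermitian] using hS
      rw [this]
    rw [h1, hb, inner_smul_right, real_inner_comm]
  rw [← Matrix.inner_toEuclideanCLM, ← b.sum_inner_mul_inner, ← b.sum_sq_norm_inner_right u,
    Finset.mul_sum]
  refine Finset.sum_le_sum fun i _ => ?_
  rw [hsymm, real_inner_comm, Real.norm_eq_abs, sq_abs]
  nlinarith [hκ i, sq_nonneg (inner ℝ u (b i)), real_inner_comm u (b i)]

/-- The integral equals `(1 - 2 v)^(-1/2)`, at most `√2` for `v ≤ 1 / 4`. Variance zero is separate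
because the law then has no density. -/
lemma lintegral_exp_sq_gaussianReal_le {v : NNReal} (hv : (v : ℝ) ≤ 1 / 4) :
    ∫⁻ z, ENNReal.ofReal (Real.exp (z ^ 2)) ∂gaussianReal 0 v ≤ ENNReal.ofReal √2 := by
  have hmeas : Measurable fun z : ℝ => ENNReal.ofReal (Real.exp (z ^ 2)) := by fun_prop
  rcases eq_or_ne v 0 with rfl | hv0
  · rw [gaussianReal_zero_var, lintegral_dirac' _ hmeas]
    refine ENNReal.ofReal_le_ofReal ?_
    simp
  · have hvpos : (0 : ℝ) < v := by positivity
    rw [gaussianReal_of_var_ne_zero _ hv0,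
      lintegral_withDensity_eq_lintegral_mul _ (measurable_gaussianPDF 0 v) hmeas]
    set b : ℝ := 1 / (2 * v) - 1 with hb
    have h2 : 2 ≤ 1 / (2 * (v : ℝ)) := by
      rw [le_div_iff₀ (by positivity)]
      linarith
    have hbpos : 0 < b := by rw [hb]; linarith
    have hpt : ∀ z : ℝ, (gaussianPDF 0 v * fun z : ℝ => ENNReal.ofReal (Real.exp (z ^ 2))) z =
        ENNReal.ofReal ((√(2 * Real.pi * v))⁻¹ * Real.exp (-b * z ^ 2)) := fun z => by
      rw [Pi.mul_apply, gaussianPDF, gaussianPDFReal, ← ENNReal.ofReal_mul (by positivity),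
        mul_assoc, ← Real.exp_add]
      congr 3
      rw [hb]
      field_simp
      ring
    simp_rw [hpt]
    rw [← ofReal_integral_eq_lintegral_ofReal ((integrable_exp_neg_mul_sq hbpos).const_mul _)
      (Eventually.of_forall fun z => by positivity), integral_const_mul, integral_gaussian]
    refine ENNReal.ofReal_le_ofReal ?_
    rw [← Real.sqrt_inv, ← Real.sqrt_mul (by positivity)]
    refine Real.sqrt_le_sqrt ?_
    rw [inv_mul_eq_div, div_div, div_le_iff₀ (by positivity)]
    have : b * (2 * v) = 1 - 2 * v := by rw [hb]; field_simp
    have h3 : 2 * (b * (2 * Real.pi * v)) = 2 * Real.pi * (1 - 2 * v) := by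
      rw [← this]; ring
    rw [h3]
    nlinarith [Real.pi_pos]

/-- The exponential moment of the square of a linear form of the features. -/
lemma DataAssumptions.lintegral_exp_sq_inner_le (hP : DataAssumptions P CX s Cy q Cys)
    {u : Param p} (hu : CX / p * ‖u‖ ^ 2 ≤ 1 / 4) :
    ∫⁻ z, ENNReal.ofReal (Real.exp (inner ℝ z.2 u ^ 2)) ∂P ≤ ENNReal.ofReal √2 := by
  obtain ⟨S, hS, heig, hmap⟩ := hP.gaussian
  have hmeas : Measurable fun z : ℝ => ENNReal.ofReal (Real.exp (z ^ 2)) := by fun_prop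
  have h1 : ∫⁻ z, ENNReal.ofReal (Real.exp (inner ℝ z.2 u ^ 2)) ∂P =
      ∫⁻ x, ENNReal.ofReal (Real.exp (innerSL ℝ u x ^ 2)) ∂(multivariateGaussian 0 S) := by
    rw [← hmap, lintegral_map (f := fun x => ENNReal.ofReal (Real.exp (innerSL ℝ u x ^ 2)))
      (hmeas.comp (innerSL ℝ u).continuous.measurable) measurable_snd]
    simp only [innerSL_apply_apply, real_inner_comm]
  have h2 : ∫⁻ x, ENNReal.ofReal (Real.exp (innerSL ℝ u x ^ 2)) ∂(multivariateGaussian 0 S) =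
      ∫⁻ z, ENNReal.ofReal (Real.exp (z ^ 2)) ∂((multivariateGaussian 0 S).map (innerSL ℝ u)) := by
    rw [lintegral_map hmeas (innerSL ℝ u).continuous.measurable]
  rw [h1, h2, IsGaussian.map_eq_gaussianReal,
    (innerSL ℝ u).integral_comp_id_comm IsGaussian.integrable_id,
    integral_id_multivariateGaussian, map_zero]
  refine lintegral_exp_sq_gaussianReal_le ?_
  have hvar : Var[innerSL ℝ u; multivariateGaussian 0 S] = u.ofLp ⬝ᵥ S.mulVec u.ofLp := by
    rw [← covarianceBilin_multivariateGaussian (μ := 0) hS,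
      covarianceBilin_self IsGaussian.memLp_two_id]
    rfl
  rw [hvar, Real.coe_toNNReal']
  exact max_le ((dotProduct_mulVec_le_of_eigenvalues_le hS.isHermitian heig u).trans hu)
    (by norm_num)

/-- Observations in `M` are integrated out one at a time. Resampling one of them changes neither `u`
nor the other factors, so each integration costs at most `√2`; this replaces conditioning on the
observations outside `M`. -/
lemma lintegral_prod_exp_sq_inner_le (hP : DataAssumptions P CX s Cy q Cys)
    (M : Finset (Fin n)) {u : Dataset n p → Param p} (hu : Measurable u)
    (hdep : ∀ D D' : Dataset n p, (∀ i ∉ M, D i = D' i) → u D = u D')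
    (hle : ∀ D, CX / p * ‖u D‖ ^ 2 ≤ 1 / 4) :
    ∫⁻ D, ∏ j ∈ M, ENNReal.ofReal (Real.exp (inner ℝ (D j).2 (u D) ^ 2)) ∂datasetLaw n P ≤
      ENNReal.ofReal √2 ^ M.card := by
  have := hP.isProbability
  have hmeas : ∀ S : Finset (Fin n), Measurable fun D : Dataset n p =>
      ∏ j ∈ S, ENNReal.ofReal (Real.exp (inner ℝ (D j).2 (u D) ^ 2)) := fun S =>
    Finset.measurable_prod _ fun j _ => by
      have : Measurable fun D : Dataset n p => (D j).2 := measurable_snd.comp (measurable_pi_apply j)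
      fun_prop
  have key : ∀ S : Finset (Fin n), S ⊆ M →
      ∫⁻ D, ∏ j ∈ S, ENNReal.ofReal (Real.exp (inner ℝ (D j).2 (u D) ^ 2)) ∂datasetLaw n P ≤
        ENNReal.ofReal √2 ^ S.card := by
    intro S
    induction S using Finset.induction_on with
    | empty => intro _; simp [datasetLaw]
    | insert j S hj ih =>
      intro hSM
      have hjM : j ∈ M := hSM (Finset.mem_insert_self _ _)
      have hupd : ∀ (D : Dataset n p) (z : Obs p), u (Function.update D j z) = u D := fun D z =>
        hdep _ _ fun i hi => Function.update_of_ne (by rintro rfl; exact hi hjM) _ _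
      calc _ ≤ ∫⁻ D, ENNReal.ofReal √2 *
              ∏ j ∈ S, ENNReal.ofReal (Real.exp (inner ℝ (D j).2 (u D) ^ 2)) ∂datasetLaw n P := by
            -- It suffices to compare the integrals over coordinate `j` with all other coordinates
            -- frozen.
            refine lintegral_le_of_lmarginal_le {j} (hmeas _) ((hmeas S).const_mul _) ?_
            intro D
            rw [lmarginal_singleton, lmarginal_singleton]
            simp_rw [hupd, Finset.prod_insert hj]
            have hprod : ∀ z : Obs p, ∏ i ∈ S, ENNReal.ofReal
                (Real.exp (inner ℝ (Function.update D j z i).2 (u D) ^ 2)) =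
                ∏ i ∈ S, ENNReal.ofReal (Real.exp (inner ℝ (D i).2 (u D) ^ 2)) := fun z =>
              Finset.prod_congr rfl fun i hi => by
                rw [Function.update_of_ne (by rintro rfl; exact hj hi)]
            simp_rw [hprod, Function.update_self]
            rw [lintegral_mul_const _ (by fun_prop), lintegral_const, measure_univ, mul_one]
            gcongr
            exact hP.lintegral_exp_sq_inner_le (hle D)
        _ = ENNReal.ofReal √2 * ∫⁻ D,
              ∏ j ∈ S, ENNReal.ofReal (Real.exp (inner ℝ (D j).2 (u D) ^ 2)) ∂datasetLaw n P :=
            lintegral_const_mul _ (hmeas S)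
        _ ≤ ENNReal.ofReal √2 * ENNReal.ofReal √2 ^ S.card := by
            gcongr
            exact ih fun i hi => hSM (Finset.mem_insert_of_mem hi)
        _ = _ := by rw [Finset.card_insert_of_notMem hj, pow_succ']
  exact key M subset_rfl

/-- Linear forms of the features in `M` with coefficients that depend only on the other
observations concentrate. -/
theorem measure_lt_sum_sq_inner_le (hP : DataAssumptions P CX s Cy q Cys) (hCX : 0 < CX)
    (hp : 0 < p) (M : Finset (Fin n)) {u : Dataset n p → Param p} (hu : Measurable u)
    (hdep : ∀ D D' : Dataset n p, (∀ i ∉ M, D i = D' i) → u D = u D') (τ : ℝ) :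
    datasetLaw n P {D | 4 * (CX / p) * τ * ‖u D‖ ^ 2 < ∑ j ∈ M, inner ℝ (D j).2 (u D) ^ 2} ≤
      ENNReal.ofReal (√2 ^ M.card * Real.exp (-τ)) := by
  set σ : ℝ := CX / p with hσ
  have hσ0 : 0 < σ := by positivity
  -- Rescaling makes `σ * ‖u'‖ ^ 2` equal to `1 / 4`, or `0` where `u` vanishes. The deviation event
  -- then lies in one covered by Markov's inequality at level `exp τ`.
  set u' : Dataset n p → Param p := fun D => (2 * √σ * ‖u D‖)⁻¹ • u D with hu'
  have hu'meas : Measurable u' := by fun_prop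
  have hle : ∀ D, σ * ‖u' D‖ ^ 2 ≤ 1 / 4 := fun D => by
    rw [hu']
    simp only [norm_smul, norm_inv, norm_mul, Real.norm_eq_abs, abs_norm, Nat.abs_ofNat,
      abs_of_nonneg (Real.sqrt_nonneg σ)]
    rcases (norm_nonneg (u D)).eq_or_lt with h | h
    · rw [← h]; norm_num
    · refine le_of_eq ?_
      rw [mul_pow, inv_pow, mul_pow, mul_pow, Real.sq_sqrt hσ0.le]
      field_simp
      norm_num
  have h1 := lintegral_prod_exp_sq_inner_le hP M hu'meas
    (fun D D' h => by simp only [hu', hdep D D' h]) hle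
  have hmeas : Measurable fun D : Dataset n p =>
      ∏ j ∈ M, ENNReal.ofReal (Real.exp (inner ℝ (D j).2 (u' D) ^ 2)) :=
    Finset.measurable_prod _ fun j _ => by
      have : Measurable fun D : Dataset n p => (D j).2 := measurable_snd.comp (measurable_pi_apply j)
      fun_prop
  have hsub : {D : Dataset n p | 4 * σ * τ * ‖u D‖ ^ 2 < ∑ j ∈ M, inner ℝ (D j).2 (u D) ^ 2} ⊆
      {D | ENNReal.ofReal (Real.exp τ) ≤
        ∏ j ∈ M, ENNReal.ofReal (Real.exp (inner ℝ (D j).2 (u' D) ^ 2))} := by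
    intro D hD
    simp only [Set.mem_ofPred_eq] at hD ⊢
    rw [← ENNReal.ofReal_prod_of_nonneg fun _ _ => (Real.exp_pos _).le, ← Real.exp_sum]
    refine ENNReal.ofReal_le_ofReal (Real.exp_le_exp.mpr ?_)
    have hpos : 0 < ‖u D‖ := by
      refine (norm_nonneg _).lt_of_ne' fun h => ?_
      rw [norm_eq_zero.mp h] at hD
      simp at hD
    have h2 : ∀ j, inner ℝ (D j).2 (u' D) ^ 2 = inner ℝ (D j).2 (u D) ^ 2 / (4 * σ * ‖u D‖ ^ 2) :=
      fun j => by
        rw [hu', inner_smul_right, mul_pow, inv_pow, mul_pow, mul_pow, Real.sq_sqrt hσ0.le]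
        field_simp
        ring
    simp_rw [h2]
    rw [← Finset.sum_div, le_div_iff₀ (by positivity)]
    linarith
  have h3 := (mul_meas_ge_le_lintegral (μ := datasetLaw n P) hmeas
    (ENNReal.ofReal (Real.exp τ))).trans h1
  have h4 : ENNReal.ofReal (√2 ^ M.card * Real.exp (-τ)) =
      (ENNReal.ofReal (Real.exp τ))⁻¹ * ENNReal.ofReal √2 ^ M.card := by
    rw [mul_comm, ENNReal.ofReal_mul (Real.exp_pos _).le, Real.exp_neg,
      ENNReal.ofReal_inv_of_pos (Real.exp_pos _), ENNReal.ofReal_pow (Real.sqrt_nonneg _)]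
  rw [h4]
  refine (measure_mono hsub).trans ?_
  exact (ENNReal.mul_le_iff_le_inv (by simp [Real.exp_pos]) ENNReal.ofReal_ne_top).mp h3

end Concentration

/-! ### Measurability -/

section Measurability

/-- The derivative is a pointwise limit of difference quotients. Joint measurability is needed
because response and predictor are both random. -/
lemma measurable_uncurry_deriv {f : ℝ → ℝ → ℝ} (hf : Measurable (Function.uncurry f))
    (hd : ∀ y, Differentiable ℝ (f y)) :
    Measurable (Function.uncurry fun y => deriv (f y)) := by
  set h : ℕ → ℝ := fun j => 1 / ((j : ℝ) + 1) with hh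
  have hh0 : Tendsto h atTop (𝓝[≠] 0) := tendsto_nhdsWithin_iff.mpr
    ⟨tendsto_one_div_add_atTop_nhds_zero_nat, Eventually.of_forall fun j => by
      simp only [hh, Set.mem_compl_iff, Set.mem_singleton_iff]; positivity⟩
  refine measurable_of_tendsto_metrizable (f := fun (j : ℕ) (w : ℝ × ℝ) =>
    (h j)⁻¹ * (f w.1 (w.2 + h j) - f w.1 w.2)) (fun j => ?_) (tendsto_pi_nhds.mpr fun w => ?_)
  · have h1 : Measurable fun w : ℝ × ℝ => f w.1 (w.2 + h j) :=
      hf.comp (measurable_fst.prodMk (measurable_snd.add_const _))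
    exact (h1.sub hf).const_mul _
  · exact ((hd w.1 w.2).hasDerivAt.tendsto_slope_zero).comp hh0

/-- The minimizer of a family of continuous functions is measurable in the parameter, if the
functions grow quadratically away from it. -/
theorem measurable_of_sq_norm_sub_le {Ω E : Type*} [MeasurableSpace Ω] [NormedAddCommGroup E]
    [SecondCountableTopology E] [MeasurableSpace E] [BorelSpace E]
    {f : Ω → E → ℝ} {b : Ω → E} {κ : ℝ} (hκ : 0 < κ) (hf : ∀ q, Measurable fun ω => f ω q)
    (hcont : ∀ ω, Continuous (f ω)) (hgrow : ∀ ω q, κ * ‖q - b ω‖ ^ 2 ≤ f ω q - f ω (b ω)) :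
    Measurable b := by
  classical
  set q : ℕ → E := TopologicalSpace.denseSeq E
  have hq : DenseRange q := TopologicalSpace.denseRange_denseSeq E
  set ε : ℕ → ℝ := fun j => 1 / ((j : ℝ) + 1) with hε
  have hε0 : ∀ j, 0 < ε j := fun j => by positivity
  -- Choosing the first `ε j`-optimal point of a fixed dense sequence is measurable, since it
  -- involves only countably many comparisons. Quadratic growth forces these points to converge to
  -- `b ω`.
  have hex : ∀ j ω, ∃ i, ∀ i', f ω (q i) < f ω (q i') + ε j := fun j ω => by
    have hopen : IsOpen {x | f ω x < f ω (b ω) + ε j} := isOpen_lt (hcont ω) continuous_const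
    obtain ⟨i, hi⟩ := hq.exists_mem_open hopen ⟨b ω, by
      rw [Set.mem_ofPred_eq]; linarith [hε0 j]⟩
    rw [Set.mem_ofPred_eq] at hi
    refine ⟨i, fun i' => ?_⟩
    have h1 := hgrow ω (q i')
    have h2 : 0 ≤ κ * ‖q i' - b ω‖ ^ 2 := by positivity
    linarith
  refine measurable_of_tendsto_metrizable (f := fun j ω => q (Nat.find (hex j ω)))
    (fun j => ?_) (tendsto_pi_nhds.mpr fun ω => ?_)
  · refine (measurable_from_nat).comp (measurable_find (hex j) fun i => ?_)
    simp only [Set.ofPred_forall]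
    exact MeasurableSet.iInter fun i' => measurableSet_lt (hf _) ((hf _).add_const _)
  · have hle : ∀ j, ‖q (Nat.find (hex j ω)) - b ω‖ ≤ √(ε j / κ) := fun j => by
      have h1 := Nat.find_spec (hex j ω)
      have h2 : ∀ x, f ω (q (Nat.find (hex j ω))) ≤ f ω x + ε j := fun x =>
        hq.induction_on (p := fun x => f ω (q (Nat.find (hex j ω))) ≤ f ω x + ε j) x
          (isClosed_le continuous_const ((hcont ω).add continuous_const)) fun i => (h1 i).le
      refine Real.le_sqrt_of_sq_le ((le_div_iff₀' hκ).mpr ?_)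
      linarith [h2 (b ω), hgrow ω (q (Nat.find (hex j ω)))]
    have hlim : Tendsto (fun j => √(ε j / κ)) atTop (𝓝 0) := by
      have := ((tendsto_one_div_add_atTop_nhds_zero_nat (𝕜 := ℝ)).div_const κ).sqrt
      simpa [hε] using this
    rw [tendsto_iff_norm_sub_tendsto_zero]
    exact squeeze_zero (fun _ => norm_nonneg _) hle hlim

variable {n p : ℕ} {ℓ : ℝ → ℝ → ℝ} {C s : ℝ} {r : Fin p → ℝ → ℝ} {ν Crr lam : ℝ}

lemma strongConvexOn_risk (hℓ : LossAssumptions ℓ C s) (hr : RegularizerAssumptions r ν Crr)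
    (hlam : 0 < lam) (D : Dataset n p) (M : Finset (Fin n)) :
    StrongConvexOn Set.univ (lam * ν) (risk ℓ r lam D M) := by
  rw [strongConvexOn_iff_convex]
  have h1 : ∀ S : Finset (Fin n), ConvexOn ℝ Set.univ
      fun β : Param p => ∑ i ∈ S, ℓ (D i).1 (inner ℝ (D i).2 β) := fun S => by
    induction S using Finset.induction_on with
    | empty => simpa using convexOn_const 0 convex_univ
    | insert i S hi ih =>
      simp_rw [Finset.sum_insert hi]
      exact ((hℓ.convex (D i).1).comp_linearMap (innerSL ℝ (D i).2).toLinearMap).add ih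
  refine ((h1 Mᶜ).add ((strongConvexOn_iff_convex.mp hr.strongConvex).smul hlam.le)).congr
    fun β _ => ?_
  simp only [Pi.add_apply, smul_eq_mul, risk]
  ring

lemma measurable_estimator (hℓ : LossAssumptions ℓ C s) (hr : RegularizerAssumptions r ν Crr)
    (hlam : 0 < lam) (hν : 0 < ν) (M : Finset (Fin n)) :
    Measurable fun D : Dataset n p => estimator ℓ r lam D M := by
  refine measurable_of_sq_norm_sub_le (f := fun D β => risk ℓ r lam D M β)
    (κ := lam * ν / 2) (by positivity) (fun β => ?_) (fun D => continuous_risk hℓ hr) fun D β =>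
      StrongConvexOn.sq_norm_sub_le (strongConvexOn_risk hℓ hr hlam D M)
        (isMinOn_estimator hℓ hr hlam hν D M) β
  refine (Finset.measurable_sum _ fun i _ => ?_).add_const _
  have h1 : Measurable fun D : Dataset n p => (D i).1 := measurable_fst.comp (measurable_pi_apply i)
  have h2 : Measurable fun D : Dataset n p => (D i).2 := measurable_snd.comp (measurable_pi_apply i)
  exact hℓ.measurable.comp (h1.prodMk (by fun_prop))

/-- The vector `H⁻¹ w` minimizes the quadratic `⟨H u, u⟩ / 2 - ⟨w, u⟩`, so the measurability
criterion for minimizers applies to it as well. -/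
lemma measurable_influence (hℓ : LossAssumptions ℓ C s) (hr : RegularizerAssumptions r ν Crr)
    (hlam : 0 < lam) (hν : 0 < ν) (M : Finset (Fin n)) {w : Dataset n p → Param p}
    (hw : Measurable w) :
    Measurable fun D : Dataset n p => influence ℓ r lam D M (w D) := by
  set H : Dataset n p → Param p →L[ℝ] Param p := fun D =>
    riskHess ℓ r lam D M (estimator ℓ r lam D M) with hH
  have hsymm : ∀ D u v, inner ℝ (H D u) v = inner ℝ u (H D v) := fun D u v =>
    inner_curvature_comm u v
  refine measurable_of_sq_norm_sub_le
    (f := fun D u => inner ℝ (H D u) u / 2 - inner ℝ (w D) u) (κ := lam * ν / 2) (by positivity)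
    (fun u => ?_) (fun D => by fun_prop) fun D u => ?_
  · have hest := measurable_estimator (n := n) hℓ hr hlam hν M
    simp only [hH, riskHess, inner_curvature]
    refine (((Finset.measurable_sum _ fun i _ => ?_).add
      (Finset.measurable_sum _ fun k _ => ?_)).div_const 2).sub (by fun_prop)
    · have h1 : Measurable fun D : Dataset n p => (D i).1 :=
        measurable_fst.comp (measurable_pi_apply i)
      have h2 : Measurable fun D : Dataset n p => (D i).2 :=
        measurable_snd.comp (measurable_pi_apply i)
      have h3 : Measurable (Function.uncurry fun y => deriv (deriv (ℓ y))) :=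
        measurable_uncurry_deriv (measurable_uncurry_deriv hℓ.measurable hℓ.differentiable_loss)
          hℓ.differentiable_deriv
      have h4 : Measurable fun D : Dataset n p =>
          deriv (deriv (ℓ (D i).1)) (inner ℝ (D i).2 (estimator ℓ r lam D M)) :=
        h3.comp (h1.prodMk (by fun_prop))
      fun_prop
    · have h1 : Measurable (deriv (deriv (r k))) := measurable_deriv _
      have h2 : Measurable fun D : Dataset n p => estimator ℓ r lam D M k := by fun_prop
      exact (((h1.comp h2).const_mul _).mul_const _).mul_const _
  · set b := influence ℓ r lam D M (w D)
    have hb : H D b = w D := riskHess_apply_inverse hℓ hr hlam hν _ _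
    have h1 : lam * ν * ‖u - b‖ ^ 2 ≤ inner ℝ (H D (u - b)) (u - b) :=
      sq_norm_le_inner_curvature (fun _ _ => hℓ.deriv_deriv_nonneg _ _)
        (fun k => mul_le_mul_of_nonneg_left (hr.le_deriv_deriv k _) hlam.le) _
    have h2 : inner ℝ (H D (u - b)) (u - b) =
        inner ℝ (H D u) u - 2 * inner ℝ (w D) u + inner ℝ (w D) b := by
      rw [map_sub, inner_sub_left, inner_sub_right, inner_sub_right, hsymm D u b, hb,
        real_inner_comm (w D) u]
      ring
    rw [h2] at h1
    change _ ≤ inner ℝ (H D u) u / 2 - inner ℝ (w D) u - (inner ℝ (H D b) b / 2 - inner ℝ (w D) b)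
    rw [hb]
    linarith

/-- With `influence_congr`, this is the form in which independence from the removed observations
enters the concentration bounds. -/
lemma estimator_congr {D D' : Dataset n p} {M : Finset (Fin n)} (h : ∀ i ∉ M, D i = D' i) :
    estimator ℓ r lam D M = estimator ℓ r lam D' M := by
  have : risk ℓ r lam D M = risk ℓ r lam D' M := funext fun β => by
    unfold risk
    congr 1
    exact Finset.sum_congr rfl fun i hi => by rw [h i (Finset.mem_compl.mp hi)]
  rw [estimator, estimator, this]

lemma influence_congr {D D' : Dataset n p} {M : Finset (Fin n)} (h : ∀ i ∉ M, D i = D' i)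
    (w : Param p) : influence ℓ r lam D M w = influence ℓ r lam D' M w := by
  have : riskHess ℓ r lam D M = riskHess ℓ r lam D' M := funext fun β => by
    unfold riskHess curvature
    congr 1
    exact Finset.sum_congr rfl fun i hi => by
      beta_reduce
      rw [h i (Finset.mem_compl.mp hi)]
  rw [influence, influence, this, estimator_congr h]

end Measurability

/-! ### The design matrix -/

section Design

/-- A separated family of vectors of norm `2` that is a net of the sphere. -/
lemma exists_net (p : ℕ) : ∃ N : Finset (Param p), N.card ≤ 5 ^ p ∧
    ∀ v : Param p, ‖v‖ = 2 → ∃ c ∈ N, ‖c‖ = 2 ∧ ‖v - c‖ ≤ 1 := by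
  by_contra! hcon
  -- If no net of at most `5 ^ p` points existed, a separated family could always be enlarged,
  -- contradicting the packing bound for separated points in a ball of radius `2`.
  have key : ∀ k : ℕ, ∃ N : Finset (Param p), N.card = k ∧ (∀ c ∈ N, ‖c‖ = 2) ∧
      ∀ c ∈ N, ∀ d ∈ N, c ≠ d → 1 ≤ ‖c - d‖ := by
    intro k
    induction k with
    | zero => exact ⟨∅, by simp⟩
    | succ k ih =>
      obtain ⟨N, hk, hN, hsep⟩ := ih
      have hcard : N.card ≤ 5 ^ p := by
        simpa using Besicovitch.card_le_of_separated N (fun c hc => (hN c hc).le) hsep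
      obtain ⟨v, hv, hvN⟩ := hcon N hcard
      have hfar : ∀ c ∈ N, 1 < ‖v - c‖ := fun c hc => hvN c hc (hN c hc)
      have hnot : v ∉ N := fun h => by
        have := hfar v h
        simp at this
        linarith
      classical
      refine ⟨insert v N, by rw [Finset.card_insert_of_notMem hnot, hk], ?_, ?_⟩
      · intro c hc
        rcases Finset.mem_insert.mp hc with rfl | hc
        · exact hv
        · exact hN c hc
      · intro c hc d hd hcd
        rcases Finset.mem_insert.mp hc with rfl | hc' <;>
          rcases Finset.mem_insert.mp hd with rfl | hd'
        · exact absurd rfl hcd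
        · exact (hfar d hd').le
        · rw [norm_sub_rev]; exact (hfar c hc').le
        · exact hsep c hc' d hd' hcd
  obtain ⟨N, hk, hN, hsep⟩ := key (5 ^ p + 1)
  have hcard : N.card ≤ 5 ^ p := by
    simpa using Besicovitch.card_le_of_separated N (fun c hc => (hN c hc).le) hsep
  omega

/-- On the sphere of radius `2` every point is within `1` of a centre, which yields `‖A‖ ≤ L + ‖A‖ /
2` for the design matrix `A`, hence `‖A‖ ≤ 2 L`. -/
lemma gramBound_of_net {n p : ℕ} {x : Fin n → Param p} {N : Finset (Param p)} {L : ℝ} (hL : 0 ≤ L)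
    (hN : ∀ v : Param p, ‖v‖ = 2 → ∃ c ∈ N, ‖c‖ = 2 ∧ ‖v - c‖ ≤ 1)
    (hx : ∀ c ∈ N, ∑ i, inner ℝ (x i) c ^ 2 ≤ L ^ 2 * ‖c‖ ^ 2) :
    GramBound x Finset.univ (2 * L) := by
  let A : Param p →L[ℝ] EuclideanSpace ℝ (Fin n) :=
    ((WithLp.linearEquiv 2 ℝ (Fin n → ℝ)).symm.toLinearMap ∘ₗ
      LinearMap.pi fun i => (innerSL ℝ (x i)).toLinearMap).toContinuousLinearMap
  have hA : ∀ v, ‖A v‖ ^ 2 = ∑ i, inner ℝ (x i) v ^ 2 := fun v => by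
    rw [EuclideanSpace.real_norm_sq_eq]
    rfl
  have h2 : ∀ v : Param p, ‖v‖ = 2 → ‖A v‖ ≤ 2 * L + ‖A‖ := fun v hv => by
    obtain ⟨c, hc, hc2, hvc⟩ := hN v hv
    have h3 : ‖A c‖ ≤ 2 * L := by
      refine abs_le_of_sq_le_sq' ?_ (by positivity) |>.2
      rw [hA]
      refine (hx c hc).trans (le_of_eq ?_)
      rw [hc2]
      ring
    have h4 : ‖A (v - c)‖ ≤ ‖A‖ := (A.le_opNorm _).trans (mul_le_of_le_one_right (norm_nonneg _) hvc)
    calc ‖A v‖ = ‖A c + A (v - c)‖ := by rw [← map_add, add_sub_cancel]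
      _ ≤ ‖A c‖ + ‖A (v - c)‖ := norm_add_le _ _
      _ ≤ _ := add_le_add h3 h4
  have h5 : ‖A‖ ≤ L + ‖A‖ / 2 := by
    refine A.opNorm_le_bound (by positivity) fun v => ?_
    rcases (norm_nonneg v).eq_or_lt with h | h
    · rw [norm_eq_zero.mp h.symm]; simp
    · have h6 := h2 ((2 / ‖v‖) • v) (by
        rw [norm_smul, norm_div, norm_norm, Real.norm_eq_abs, abs_two, div_mul_cancel₀ _ h.ne'])
      rw [map_smul, norm_smul, norm_div, norm_norm, Real.norm_eq_abs, abs_two,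
        div_mul_eq_mul_div, div_le_iff₀ h] at h6
      linarith
  intro v
  rw [← hA, ← mul_pow]
  refine pow_le_pow_left₀ (norm_nonneg _) ((A.le_opNorm v).trans ?_) 2
  gcongr
  linarith

end Design

/-! ### Most data sets are tame -/

section TameProbability

variable {n p : ℕ} {P : Measure (Obs p)} {CX Cy q Cys : ℝ} {ℓ : ℝ → ℝ → ℝ} {C s : ℝ}
  {r : Fin p → ℝ → ℝ} {ν Crr lam : ℝ}

/-- The bound for the design matrix of a tame data set; the number of observations is at most
proportional to the dimension, with a constant entering through `T`. -/
def designBound (CX T : ℝ) : ℝ := max 1 (2 * √(4 * CX * T))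

/-- The bound for the leave-one-out predictors on a tame data set. -/
def leaveOneOutBound (C s lam ν CX a Y : ℝ) (n p : ℕ) : ℝ :=
  √(8 * (CX / p) * (a * Real.log n) * (2 / (lam * ν) * (n * growthBound C s Y 0)))

/-- The bound for the influence of removed observations on a tame data set. -/
def influenceBound (lam ν CX T a : ℝ) (n p : ℕ) : ℝ :=
  √(4 * (CX / p) * (a * Real.log n)) * (designBound CX T / (lam * ν))

lemma measure_response_le (hP : DataAssumptions P CX s Cy q Cys) :
    datasetLaw n P {D | ∃ i, Cy < |(D i).1|} ≤ ENNReal.ofReal (n * q) := by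
  have := hP.isProbability
  have hset : {D : Dataset n p | ∃ i, Cy < |(D i).1|} =
      ⋃ i, Function.eval i ⁻¹' {z : Obs p | Cy < |z.1|} := by
    ext D; simp
  have hm : MeasurableSet {z : Obs p | Cy < |z.1|} :=
    measurableSet_lt measurable_const (by fun_prop)
  have hq : P {z : Obs p | Cy < |z.1|} ≤ ENNReal.ofReal q := by
    rw [← ofReal_measureReal]
    exact ENNReal.ofReal_le_ofReal hP.tail
  calc _ ≤ ∑ i : Fin n, datasetLaw n P (Function.eval i ⁻¹' {z : Obs p | Cy < |z.1|}) := by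
        rw [hset]; exact measure_iUnion_fintype_le _ _
    _ = ∑ i : Fin n, P {z : Obs p | Cy < |z.1|} := by
        refine Finset.sum_congr rfl fun i _ => ?_
        exact (measurePreserving_eval (fun _ : Fin n => P) i).measure_preimage hm.nullMeasurableSet
    _ ≤ ∑ i : Fin n, ENNReal.ofReal q := Finset.sum_le_sum fun _ _ => hq
    _ = _ := by
        rw [Finset.sum_const, Finset.card_univ, Fintype.card_fin, nsmul_eq_mul,
          ENNReal.ofReal_mul (Nat.cast_nonneg n), ENNReal.ofReal_natCast]

lemma exp_two_sqrt_le : √2 ≤ Real.exp (1 / 2) := by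
  have : √2 ≤ 3 / 2 := Real.sqrt_le_iff.mpr ⟨by norm_num, by norm_num⟩
  linarith [Real.add_one_le_exp (1 / 2 : ℝ)]

/-- Each of the at most `5 ^ p ≤ exp (4 p)` net points fails with probability at most `√2 ^ n * exp
(-T p)`. Since `n ≤ (T - 5) p`, the union bound leaves `exp (-p)`. -/
lemma measure_not_gramBound_le (hP : DataAssumptions P CX s Cy q Cys) (hCX : 0 < CX) (hp : 0 < p)
    {T : ℝ} (hT : (n : ℝ) / p ≤ T - 5) :
    datasetLaw n P {D | ¬ GramBound (fun i => (D i).2) Finset.univ (designBound CX T)} ≤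
      ENNReal.ofReal (Real.exp (-p)) := by
  obtain ⟨N, hcard, hN⟩ := exists_net p
  have hT0 : 0 ≤ T := by
    have : (0 : ℝ) ≤ n / p := by positivity
    linarith
  have hp' : (0 : ℝ) < p := by exact_mod_cast hp
  have hsub : {D : Dataset n p | ¬ GramBound (fun i => (D i).2) Finset.univ (designBound CX T)} ⊆
      ⋃ c ∈ N, {D | 4 * (CX / p) * (T * p) * ‖c‖ ^ 2 <
        ∑ j ∈ (Finset.univ : Finset (Fin n)), inner ℝ (D j).2 c ^ 2} := by
    intro D hD
    by_contra hcon
    simp only [Set.mem_iUnion, Set.mem_ofPred_eq, not_exists, not_lt] at hcon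
    refine hD fun v => ?_
    refine (gramBound_of_net (L := √(4 * CX * T)) (Real.sqrt_nonneg _) hN (fun c hc => ?_) v).trans ?_
    · refine (hcon c hc).trans (le_of_eq ?_)
      rw [Real.sq_sqrt (by positivity)]
      field_simp
    · gcongr
      exact le_max_right _ _
  calc _ ≤ ∑ c ∈ N, datasetLaw n P {D | 4 * (CX / p) * (T * p) * ‖c‖ ^ 2 <
        ∑ j ∈ (Finset.univ : Finset (Fin n)), inner ℝ (D j).2 c ^ 2} :=
        (measure_mono hsub).trans (measure_biUnion_finset_le _ _)
    _ ≤ ∑ c ∈ N, ENNReal.ofReal (√2 ^ n * Real.exp (-(T * p))) := by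
        refine Finset.sum_le_sum fun c _ => ?_
        simpa using measure_lt_sum_sq_inner_le (n := n) hP hCX hp Finset.univ
          (u := fun _ => c) measurable_const (fun _ _ _ => rfl) (T * p)
    _ = ENNReal.ofReal (N.card * (√2 ^ n * Real.exp (-(T * p)))) := by
        rw [Finset.sum_const, nsmul_eq_mul, ENNReal.ofReal_mul (Nat.cast_nonneg _),
          ENNReal.ofReal_natCast]
    _ ≤ _ := by
        refine ENNReal.ofReal_le_ofReal ?_
        have h5 : (5 : ℝ) ≤ Real.exp 4 := by linarith [Real.add_one_le_exp (4 : ℝ)]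
        have hN5 : (N.card : ℝ) ≤ Real.exp (4 * p) := by
          calc (N.card : ℝ) ≤ 5 ^ p := by exact_mod_cast hcard
            _ ≤ Real.exp 4 ^ p := by gcongr
            _ = _ := by rw [← Real.exp_nat_mul]; ring_nf
        have h2 : √2 ^ n ≤ Real.exp n := by
          calc √2 ^ n ≤ Real.exp (1 / 2) ^ n := by gcongr; exact exp_two_sqrt_le
            _ = Real.exp (n * (1 / 2)) := by rw [← Real.exp_nat_mul]
            _ ≤ _ := Real.exp_le_exp.mpr (by linarith [Nat.cast_nonneg (α := ℝ) n])
        rw [div_le_iff₀ hp'] at hT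
        calc N.card * (√2 ^ n * Real.exp (-(T * p)))
            ≤ Real.exp (4 * p) * (Real.exp n * Real.exp (-(T * p))) := by gcongr
          _ = Real.exp (4 * p + (n + -(T * p))) := by rw [← Real.exp_add, ← Real.exp_add]
          _ ≤ _ := Real.exp_le_exp.mpr (by linarith)

/-- A deviation level growing with `k + 1` absorbs the moment factor `√2 ^ k` and still leaves `n ^
(-k)` to pay for the number of sets of size `k`; `a ≥ 2` is what this takes. -/
lemma sqrt_two_pow_mul_exp_le (hn : 3 ≤ n) {a : ℝ} (ha : 2 ≤ a) (k : ℕ) :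
    √2 ^ k * Real.exp (-((k + 1) * (a * Real.log n))) ≤
      (1 / (n : ℝ)) ^ k * Real.exp (-(a * Real.log n)) := by
  have hn0 : (0 : ℝ) < n := by positivity
  have hlog : 1 ≤ Real.log n := by
    rw [Real.le_log_iff_exp_le hn0]
    have : (3 : ℝ) ≤ n := by exact_mod_cast hn
    linarith [Real.exp_one_lt_d9]
  have h1 : √2 ^ k ≤ Real.exp (k * Real.log n) := by
    calc √2 ^ k ≤ Real.exp (1 / 2) ^ k := by gcongr; exact exp_two_sqrt_le
      _ = Real.exp (k * (1 / 2)) := by rw [← Real.exp_nat_mul]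
      _ ≤ _ := Real.exp_le_exp.mpr (by gcongr; linarith)
  have h2 : (1 / (n : ℝ)) ^ k = Real.exp (-(k * Real.log n)) := by
    rw [Real.exp_neg, Real.exp_nat_mul, Real.exp_log hn0, one_div, inv_pow]
  calc _ ≤ Real.exp (k * Real.log n) * Real.exp (-((k + 1) * (a * Real.log n))) := by gcongr
    _ = Real.exp (k * Real.log n - (k + 1) * (a * Real.log n)) := by rw [← Real.exp_add]; ring_nf
    _ ≤ Real.exp (-(k * Real.log n) + -(a * Real.log n)) := by
        refine Real.exp_le_exp.mpr ?_
        have : 0 ≤ k * Real.log n * (a - 2) :=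
          mul_nonneg (mul_nonneg (Nat.cast_nonneg k) (by linarith)) (by linarith)
        linarith
    _ = _ := by rw [h2, Real.exp_add]

/-- The binomial theorem gives `(1 + 1 / n) ^ n ≤ e`: all subsets together cost only a constant in
the union bound. -/
lemma sum_one_div_pow_card_le (hn : 1 ≤ n) :
    ∑ M : Finset (Fin n), (1 / (n : ℝ)) ^ M.card ≤ 3 := by
  have hn0 : (0 : ℝ) < n := by positivity
  have h := Finset.sum_pow_mul_eq_add_pow (1 / (n : ℝ)) 1 (Finset.univ : Finset (Fin n))
  simp only [one_pow, mul_one, Finset.powerset_univ, Finset.card_univ, Fintype.card_fin] at h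
  rw [h]
  calc (1 / (n : ℝ) + 1) ^ n ≤ Real.exp (1 / n) ^ n := by
        gcongr; exact Real.add_one_le_exp _
    _ = Real.exp 1 := by rw [← Real.exp_nat_mul, mul_one_div_cancel hn0.ne']
    _ ≤ 3 := by linarith [Real.exp_one_lt_d9]

/-- The data sets for which a form of the features in `M`, given by the other observations, is
large. -/
def deviationSet (κ : ℝ) (M : Finset (Fin n)) (u : Dataset n p → Param p) : Set (Dataset n p) :=
  {D | 4 * (CX / p) * ((M.card + 1) * κ) * ‖u D‖ ^ 2 < ∑ j ∈ M, inner ℝ (D j).2 (u D) ^ 2}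

lemma measure_deviationSet_le (hP : DataAssumptions P CX s Cy q Cys) (hCX : 0 < CX) (hp : 0 < p)
    (hn : 3 ≤ n) {a : ℝ} (ha : 2 ≤ a) (M : Finset (Fin n)) {u : Dataset n p → Param p}
    (hu : Measurable u) (hdep : ∀ D D' : Dataset n p, (∀ i ∉ M, D i = D' i) → u D = u D') :
    datasetLaw n P (deviationSet (CX := CX) (a * Real.log n) M u) ≤
      ENNReal.ofReal ((1 / (n : ℝ)) ^ M.card * Real.exp (-(a * Real.log n))) :=
  (measure_lt_sum_sq_inner_le hP hCX hp M hu hdep _).trans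
    (ENNReal.ofReal_le_ofReal (sqrt_two_pow_mul_exp_le hn ha M.card))

/-- The index set `S M` retains those `k` for which `u M k` ignores the observations in `M`; for the
influence on other observations these are the `k ∉ M`. -/
lemma sum_measure_deviationSet_le {ι : Type*} [Fintype ι] (hP : DataAssumptions P CX s Cy q Cys)
    (hCX : 0 < CX) (hp : 0 < p)
    (hn : 3 ≤ n) {a : ℝ} (ha : 2 ≤ a) {u : Finset (Fin n) → ι → Dataset n p → Param p}
    (hu : ∀ M k, Measurable (u M k)) {S : Finset (Fin n) → Finset ι}
    (hdep : ∀ M, ∀ k ∈ S M, ∀ D D' : Dataset n p, (∀ i ∉ M, D i = D' i) → u M k D = u M k D') :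
    datasetLaw n P (⋃ M, ⋃ k ∈ S M, deviationSet (CX := CX) (a * Real.log n) M (u M k)) ≤
      ENNReal.ofReal (3 * Fintype.card ι * Real.exp (-(a * Real.log n))) := by
  calc _ ≤ ∑ M : Finset (Fin n), ∑ k ∈ S M,
        datasetLaw n P (deviationSet (CX := CX) (a * Real.log n) M (u M k)) :=
        (measure_iUnion_fintype_le _ _).trans
          (Finset.sum_le_sum fun M _ => measure_biUnion_finset_le _ _)
    _ ≤ ∑ M : Finset (Fin n), ∑ k : ι,
        ENNReal.ofReal ((1 / (n : ℝ)) ^ M.card * Real.exp (-(a * Real.log n))) := by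
        refine Finset.sum_le_sum fun M _ => ?_
        refine (Finset.sum_le_sum fun k hk =>
          measure_deviationSet_le hP hCX hp hn ha M (hu M k) (hdep M k hk)).trans ?_
        exact Finset.sum_le_sum_of_subset (Finset.subset_univ _)
    _ = ENNReal.ofReal (∑ M : Finset (Fin n), Fintype.card ι *
        ((1 / (n : ℝ)) ^ M.card * Real.exp (-(a * Real.log n)))) := by
        rw [ENNReal.ofReal_sum_of_nonneg fun _ _ => by positivity]
        refine Finset.sum_congr rfl fun M _ => ?_
        rw [Finset.sum_const, nsmul_eq_mul, Finset.card_univ,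
          ENNReal.ofReal_mul (Nat.cast_nonneg (Fintype.card ι)), ENNReal.ofReal_natCast]
    _ ≤ _ := by
        refine ENNReal.ofReal_le_ofReal ?_
        have h := sum_one_div_pow_card_le (n := n) (by omega)
        calc _ = (∑ M : Finset (Fin n), (1 / (n : ℝ)) ^ M.card) *
              (Fintype.card ι * Real.exp (-(a * Real.log n))) := by
              rw [Finset.sum_mul]
              exact Finset.sum_congr rfl fun _ _ => by ring
          _ ≤ 3 * (Fintype.card ι * Real.exp (-(a * Real.log n))) := by gcongr
          _ = _ := by ring

lemma GramBound.norm_le {x : Fin n → Param p} {K : ℝ} (h : GramBound x Finset.univ K) (hK : 0 ≤ K)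
    (i : Fin n) : ‖x i‖ ≤ K := by
  have h1 := h.abs_inner_le hK (Finset.mem_univ i) (x i)
  rw [real_inner_self_eq_norm_sq, abs_of_nonneg (sq_nonneg _), pow_two] at h1
  rcases (norm_nonneg (x i)).eq_or_lt with h0 | h0
  · rw [← h0]; exact hK
  · exact le_of_mul_le_mul_right h1 h0

lemma norm_influence_le (hℓ : LossAssumptions ℓ C s) (hr : RegularizerAssumptions r ν Crr)
    (hlam : 0 < lam) (hν : 0 < ν) (D : Dataset n p) (M : Finset (Fin n)) (w : Param p) :
    ‖influence ℓ r lam D M w‖ ≤ ‖w‖ / (lam * ν) := by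
  rw [le_div_iff₀' (mul_pos hlam hν)]
  have h := norm_le_norm_riskHess (D := D) (M := M) hℓ hr hlam (estimator ℓ r lam D M)
    (influence ℓ r lam D M w)
  rwa [influence, riskHess_apply_inverse hℓ hr hlam hν] at h

/-- A data set is tame outside of exceptional sets of small probability. -/
theorem measure_not_isTame_le (hP : DataAssumptions P CX s Cy q Cys)
    (hℓ : LossAssumptions ℓ C s) (hr : RegularizerAssumptions r ν Crr) (hlam : 0 < lam) (hν : 0 < ν)
    (hCX : 0 < CX) (hp : 0 < p) (hn : 3 ≤ n) {T a : ℝ} (hT : (n : ℝ) / p ≤ T - 5) (ha : 2 ≤ a) :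
    datasetLaw n P {D | ¬ IsTame ℓ r lam (designBound CX T) |Cy|
        (leaveOneOutBound C s lam ν CX a |Cy| n p) (influenceBound lam ν CX T a n p) D} ≤
      ENNReal.ofReal (n * q) + ENNReal.ofReal (Real.exp (-p)) +
        ENNReal.ofReal (3 * (2 * n + p) * Real.exp (-(a * Real.log n))) := by
  have hK1 : 1 ≤ designBound CX T := le_max_left _ _
  have hK0 : 0 ≤ designBound CX T := zero_le_one.trans hK1
  have hΛ : 0 < lam * ν := mul_pos hlam hν
  have hlog : 0 ≤ Real.log n := Real.log_natCast_nonneg n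
  have ha0 : 0 ≤ a * Real.log n := mul_nonneg (by linarith) hlog
  have hest : ∀ M : Finset (Fin n), Measurable fun D : Dataset n p => estimator ℓ r lam D M :=
    fun M => measurable_estimator hℓ hr hlam hν M
  -- leave-one-out predictors
  have hE1 := sum_measure_deviationSet_le (ι := Fin n) hP hCX hp hn ha
    (u := fun M _ D => estimator ℓ r lam D M) (fun M _ => hest M) (S := fun M => M)
    (fun M k _ D D' h => estimator_congr h)
  -- influence on the remaining observations
  have hE2 := sum_measure_deviationSet_le (ι := Fin n) hP hCX hp hn ha
    (u := fun M k D => influence ℓ r lam D M (D k).2)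
    (fun M k => measurable_influence hℓ hr hlam hν M (measurable_snd.comp (measurable_pi_apply k)))
    (S := fun M => Mᶜ) (fun M k hk D D' h => by
      rw [influence_congr h, h k (Finset.mem_compl.mp hk)])
  -- influence on the coordinates
  have hE3 := sum_measure_deviationSet_le (ι := Fin p) hP hCX hp hn ha
    (u := fun M k D => influence ℓ r lam D M (EuclideanSpace.single k 1))
    (fun M k => measurable_influence hℓ hr hlam hν M measurable_const)
    (S := fun _ => Finset.univ) (fun M k _ D D' h => influence_congr h _)
  have hsub : {D : Dataset n p | ¬ IsTame ℓ r lam (designBound CX T) |Cy|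
        (leaveOneOutBound C s lam ν CX a |Cy| n p) (influenceBound lam ν CX T a n p) D} ⊆
      ({D | ∃ i, Cy < |(D i).1|} ∪
        {D | ¬ GramBound (fun i => (D i).2) Finset.univ (designBound CX T)}) ∪
      ((⋃ M, ⋃ k ∈ M, deviationSet (CX := CX) (a * Real.log n) M
          fun D => estimator ℓ r lam D M) ∪
        ((⋃ M, ⋃ k ∈ Mᶜ, deviationSet (CX := CX) (a * Real.log n) M
          fun D => influence ℓ r lam D M (D k).2) ∪
        (⋃ M, ⋃ k ∈ Finset.univ, deviationSet (CX := CX) (a * Real.log n) M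
          fun D => influence ℓ r lam D M (EuclideanSpace.single k 1)))) := by
    intro D hD
    by_contra hcon
    simp only [Set.mem_union, Set.mem_iUnion, not_or, not_exists, Set.mem_ofPred_eq, not_lt,
      not_not, deviationSet] at hcon
    obtain ⟨⟨hy, hX⟩, h1, h2, h3⟩ := hcon
    have hY : ∀ i, |(D i).1| ≤ |Cy| := fun i => (hy i).trans (le_abs_self _)
    have hinf : ∀ (M : Finset (Fin n)) (w : Param p), ‖w‖ ≤ designBound CX T →
        4 * (CX / p) * (((M.card : ℝ) + 1) * (a * Real.log n)) * ‖influence ℓ r lam D M w‖ ^ 2 ≤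
          influenceBound lam ν CX T a n p ^ 2 * (M.card + 1) := fun M w hw => by
      rw [influenceBound, mul_pow, Real.sq_sqrt (by positivity)]
      calc _ ≤ 4 * (CX / p) * (((M.card : ℝ) + 1) * (a * Real.log n)) *
            (designBound CX T / (lam * ν)) ^ 2 := by
            gcongr
            exact (norm_influence_le hℓ hr hlam hν D M w).trans (by gcongr)
        _ = _ := by ring
    refine hD ⟨hY, hX, fun i => ?_, fun M k hk => ?_, fun M k => ?_⟩
    -- For a singleton `|M| + 1 = 2`, which turns the `4` of the deviation bound into the `8` of
    -- `leaveOneOutBound`.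
    · have h4 := h1 {i} i (Finset.mem_singleton_self i)
      rw [Finset.sum_singleton, Finset.card_singleton] at h4
      have h5 := sq_norm_estimator_le (D := D) hℓ hr hlam hν (abs_nonneg Cy) hY {i}
      have h6 : ‖estimator ℓ r lam D {i}‖ ^ 2 ≤
          2 / (lam * ν) * (n * growthBound C s |Cy| 0) := by
        rw [div_mul_eq_mul_div, le_div_iff₀ hΛ]
        linarith
      refine Real.abs_le_sqrt (h4.trans ?_)
      calc _ ≤ 4 * (CX / p) * (((1 : ℕ) + 1) * (a * Real.log n)) *
            (2 / (lam * ν) * (n * growthBound C s |Cy| 0)) := by gcongr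
        _ = _ := by push_cast; ring
    · exact (h2 M k (Finset.mem_compl.mpr hk)).trans (hinf M _ (hX.norm_le hK0 k))
    · exact (h3 M k (Finset.mem_univ k)).trans (hinf M _ (by simpa using hK1))
  have hrest : 3 * (2 * (n : ℝ) + p) * Real.exp (-(a * Real.log n)) =
      3 * (Fintype.card (Fin n) : ℕ) * Real.exp (-(a * Real.log n)) +
        (3 * (Fintype.card (Fin n) : ℕ) * Real.exp (-(a * Real.log n)) +
          3 * (Fintype.card (Fin p) : ℕ) * Real.exp (-(a * Real.log n))) := by
    simp only [Fintype.card_fin]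
    ring
  rw [hrest, ENNReal.ofReal_add (by positivity) (by positivity),
    ENNReal.ofReal_add (by positivity) (by positivity)]
  refine (measure_mono hsub).trans ((measure_union_le _ _).trans (add_le_add
    ((measure_union_le _ _).trans (add_le_add (measure_response_le hP)
      (measure_not_gramBound_le hP hCX hp hT))) ((measure_union_le _ _).trans (add_le_add hE1
        ((measure_union_le _ _).trans (add_le_add hE2 hE3))))))

end TameProbability

/-! ### The isotropic Laplace distribution -/

section Laplace

variable {p : ℕ} {κ : ℝ}

lemma lintegral_laplaceWeight {f : Param p → ℝ} (hf : Measurable f) (κ : ℝ) :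
    ∫⁻ b, ENNReal.ofReal (f b) ∂laplaceWeight p κ =
      ∫⁻ b : Param p, ENNReal.ofReal (Real.exp (-κ * ‖b‖) * f b) := by
  rw [laplaceWeight, lintegral_withDensity_eq_lintegral_mul _ (by fun_prop) (by fun_prop)]
  simp_rw [Pi.mul_apply, ← ENNReal.ofReal_mul (Real.exp_pos _).le]

/-- The radial moments of the unnormalized Laplace measure. -/
lemma lintegral_norm_pow_laplaceWeight (hp : 0 < p) (hκ : 0 < κ) (k : ℕ) :
    ∫⁻ b, ENNReal.ofReal (‖b‖ ^ k) ∂laplaceWeight p κ =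
      ENNReal.ofReal (p * volume.real (Metric.ball (0 : Param p) 1) *
        ((1 / κ) ^ (p + k) * (p + k - 1).factorial)) := by
  have : Nontrivial (Param p) := by
    have : Nonempty (Fin p) := ⟨⟨0, hp⟩⟩
    infer_instance
  set f : ℝ → ℝ := fun y => Real.exp (-κ * y) * y ^ k with hf
  have hval : ∫ y in Set.Ioi (0 : ℝ), y ^ (p - 1) • f y =
      (1 / κ) ^ (p + k) * (p + k - 1).factorial := by
    have h1 := Real.integral_rpow_mul_exp_neg_mul_Ioi (a := ((p + k : ℕ) : ℝ)) (r := κ)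
      (by positivity) hκ
    obtain ⟨j, hj⟩ : ∃ j, p + k = j + 1 := ⟨p + k - 1, by omega⟩
    have hj' : p - 1 + k = j := by omega
    rw [hj, Nat.add_sub_cancel]
    rw [hj, Real.rpow_natCast, Nat.cast_succ, Real.Gamma_nat_eq_factorial] at h1
    rw [← h1]
    refine setIntegral_congr_fun measurableSet_Ioi fun y _ => ?_
    simp only [hf, smul_eq_mul, add_sub_cancel_right, Real.rpow_natCast]
    rw [← hj', pow_add, neg_mul]
    ring
  have hne : ∫ y in Set.Ioi (0 : ℝ), y ^ (p - 1) • f y ≠ 0 := by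
    rw [hval]; positivity
  -- Integrability comes for free: the Bochner integral of a non-integrable function is zero, and
  -- the radial integral was computed to be nonzero.
  have hint : Integrable (fun b : Param p => f ‖b‖) volume := by
    rw [integrable_fun_norm_addHaar]
    simpa using! not_imp_comm.1 integral_undef hne
  rw [lintegral_laplaceWeight (by fun_prop),
    ← ofReal_integral_eq_lintegral_ofReal hint (Eventually.of_forall fun b => by positivity),
    integral_fun_norm_addHaar volume f]
  congr 1
  rw [finrank_euclideanSpace_fin, hval]
  simp only [nsmul_eq_mul, smul_eq_mul]
  ring

lemma volume_real_ball_pos : 0 < volume.real (Metric.ball (0 : Param p) 1) :=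
  ENNReal.toReal_pos (Metric.measure_ball_pos _ _ one_pos).ne' measure_ball_lt_top.ne

lemma laplaceWeight_univ (hp : 0 < p) (hκ : 0 < κ) :
    laplaceWeight p κ Set.univ = ENNReal.ofReal (p * volume.real (Metric.ball (0 : Param p) 1) *
        ((1 / κ) ^ p * (p - 1).factorial)) := by
  simpa using lintegral_norm_pow_laplaceWeight hp hκ 0

lemma isProbabilityMeasure_isotropicLaplace (hp : 0 < p) (hκ : 0 < κ) :
    IsProbabilityMeasure (isotropicLaplace p κ) := by
  have hv := volume_real_ball_pos (p := p)
  refine ⟨?_⟩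
  rw [isotropicLaplace, Measure.smul_apply, smul_eq_mul, laplaceWeight_univ hp hκ]
  exact ENNReal.inv_mul_cancel (ENNReal.ofReal_pos.mpr (by positivity)).ne' ENNReal.ofReal_ne_top

/-- The quotient of the factorials is `p (p + 1) ⋯ (p + k - 1)`, and `p + j ≤ (j + 1) p` bounds each
factor. -/
lemma factorial_add_le (hp : 0 < p) (k : ℕ) :
    (p + k - 1).factorial ≤ (p - 1).factorial * (k.factorial * p ^ k) := by
  induction k with
  | zero => simp
  | succ k ih =>
    have h1 : p + (k + 1) - 1 = (p + k - 1) + 1 := by omega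
    have h2 : p + k - 1 + 1 ≤ (k + 1) * p := by nlinarith [Nat.zero_le k, Nat.sub_add_cancel (show 1 ≤ p + k by omega)]
    rw [h1, Nat.factorial_succ, Nat.factorial_succ, pow_succ]
    calc _ ≤ (k + 1) * p * ((p - 1).factorial * (k.factorial * p ^ k)) := Nat.mul_le_mul h2 ih
      _ = _ := by ring

/-- The radial moments of the isotropic Laplace distribution. -/
lemma lintegral_norm_pow_isotropicLaplace_le (hp : 0 < p) (hκ : 0 < κ) (k : ℕ) :
    ∫⁻ b, ENNReal.ofReal (‖b‖ ^ k) ∂isotropicLaplace p κ ≤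
      ENNReal.ofReal (k.factorial * (p / κ) ^ k) := by
  have hv := volume_real_ball_pos (p := p)
  rw [isotropicLaplace, lintegral_smul_measure, lintegral_norm_pow_laplaceWeight hp hκ,
    laplaceWeight_univ hp hκ, smul_eq_mul, ← ENNReal.ofReal_inv_of_pos (by positivity),
    ← ENNReal.ofReal_mul (by positivity)]
  refine ENNReal.ofReal_le_ofReal ?_
  rw [inv_mul_le_iff₀ (by positivity)]
  have h : ((p + k - 1).factorial : ℝ) ≤ (p - 1).factorial * (k.factorial * p ^ k) := by
    exact_mod_cast factorial_add_le hp k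
  calc _ ≤ p * volume.real (Metric.ball (0 : Param p) 1) *
        ((1 / κ) ^ (p + k) * ((p - 1).factorial * (k.factorial * p ^ k))) := by gcongr
    _ = _ := by rw [pow_add, div_pow (p : ℝ) κ k]; ring

end Laplace

/-! ### The generalization error divergence -/

section GeneralizationError

variable {p : ℕ} {P : Measure (Obs p)} {CX Cy q Cys : ℝ} {ℓ : ℝ → ℝ → ℝ} {C s : ℝ}

/-- After normalizing `v` so that the exponential moment of the square is at most `√2`, the moments
follow from `x ^ k / k! ≤ exp x`. -/
lemma DataAssumptions.lintegral_inner_pow_le (hP : DataAssumptions P CX s Cy q Cys) (hCX : 0 < CX)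
    (hp : 0 < p) (v : Param p) {k : ℕ} (hk : k ≠ 0) :
    ∫⁻ z, ENNReal.ofReal (inner ℝ z.2 v ^ (2 * k)) ∂P ≤
      ENNReal.ofReal (√2 * k.factorial * (4 * (CX / p) * ‖v‖ ^ 2) ^ k) := by
  rcases eq_or_ne v 0 with rfl | hv
  · simp [hk]
  have hv0 : 0 < ‖v‖ := norm_pos_iff.mpr hv
  set τ : ℝ := 4 * (CX / p) * ‖v‖ ^ 2 with hτ
  have hτ0 : 0 < τ := by positivity
  have h1 := hP.lintegral_exp_sq_inner_le (u := (√τ)⁻¹ • v) (le_of_eq (by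
    rw [norm_smul, norm_inv, Real.norm_eq_abs, abs_of_nonneg (Real.sqrt_nonneg _), mul_pow, inv_pow,
      Real.sq_sqrt hτ0.le, hτ]
    field_simp))
  calc _ ≤ ∫⁻ z, ENNReal.ofReal (k.factorial * τ ^ k) *
        ENNReal.ofReal (Real.exp (inner ℝ z.2 ((√τ)⁻¹ • v) ^ 2)) ∂P := by
        refine lintegral_mono fun z => ?_
        rw [← ENNReal.ofReal_mul (by positivity)]
        refine ENNReal.ofReal_le_ofReal ?_
        have h2 := Real.pow_div_factorial_le_exp (inner ℝ z.2 ((√τ)⁻¹ • v) ^ 2) (sq_nonneg _) k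
        rw [div_le_iff₀ (by positivity)] at h2
        have h3 : inner ℝ z.2 v ^ (2 * k) = τ ^ k * (inner ℝ z.2 ((√τ)⁻¹ • v) ^ 2) ^ k := by
          rw [← mul_pow, inner_smul_right, mul_pow (√τ)⁻¹, inv_pow, Real.sq_sqrt hτ0.le,
            mul_inv_cancel_left₀ hτ0.ne', pow_mul]
        rw [h3]
        calc _ ≤ τ ^ k * (Real.exp (inner ℝ z.2 ((√τ)⁻¹ • v) ^ 2) * k.factorial) := by gcongr
          _ = _ := by ring
    _ = ENNReal.ofReal (k.factorial * τ ^ k) *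
        ∫⁻ z, ENNReal.ofReal (Real.exp (inner ℝ z.2 ((√τ)⁻¹ • v) ^ 2)) ∂P :=
        lintegral_const_mul _ (by fun_prop)
    _ ≤ ENNReal.ofReal (k.factorial * τ ^ k) * ENNReal.ofReal √2 := by gcongr
    _ = _ := by rw [← ENNReal.ofReal_mul (by positivity)]; ring_nf

/-- The constant in the moment bound of order `2 k` for a perturbed linear predictor. -/
def perturbationConst (CX : ℝ) (k : ℕ) : ℝ :=
  √2 * k.factorial * (4 * CX) ^ k * (4 ^ k * (1 + (2 * k).factorial))

/-- The feature is integrated first with the noise frozen, which leaves a moment of `‖v + b‖`. The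
factor `1 / p` of the covariance cancels the square of the norm scale `√p * ρ`. -/
lemma lintegral_inner_add_pow_le (hP : DataAssumptions P CX s Cy q Cys) (hCX : 0 < CX)
    (hp : 0 < p) {κ ρ : ℝ} (hκ : 0 < κ) (hρ : 0 ≤ ρ) {v : Param p} (hv : ‖v‖ ≤ √p * ρ)
    (hκρ : p / κ ≤ √p * ρ) {k : ℕ} (hk : k ≠ 0) :
    ∫⁻ w : Obs p × Param p, ENNReal.ofReal (inner ℝ w.1.2 (v + w.2) ^ (2 * k))
        ∂(P.prod (isotropicLaplace p κ)) ≤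
      ENNReal.ofReal (perturbationConst CX k * ρ ^ (2 * k)) := by
  have := hP.isProbability
  have := isProbabilityMeasure_isotropicLaplace hp hκ
  have hp0 : (0 : ℝ) < p := by exact_mod_cast hp
  have hpow : (√(p : ℝ) * ρ) ^ (2 * k) = p ^ k * ρ ^ (2 * k) := by
    rw [mul_pow, pow_mul, Real.sq_sqrt hp0.le]
  rw [lintegral_prod_symm _ (by fun_prop)]
  set c : ℝ := √2 * k.factorial * (4 * (CX / p)) ^ k * 4 ^ k with hc
  have hc0 : 0 ≤ c := by positivity
  calc _ ≤ ∫⁻ b, ENNReal.ofReal c * (ENNReal.ofReal (p ^ k * ρ ^ (2 * k)) +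
        ENNReal.ofReal (‖b‖ ^ (2 * k))) ∂isotropicLaplace p κ := by
        refine lintegral_mono fun b => ?_
        refine (hP.lintegral_inner_pow_le hCX hp (v + b) hk).trans ?_
        rw [← ENNReal.ofReal_add (by positivity) (by positivity), ← ENNReal.ofReal_mul hc0]
        refine ENNReal.ofReal_le_ofReal ?_
        have h1 : ‖v + b‖ ^ (2 * k) ≤ 4 ^ k * (p ^ k * ρ ^ (2 * k) + ‖b‖ ^ (2 * k)) := by
          calc ‖v + b‖ ^ (2 * k) ≤ (√p * ρ + ‖b‖) ^ (2 * k) := by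
                gcongr
                exact (norm_add_le _ _).trans (by gcongr)
            _ ≤ 2 ^ (2 * k - 1) * ((√p * ρ) ^ (2 * k) + ‖b‖ ^ (2 * k)) :=
                add_pow_le (by positivity) (norm_nonneg _) _
            _ ≤ 4 ^ k * ((√p * ρ) ^ (2 * k) + ‖b‖ ^ (2 * k)) := by
                gcongr
                calc (2 : ℝ) ^ (2 * k - 1) ≤ 2 ^ (2 * k) :=
                      pow_le_pow_right₀ (by norm_num) (Nat.sub_le _ _)
                  _ = 4 ^ k := by rw [pow_mul]; norm_num
            _ = _ := by rw [hpow]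
        calc √2 * k.factorial * (4 * (CX / p) * ‖v + b‖ ^ 2) ^ k
            = √2 * k.factorial * (4 * (CX / p)) ^ k * ‖v + b‖ ^ (2 * k) := by
              rw [mul_pow, ← pow_mul]; ring
          _ ≤ √2 * k.factorial * (4 * (CX / p)) ^ k *
              (4 ^ k * (p ^ k * ρ ^ (2 * k) + ‖b‖ ^ (2 * k))) := by gcongr
          _ = _ := by rw [hc]; ring
    _ = ENNReal.ofReal c * (ENNReal.ofReal (p ^ k * ρ ^ (2 * k)) +
        ∫⁻ b, ENNReal.ofReal (‖b‖ ^ (2 * k)) ∂isotropicLaplace p κ) := by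
        rw [lintegral_const_mul _ (by fun_prop), lintegral_add_left measurable_const,
          lintegral_const, measure_univ, mul_one]
    _ ≤ ENNReal.ofReal c * (ENNReal.ofReal (p ^ k * ρ ^ (2 * k)) +
        ENNReal.ofReal ((2 * k).factorial * (p ^ k * ρ ^ (2 * k)))) := by
        gcongr
        refine (lintegral_norm_pow_isotropicLaplace_le hp hκ (2 * k)).trans
          (ENNReal.ofReal_le_ofReal ?_)
        rw [← hpow]
        gcongr
    _ = _ := by
        rw [← ENNReal.ofReal_add (by positivity) (by positivity), ← ENNReal.ofReal_mul hc0]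
        congr 1
        rw [hc, perturbationConst, mul_pow, mul_pow, div_pow]
        field_simp

lemma rpow_le_one_add_pow {x s : ℝ} {k : ℕ} (hx : 0 ≤ x) (hs : 0 ≤ s) (hk : s ≤ k) :
    x ^ s ≤ 1 + x ^ k := by
  rcases le_total x 1 with h | h
  · exact (Real.rpow_le_one hx h hs).trans (by linarith [pow_nonneg hx k])
  · calc x ^ s ≤ x ^ (k : ℝ) := Real.rpow_le_rpow_of_exponent_le h hk
      _ = x ^ k := Real.rpow_natCast x k
      _ ≤ _ := by linarith

/-- The factor of the scale `ρ` of the perturbation in the bound for the generalization error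
divergence. -/
def divergenceFactor (C CX Cys : ℝ) (k : ℕ) (F ρ : ℝ) : ℝ :=
  C / 2 * (4 * (4 + |Cys| + 4 ^ k * (√2 * k.factorial * (4 * F) ^ k) +
    4 ^ k * (perturbationConst CX k * ρ ^ (2 * k))) + perturbationConst CX 1)

/-- The weighted inequality `2 W |d| ≤ ρ W² + d² / ρ` decouples the growth factor `W` from the
increment `d`, so no independence of `y`, `a` and `d` is needed. As `d` has size `ρ`, both terms are
of order `ρ`. -/
lemma LossAssumptions.abs_sub_le_of_scale (hℓ : LossAssumptions ℓ C s) {k : ℕ} (hk : s ≤ k)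
    {ρ : ℝ} (hρ : 0 < ρ) (y a d : ℝ) :
    |ℓ y a - ℓ y (a + d)| ≤ C / 2 * (ρ * (4 * (4 + |y| ^ (2 * s) + 4 ^ k * a ^ (2 * k) +
      4 ^ k * d ^ (2 * k))) + d ^ 2 / ρ) := by
  set W : ℝ := 2 + |y| ^ s + 2 ^ k * |a| ^ k + 2 ^ k * |d| ^ k with hW
  have hys : 0 ≤ |y| ^ s := Real.rpow_nonneg (abs_nonneg y) s
  have h1 : |ℓ y a - ℓ y (a + d)| ≤ C * W * |d| := by
    refine (hℓ.abs_sub_le (Y := |y|) (Z := |a| + |d|) le_rfl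
      (by linarith [abs_nonneg d]) (abs_add_le a d)).trans ?_
    rw [show a - (a + d) = -d by ring, abs_neg, growthBound]
    have h2 : (|a| + |d|) ^ s ≤ 1 + (2 ^ k * |a| ^ k + 2 ^ k * |d| ^ k) := by
      refine (rpow_le_one_add_pow (by positivity) hℓ.s_pos.le hk).trans ?_
      gcongr
      calc (|a| + |d|) ^ k ≤ 2 ^ (k - 1) * (|a| ^ k + |d| ^ k) :=
            add_pow_le (abs_nonneg _) (abs_nonneg _) _
        _ ≤ 2 ^ k * (|a| ^ k + |d| ^ k) := by
            gcongr
            · norm_num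
            · exact Nat.sub_le _ _
        _ = _ := by ring
    have := hℓ.C_pos
    gcongr
    rw [hW]
    linarith
  have h2 : W * |d| ≤ (ρ * W ^ 2 + d ^ 2 / ρ) / 2 := by
    have h3 : 0 ≤ (ρ * W - |d|) ^ 2 / ρ := by positivity
    have h4 : (ρ * W - |d|) ^ 2 / ρ = ρ * W ^ 2 + d ^ 2 / ρ - 2 * (W * |d|) := by
      rw [← sq_abs d]
      field_simp
      ring
    linarith
  have h3 : W ^ 2 ≤ 4 * (4 + |y| ^ (2 * s) + 4 ^ k * a ^ (2 * k) + 4 ^ k * d ^ (2 * k)) := by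
    have e1 : |y| ^ (2 * s) = (|y| ^ s) ^ 2 := by
      rw [mul_comm, Real.rpow_mul (abs_nonneg y), Real.rpow_two]
    have e2 : ∀ x : ℝ, 4 ^ k * x ^ (2 * k) = (2 ^ k * |x| ^ k) ^ 2 := fun x => by
      rw [pow_mul, ← mul_pow, ← mul_pow, ← pow_mul, mul_comm k 2, pow_mul, mul_pow (2 : ℝ) |x| 2,
        sq_abs]
      norm_num
    rw [e1, e2, e2, hW]
    nlinarith [sq_nonneg (2 - |y| ^ s), sq_nonneg (2 - 2 ^ k * |a| ^ k),
      sq_nonneg (2 - 2 ^ k * |d| ^ k), sq_nonneg (|y| ^ s - 2 ^ k * |a| ^ k),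
      sq_nonneg (|y| ^ s - 2 ^ k * |d| ^ k), sq_nonneg (2 ^ k * |a| ^ k - 2 ^ k * |d| ^ k)]
  have hC := hℓ.C_pos
  calc _ ≤ C * (W * |d|) := by rw [← mul_assoc]; exact h1
    _ ≤ C * ((ρ * W ^ 2 + d ^ 2 / ρ) / 2) := by gcongr
    _ ≤ C * ((ρ * (4 * (4 + |y| ^ (2 * s) + 4 ^ k * a ^ (2 * k) + 4 ^ k * d ^ (2 * k))) +
        d ^ 2 / ρ) / 2) := by gcongr
    _ = _ := by ring

/-- The divergence between the predictions of `β₁` and of a Laplace perturbation of `β₂`. -/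
theorem lintegral_abs_loss_sub_le (hP : DataAssumptions P CX s Cy q Cys)
    (hℓ : LossAssumptions ℓ C s) (hCX : 0 < CX) (hp : 0 < p) {κ ρ F : ℝ} (hκ : 0 < κ) (hρ : 0 < ρ)
    {β₁ β₂ : Param p} (hβ : ‖β₂ - β₁‖ ≤ √p * ρ) (hκρ : p / κ ≤ √p * ρ)
    (hF : CX / p * ‖β₁‖ ^ 2 ≤ F) {k : ℕ} (hk : s ≤ k) :
    ∫⁻ w : Obs p × Param p,
      ENNReal.ofReal |ℓ w.1.1 (inner ℝ w.1.2 β₁) - ℓ w.1.1 (inner ℝ w.1.2 (β₂ + w.2))|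
        ∂(P.prod (isotropicLaplace p κ)) ≤
      ENNReal.ofReal (ρ * divergenceFactor C CX Cys k F ρ) := by
  have := hP.isProbability
  have := isProbabilityMeasure_isotropicLaplace hp hκ
  have hC := hℓ.C_pos
  have hk0 : k ≠ 0 := by
    rintro rfl
    have := hℓ.s_pos
    simp at hk
    linarith
  set μ := P.prod (isotropicLaplace p κ)
  have hfst : ∀ f : Obs p → ℝ≥0∞, Measurable f → ∫⁻ w, f w.1 ∂μ = ∫⁻ z, f z ∂P := fun f hf =>
    measurePreserving_fst.lintegral_comp hf
  set fy : Obs p × Param p → ℝ≥0∞ := fun w => ENNReal.ofReal (|w.1.1| ^ (2 * s)) with hfy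
  set fa : Obs p × Param p → ℝ≥0∞ := fun w => ENNReal.ofReal (inner ℝ w.1.2 β₁ ^ (2 * k)) with hfa
  set fd : ℕ → Obs p × Param p → ℝ≥0∞ := fun j w =>
    ENNReal.ofReal (inner ℝ w.1.2 (β₂ - β₁ + w.2) ^ (2 * j)) with hfd
  have hfym : Measurable fy := by fun_prop
  have hfam : Measurable fa := by fun_prop
  have hfdm : ∀ j, Measurable (fd j) := fun j => by fun_prop
  have hy : ∫⁻ w, fy w ∂μ ≤ ENNReal.ofReal |Cys| := by
    rw [hfst (fun z => ENNReal.ofReal (|z.1| ^ (2 * s))) (by fun_prop)]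
    exact hP.moment.trans (ENNReal.ofReal_le_ofReal (le_abs_self _))
  have hF0 : 0 ≤ F := le_trans (by positivity) hF
  have ha : ∫⁻ w, fa w ∂μ ≤ ENNReal.ofReal (√2 * k.factorial * (4 * F) ^ k) := by
    rw [hfst (fun z => ENNReal.ofReal (inner ℝ z.2 β₁ ^ (2 * k))) (by fun_prop)]
    refine (hP.lintegral_inner_pow_le hCX hp β₁ hk0).trans (ENNReal.ofReal_le_ofReal ?_)
    rw [mul_assoc 4]
    gcongr
  have hd : ∀ j, j ≠ 0 → ∫⁻ w, fd j w ∂μ ≤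
      ENNReal.ofReal (perturbationConst CX j * ρ ^ (2 * j)) := fun j hj =>
    lintegral_inner_add_pow_le hP hCX hp hκ hρ.le hβ hκρ hj
  have hc : ∀ j, 0 ≤ perturbationConst CX j := fun j => by
    unfold perturbationConst; positivity
  calc _ ≤ ∫⁻ w, ENNReal.ofReal (C / 2) * (ENNReal.ofReal (4 * ρ) * (ENNReal.ofReal 4 + fy w +
        ENNReal.ofReal (4 ^ k) * fa w + ENNReal.ofReal (4 ^ k) * fd k w) +
        ENNReal.ofReal (1 / ρ) * fd 1 w) ∂μ := by
        refine lintegral_mono fun w => ?_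
        have hsplit : inner ℝ w.1.2 (β₂ + w.2) =
            inner ℝ w.1.2 β₁ + inner ℝ w.1.2 (β₂ - β₁ + w.2) := by
          rw [← inner_add_right]; congr 1; abel
        rw [hsplit]
        refine (ENNReal.ofReal_le_ofReal (hℓ.abs_sub_le_of_scale hk hρ w.1.1 (inner ℝ w.1.2 β₁)
          (inner ℝ w.1.2 (β₂ - β₁ + w.2)))).trans (le_of_eq ?_)
        have e1 : 0 ≤ |w.1.1| ^ (2 * s) := Real.rpow_nonneg (abs_nonneg _) _
        have e2 : ∀ (x : ℝ) (j : ℕ), 0 ≤ x ^ (2 * j) := fun x j => by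
          rw [pow_mul]; positivity
        have e3 := e2 (inner ℝ w.1.2 β₁) k
        have e4 := e2 (inner ℝ w.1.2 (β₂ - β₁ + w.2)) k
        have e5 := e2 (inner ℝ w.1.2 (β₂ - β₁ + w.2)) 1
        simp only [hfy, hfa, hfd]
        rw [← ENNReal.ofReal_mul (by positivity), ← ENNReal.ofReal_mul (by positivity),
          ← ENNReal.ofReal_mul (by positivity), ← ENNReal.ofReal_add (by positivity) e1,
          ← ENNReal.ofReal_add (by positivity) (by positivity),
          ← ENNReal.ofReal_add (by positivity) (by positivity),
          ← ENNReal.ofReal_mul (by positivity), ← ENNReal.ofReal_add (by positivity) (by positivity),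
          ← ENNReal.ofReal_mul (by positivity)]
        congr 1
        ring
    _ = ENNReal.ofReal (C / 2) * (ENNReal.ofReal (4 * ρ) * (ENNReal.ofReal 4 + ∫⁻ w, fy w ∂μ +
        ENNReal.ofReal (4 ^ k) * ∫⁻ w, fa w ∂μ + ENNReal.ofReal (4 ^ k) * ∫⁻ w, fd k w ∂μ) +
        ENNReal.ofReal (1 / ρ) * ∫⁻ w, fd 1 w ∂μ) := by
        have m1 := hfdm 1
        have mk := hfdm k
        rw [lintegral_const_mul _ (by fun_prop), lintegral_add_left (by fun_prop),
          lintegral_const_mul _ (by fun_prop), lintegral_add_left (by fun_prop),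
          lintegral_add_left (by fun_prop), lintegral_add_left (by fun_prop),
          lintegral_const_mul _ hfam, lintegral_const_mul _ mk, lintegral_const_mul _ m1,
          lintegral_const, measure_univ, mul_one]
    _ ≤ ENNReal.ofReal (C / 2) * (ENNReal.ofReal (4 * ρ) * (ENNReal.ofReal 4 +
        ENNReal.ofReal |Cys| + ENNReal.ofReal (4 ^ k) *
          ENNReal.ofReal (√2 * k.factorial * (4 * F) ^ k) +
        ENNReal.ofReal (4 ^ k) * ENNReal.ofReal (perturbationConst CX k * ρ ^ (2 * k))) +
        ENNReal.ofReal (1 / ρ) * ENNReal.ofReal (perturbationConst CX 1 * ρ ^ (2 * 1))) := by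
        gcongr
        · exact hd k hk0
        · exact hd 1 one_ne_zero
    _ = _ := by
        have e1 := hc k
        have e2 := hc 1
        rw [← ENNReal.ofReal_mul (by positivity), ← ENNReal.ofReal_mul (by positivity),
          ← ENNReal.ofReal_mul (by positivity),
          ← ENNReal.ofReal_add (by positivity) (by positivity),
          ← ENNReal.ofReal_add (by positivity) (by positivity),
          ← ENNReal.ofReal_add (by positivity) (by positivity),
          ← ENNReal.ofReal_mul (by positivity), ← ENNReal.ofReal_add (by positivity) (by positivity),
          ← ENNReal.ofReal_mul (by positivity)]
        congr 1
        rw [divergenceFactor]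
        field_simp
        ring

end GeneralizationError

/-! ### Polylogarithmic sequences -/

section Polylog

lemma eventually_one_le_log : ∀ᶠ n : ℕ in atTop, 1 ≤ Real.log n :=
  (Real.tendsto_log_atTop.comp tendsto_natCast_atTop_atTop).eventually_ge_atTop 1

lemma isPolylog_iff {f : ℕ → ℝ} : IsPolylog f ↔ ∃ (k : ℕ) (c : ℝ), 0 < c ∧
    ∀ᶠ n : ℕ in atTop, |f n| ≤ c * Real.log n ^ k := by
  constructor
  · rintro ⟨k, hk⟩
    obtain ⟨c, hc, h⟩ := hk.exists_pos
    refine ⟨k, c, hc, ?_⟩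
    filter_upwards [h.bound] with n hn
    rwa [Real.norm_eq_abs, Real.norm_eq_abs,
      abs_of_nonneg (pow_nonneg (Real.log_natCast_nonneg n) k)] at hn
  · rintro ⟨k, c, -, h⟩
    refine ⟨k, IsBigO.of_bound c ?_⟩
    filter_upwards [h] with n hn
    rwa [Real.norm_eq_abs, Real.norm_eq_abs,
      abs_of_nonneg (pow_nonneg (Real.log_natCast_nonneg n) k)]

variable {f g : ℕ → ℝ}

lemma IsPolylog.of_le (hg : IsPolylog g) (h : ∀ᶠ n : ℕ in atTop, |f n| ≤ |g n|) : IsPolylog f := by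
  obtain ⟨k, hk⟩ := hg
  exact ⟨k, (IsBigO.of_bound' h).trans hk⟩

lemma isPolylog_const (c : ℝ) : IsPolylog fun _ => c :=
  ⟨0, by simpa using isBigO_const_const c (one_ne_zero (α := ℝ)) (atTop : Filter ℕ)⟩

lemma isPolylog_log : IsPolylog fun n => Real.log n :=
  ⟨1, by simpa using isBigO_refl (fun n : ℕ => Real.log n) atTop⟩

lemma isPolylog_of_tendsto {l : ℝ} (h : Tendsto f atTop (𝓝 l)) : IsPolylog f :=
  ⟨0, by simpa using h.isBigO_one ℝ⟩

lemma IsPolylog.add (hf : IsPolylog f) (hg : IsPolylog g) : IsPolylog fun n => f n + g n := by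
  obtain ⟨k, c, hc, h⟩ := isPolylog_iff.mp hf
  obtain ⟨k', c', hc', h'⟩ := isPolylog_iff.mp hg
  refine isPolylog_iff.mpr ⟨k + k', c + c', by positivity, ?_⟩
  filter_upwards [h, h', eventually_one_le_log] with n hn hn' hlog
  have h1 : Real.log n ^ k ≤ Real.log n ^ (k + k') := pow_le_pow_right₀ hlog (by omega)
  have h2 : Real.log n ^ k' ≤ Real.log n ^ (k + k') := pow_le_pow_right₀ hlog (by omega)
  calc |f n + g n| ≤ |f n| + |g n| := abs_add_le _ _
    _ ≤ c * Real.log n ^ (k + k') + c' * Real.log n ^ (k + k') :=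
        add_le_add (hn.trans (by gcongr)) (hn'.trans (by gcongr))
    _ = _ := by ring

lemma IsPolylog.mul (hf : IsPolylog f) (hg : IsPolylog g) : IsPolylog fun n => f n * g n := by
  obtain ⟨k, hk⟩ := hf
  obtain ⟨k', hk'⟩ := hg
  exact ⟨k + k', by simpa only [pow_add] using hk.mul hk'⟩

lemma IsPolylog.const_mul (hf : IsPolylog f) (c : ℝ) : IsPolylog fun n => c * f n :=
  (isPolylog_const c).mul hf

lemma IsPolylog.div_const (hf : IsPolylog f) (c : ℝ) : IsPolylog fun n => f n / c := by
  simpa only [div_eq_mul_inv] using hf.mul (isPolylog_const c⁻¹)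

lemma IsPolylog.pow (hf : IsPolylog f) (k : ℕ) : IsPolylog fun n => f n ^ k := by
  induction k with
  | zero => simpa using isPolylog_const 1
  | succ k ih => simpa only [pow_succ] using ih.mul hf

lemma IsPolylog.abs (hf : IsPolylog f) : IsPolylog fun n => |f n| :=
  hf.of_le (Eventually.of_forall fun n => by rw [abs_abs])

lemma IsPolylog.sqrt (hf : IsPolylog f) : IsPolylog fun n => √(f n) := by
  refine ((isPolylog_const 1).add hf.abs).of_le (Eventually.of_forall fun n => ?_)
  rw [abs_of_nonneg (Real.sqrt_nonneg _), abs_of_nonneg (by positivity)]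
  refine Real.sqrt_le_iff.mpr ⟨by positivity, ?_⟩
  nlinarith [le_abs_self (f n), abs_nonneg (f n)]

lemma IsPolylog.rpow (hf : IsPolylog f) (h0 : ∀ n, 0 ≤ f n) {s : ℝ} (hs : 0 ≤ s) :
    IsPolylog fun n => f n ^ s := by
  refine ((isPolylog_const 1).add (hf.pow ⌈s⌉₊)).of_le (Eventually.of_forall fun n => ?_)
  rw [abs_of_nonneg (Real.rpow_nonneg (h0 n) s),
    abs_of_nonneg (by have := pow_nonneg (h0 n) ⌈s⌉₊; positivity)]
  exact rpow_le_one_add_pow (h0 n) hs (Nat.le_ceil s)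

lemma IsPolylog.tendsto_mul_rpow_neg (hf : IsPolylog f) {δ : ℝ} (hδ : 0 < δ) :
    Tendsto (fun n : ℕ => f n * (n : ℝ) ^ (-δ)) atTop (𝓝 0) := by
  obtain ⟨k, hk⟩ := hf
  have h1 : (fun n : ℕ => Real.log n ^ k) =o[atTop] fun n : ℕ => (n : ℝ) ^ δ := by
    have h2 := (isLittleO_log_rpow_rpow_atTop (s := δ) (k : ℝ) hδ).comp_tendsto
      (tendsto_natCast_atTop_atTop (R := ℝ))
    refine h2.congr (fun n => ?_) fun n => rfl
    simp [Real.rpow_natCast]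
  have h3 := (hk.trans_isLittleO h1).tendsto_div_nhds_zero
  refine h3.congr fun n => ?_
  rw [Real.rpow_neg (Nat.cast_nonneg n), div_eq_mul_inv]

lemma IsPolylog.growthBound {C s : ℝ} {Y Z : ℕ → ℝ} (hs : 0 < s) (hY : IsPolylog Y)
    (hZ : IsPolylog Z) (hY0 : ∀ n, 0 ≤ Y n) (hZ0 : ∀ n, 0 ≤ Z n) :
    IsPolylog fun n => growthBound C s (Y n) (Z n) := by
  unfold Unlearning.growthBound
  exact (((isPolylog_const 1).add (hY.rpow hY0 hs.le)).add (hZ.rpow hZ0 hs.le)).const_mul C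

/-! ### The constants of tame data sets are polylogarithmic -/

section Constants

variable {C s lam ν K : ℝ} {Y A Crr : ℕ → ℝ}

lemma isPolylog_fitBound (hs : 0 < s)
    (hY : IsPolylog Y) (hA : IsPolylog A) (hY0 : ∀ n, 0 ≤ Y n) (hA0 : ∀ n, 0 ≤ A n) :
    IsPolylog fun n => fitBound C s lam ν K (Y n) (A n) := by
  unfold fitBound
  exact (hA.add ((((hY.growthBound hs hA hY0 hA0).const_mul K).const_mul K).div_const _)).add
    (isPolylog_const 1)

lemma isPolylog_slopeBound (hC : 0 < C) (hs : 0 < s) (hlam : 0 < lam) (hν : 0 < ν) (hK : 1 ≤ K)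
    (hY : IsPolylog Y) (hA : IsPolylog A) (hY0 : ∀ n, 0 ≤ Y n) (hA0 : ∀ n, 0 ≤ A n) :
    IsPolylog fun n => slopeBound C s lam ν K (Y n) (A n) :=
  hY.growthBound hs (isPolylog_fitBound hs hY hA hY0 hA0) hY0 fun n =>
    zero_le_one.trans (le_fitBound hC hlam hν hK (hY0 n) (hA0 n)).2

lemma isPolylog_ratioBound (hC : 0 < C) (hs : 0 < s) (hlam : 0 < lam) (hν : 0 < ν) (hK : 1 ≤ K)
    (hY : IsPolylog Y) (hA : IsPolylog A) (hCrr : IsPolylog Crr) (hY0 : ∀ n, 0 ≤ Y n)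
    (hA0 : ∀ n, 0 ≤ A n) : IsPolylog fun n => ratioBound C s lam ν K (Y n) (A n) (Crr n) := by
  have hR : IsPolylog fun n => rangeBound C s lam ν K (Y n) (A n) :=
    ((isPolylog_fitBound hs hY hA hY0 hA0).add
      ((((isPolylog_slopeBound hC hs hlam hν hK hY hA hY0 hA0).const_mul K).const_mul K).div_const
        _)).add (isPolylog_const K)
  exact (((hY.growthBound hs hR hY0 fun n =>
    (le_rangeBound hC hlam hν hK (hY0 n) (hA0 n)).2.2.2).const_mul _).add
      (hCrr.abs.const_mul lam)).div_const _

lemma isPolylog_chainFactor (hC : 0 < C) (hs : 0 < s) (hlam : 0 < lam) (hν : 0 < ν) (hK : 1 ≤ K)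
    (hY : IsPolylog Y) (hA : IsPolylog A) (hCrr : IsPolylog Crr) (hY0 : ∀ n, 0 ≤ Y n)
    (hA0 : ∀ n, 0 ≤ A n) : IsPolylog fun n => chainFactor C s lam ν K (Y n) (A n) (Crr n) := by
  have hB := isPolylog_slopeBound hC hs hlam hν hK hY hA hY0 hA0
  have hQ := isPolylog_ratioBound hC hs hlam hν hK hY hA hCrr hY0 hA0
  exact hB.add (((hQ.const_mul _).mul (hB.pow 2)).div_const _)

lemma isPolylog_newtonFactor (hC : 0 < C) (hs : 0 < s) (hlam : 0 < lam) (hν : 0 < ν) (hK : 1 ≤ K)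
    (hY : IsPolylog Y) (hA : IsPolylog A) (hCrr : IsPolylog Crr) (hY0 : ∀ n, 0 ≤ Y n)
    (hA0 : ∀ n, 0 ≤ A n) : IsPolylog fun n => newtonFactor C s lam ν K (Y n) (A n) (Crr n) := by
  have hB := isPolylog_slopeBound hC hs hlam hν hK hY hA hY0 hA0
  have hQ := isPolylog_ratioBound hC hs hlam hν hK hY hA hCrr hY0 hA0
  exact ((hQ.const_mul K).add (isPolylog_const 1)).mul ((hQ.mul (((hB.pow 2).const_mul K).div_const
    _)).mul ((hQ.const_mul (1 + K)).add (isPolylog_const 1)))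

end Constants

end Polylog

/-! ### The perturbation scale -/

section NoiseScale

variable {C₁ C₂ lam ν : ℝ} {m n : ℕ}

lemma noiseScale_one : noiseScale C₁ C₂ lam ν m n 1 =
    C₁ * √(C₂ * (m : ℝ) ^ 3 / (2 * lam * ν * n)) := by
  rw [noiseScale, Real.sqrt_eq_rpow]
  norm_num

/-- One more step doubles both exponents, so the scale obeys the same squaring recursion as Newton's
error. -/
lemma noiseScale_succ (hC₂ : 0 ≤ C₂) (hlam : 0 < lam) (hν : 0 < ν) (t : ℕ) :
    noiseScale C₁ C₂ lam ν m n (t + 1) = noiseScale C₁ C₂ lam ν m n 1 ^ 2 ^ t := by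
  have hb : 0 ≤ C₂ * (m : ℝ) ^ 3 / (2 * lam * ν * n) := by positivity
  rw [noiseScale_one, mul_pow, noiseScale]
  generalize C₂ * (m : ℝ) ^ 3 / (2 * lam * ν * n) = b at hb
  rw [Real.sqrt_eq_rpow, ← Real.rpow_natCast C₁, ← Real.rpow_natCast (b ^ (1 / 2 : ℝ)),
    ← Real.rpow_mul hb]
  push_cast
  congr 2
  · rw [add_sub_cancel_right, Real.rpow_natCast]
  · rw [show (t : ℝ) + 1 - 2 = t - 1 by ring, Real.rpow_sub_one two_ne_zero, Real.rpow_natCast]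
    ring

end NoiseScale

/-! ### The proportional asymptotic regime -/

section Regime

variable {p : ℕ → ℕ} {γ₀ : ℝ}

lemma eventually_proportional (hγ₀ : 0 < γ₀)
    (hPHAS : Tendsto (fun n : ℕ => (n : ℝ) / p n) atTop (𝓝 γ₀)) :
    ∀ᶠ n : ℕ in atTop, 0 < p n ∧ (n : ℝ) / p n ≤ γ₀ + 1 ∧ (p n : ℝ) ≤ 2 / γ₀ * n := by
  filter_upwards [hPHAS.eventually_lt_const (lt_add_one γ₀),
    hPHAS.eventually_const_lt (half_lt_self hγ₀)] with n h1 h2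
  -- For `p n = 0` the quotient is `0` by convention, which is excluded by its being above `γ₀ / 2`.
  have hp : 0 < p n := by
    rcases Nat.eq_zero_or_pos (p n) with h | h
    · rw [h, Nat.cast_zero, div_zero] at h2
      linarith
    · exact h
  have hp' : (0 : ℝ) < p n := Nat.cast_pos.mpr hp
  refine ⟨hp, h1.le, ?_⟩
  rw [lt_div_iff₀ hp'] at h2
  rw [div_mul_eq_mul_div, le_div_iff₀ hγ₀]
  linarith

lemma tendsto_dimension (hγ₀ : 0 < γ₀)
    (hPHAS : Tendsto (fun n : ℕ => (n : ℝ) / p n) atTop (𝓝 γ₀)) :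
    Tendsto (fun n => (p n : ℝ)) atTop atTop := by
  have h1 : Tendsto (fun n : ℕ => (n : ℝ) / (γ₀ + 1)) atTop atTop :=
    tendsto_natCast_atTop_atTop.atTop_div_const (by positivity)
  refine tendsto_atTop_mono' _ ?_ h1
  filter_upwards [eventually_proportional hγ₀ hPHAS] with n ⟨hp, h, _⟩
  have hp' : (0 : ℝ) < p n := Nat.cast_pos.mpr hp
  rw [div_le_iff₀ hp'] at h
  rw [div_le_iff₀ (by positivity)]
  linarith

/-- The bound on the squared size of the predictions of an estimator at a fresh observation. -/
def energyBound (C s lam ν CX Y : ℝ) (n p : ℕ) : ℝ :=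
  CX / p * (2 / (lam * ν) * (n * growthBound C s Y 0))

variable {C s lam ν CX a : ℝ} {Y : ℕ → ℝ}

lemma energyBound_nonneg {Y : ℝ} (hC : 0 < C) (hlam : 0 < lam) (hν : 0 < ν) (hCX : 0 < CX)
    (hY : 0 ≤ Y) (n p : ℕ) : 0 ≤ energyBound C s lam ν CX Y n p := by
  have := growthBound_nonneg (s := s) hC hY (le_refl (0 : ℝ))
  unfold energyBound
  positivity

lemma isPolylog_energyBound (hs : 0 < s)
    (hPHAS : Tendsto (fun n : ℕ => (n : ℝ) / p n) atTop (𝓝 γ₀)) (hY : IsPolylog Y)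
    (hY0 : ∀ n, 0 ≤ Y n) : IsPolylog fun n => energyBound C s lam ν CX (Y n) n (p n) := by
  have h := ((isPolylog_of_tendsto hPHAS).mul
    (hY.growthBound (C := C) hs (isPolylog_const 0) hY0 fun _ => le_rfl)).const_mul
      (CX * (2 / (lam * ν)))
  refine h.of_le (Eventually.of_forall fun n => le_of_eq ?_)
  congr 1
  rw [energyBound]
  ring

lemma isPolylog_leaveOneOutBound (hs : 0 < s)
    (hPHAS : Tendsto (fun n : ℕ => (n : ℝ) / p n) atTop (𝓝 γ₀)) (hY : IsPolylog Y)
    (hY0 : ∀ n, 0 ≤ Y n) :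
    IsPolylog fun n => leaveOneOutBound C s lam ν CX a (Y n) n (p n) := by
  have h := (((isPolylog_energyBound (C := C) (lam := lam) (ν := ν) (CX := CX) hs hPHAS hY
    hY0).mul isPolylog_log).const_mul (8 * a)).sqrt
  refine h.of_le (Eventually.of_forall fun n => le_of_eq ?_)
  rw [leaveOneOutBound, energyBound]
  congr 2
  ring

/-- The influence is of order `√(log n / p)`, and `n / p` converges. -/
lemma isPolylog_influenceBound (hPHAS : Tendsto (fun n : ℕ => (n : ℝ) / p n) atTop (𝓝 γ₀))
    (T : ℝ) : IsPolylog fun n => influenceBound lam ν CX T a n (p n) * √n := by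
  have h := ((((isPolylog_of_tendsto hPHAS).mul isPolylog_log).const_mul (4 * CX * a)).sqrt).mul
    (isPolylog_const (designBound CX T / (lam * ν)))
  refine h.of_le (Eventually.of_forall fun n => le_of_eq ?_)
  congr 1
  rw [influenceBound, mul_right_comm, ← Real.sqrt_mul' _ (Nat.cast_nonneg n)]
  congr 2
  ring

/-- A polylogarithmic sequence times the square root of a polynomially small sequence vanishes. -/
lemma IsPolylog.tendsto_mul_sqrt {f g : ℕ → ℝ} (hf : IsPolylog f) {δ : ℝ} (hδ : 0 < δ)
    (hg : ∀ᶠ n : ℕ in atTop, g n ≤ (n : ℝ) ^ (-δ)) :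
    Tendsto (fun n => f n * √(g n)) atTop (𝓝 0) := by
  refine squeeze_zero_norm' ?_ (hf.abs.tendsto_mul_rpow_neg (half_pos hδ))
  filter_upwards [hg] with n hn
  rw [Real.norm_eq_abs, abs_mul, abs_of_nonneg (Real.sqrt_nonneg _)]
  refine mul_le_mul_of_nonneg_left ?_ (abs_nonneg _)
  refine Real.sqrt_le_iff.mpr ⟨Real.rpow_nonneg (Nat.cast_nonneg n) _, hn.trans_eq ?_⟩
  rw [← Real.rpow_natCast, ← Real.rpow_mul (Nat.cast_nonneg n)]
  congr 1
  push_cast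
  ring

end Regime

/-! ### Typical data sets -/

section Typical

/-- Data sets on which the fitted values are stable under the removal of few observations. -/
def IsTypical {n p : ℕ} (ℓ : ℝ → ℝ → ℝ) (r : Fin p → ℝ → ℝ) (C s lam ν CX T a Y : ℝ)
    (D : Dataset n p) : Prop :=
  IsTame ℓ r lam (designBound CX T) Y (leaveOneOutBound C s lam ν CX a Y n p)
    (influenceBound lam ν CX T a n p) D

lemma DataAssumptions.tail_nonneg {p : ℕ} {P : Measure (Obs p)} {CX s Cy q Cys : ℝ}
    (hP : DataAssumptions P CX s Cy q Cys) : 0 ≤ q :=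
  measureReal_nonneg.trans hP.tail

lemma DataAssumptions.isProbabilityMeasure_datasetLaw {p : ℕ} {P : Measure (Obs p)}
    {CX s Cy q Cys : ℝ} (hP : DataAssumptions P CX s Cy q Cys) (n : ℕ) :
    IsProbabilityMeasure (datasetLaw n P) := by
  have := hP.isProbability
  unfold datasetLaw
  infer_instance

/-- The probability that a data set is allowed not to be typical. -/
def failureBound (n p : ℕ) (q c : ℝ) : ℝ :=
  ((n : ℝ) + 1) * q + 14 * (n : ℝ) ^ (1 - c) + n * Real.exp (-(p : ℝ) / 2)
    + 2 * Real.exp (-(p : ℝ)) + Real.exp (-(1 - Real.log 2) * p)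

lemma failureBound_nonneg {n p : ℕ} {q : ℝ} (hq : 0 ≤ q) (c : ℝ) : 0 ≤ failureBound n p q c := by
  have := Real.rpow_nonneg (Nat.cast_nonneg (α := ℝ) n) (1 - c)
  unfold failureBound
  positivity

variable {p : ℕ → ℕ} {γ₀ C s lam ν CX Cys : ℝ} {ℓ : ℝ → ℝ → ℝ} {r : ∀ n, Fin (p n) → ℝ → ℝ}
  {P : ∀ n, Measure (Obs (p n))} {Cy q Crr : ℕ → ℝ}

lemma eventually_failure_le (hγ₀ : 0 < γ₀)
    (hPHAS : Tendsto (fun n : ℕ => (n : ℝ) / p n) atTop (𝓝 γ₀)) (c : ℝ) :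
    ∀ᶠ n : ℕ in atTop, 3 * (2 * (n : ℝ) + p n) * Real.exp (-((2 + |c|) * Real.log n)) ≤
      14 * (n : ℝ) ^ (1 - c) := by
  filter_upwards [eventually_proportional hγ₀ hPHAS, eventually_ge_atTop 1,
    tendsto_natCast_atTop_atTop.eventually_ge_atTop (3 * (2 + 2 / γ₀))] with n ⟨_, _, hp⟩ hn hlarge
  have hn1 : (1 : ℝ) ≤ n := by exact_mod_cast hn
  have hn0 : (0 : ℝ) < n := by linarith
  have h1 : Real.exp (-((2 + |c|) * Real.log n)) = (n : ℝ) ^ (-(2 + |c|)) := by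
    rw [Real.rpow_def_of_pos hn0]
    congr 1
    ring
  -- The exponent `a = 2 + |c|` is splittable off from `1 - c` with a nonnegative remainder `3 + |c|
  -- - c`, so the target keeps two powers of `n` to spare over the linear number of forms.
  have h2 : (n : ℝ) ^ (1 - c) = (n : ℝ) * n * (n : ℝ) ^ (|c| - c) * n *
      (n : ℝ) ^ (-(2 + |c|)) := by
    rw [show (1 : ℝ) - c = 1 + 1 + (|c| - c) + 1 + -(2 + |c|) by ring, Real.rpow_add hn0,
      Real.rpow_add hn0, Real.rpow_add hn0, Real.rpow_add hn0, Real.rpow_one]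
  have h3 : 1 ≤ (n : ℝ) ^ (|c| - c) :=
    Real.one_le_rpow hn1 (sub_nonneg.mpr (le_abs_self c))
  have h4 : 0 < (n : ℝ) ^ (-(2 + |c|)) := Real.rpow_pos_of_pos hn0 _
  rw [h1, h2, ← mul_assoc]
  refine mul_le_mul_of_nonneg_right ?_ h4.le
  calc 3 * (2 * (n : ℝ) + p n) ≤ 3 * (2 * n + 2 / γ₀ * n) := by gcongr
    _ = 3 * (2 + 2 / γ₀) * n := by ring
    _ ≤ n * n := by gcongr
    _ = 1 * (n * 1 * 1 * n) := by ring
    _ ≤ 14 * (n * n * (n : ℝ) ^ (|c| - c) * n) := by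
      gcongr
      norm_num

/-- The probability bound is claimed for every `n`, the typicality only for large `n`; outside the
regime of the concentration estimates the whole space is taken. -/
lemma exists_typical_sets (hγ₀ : 0 < γ₀)
    (hPHAS : Tendsto (fun n : ℕ => (n : ℝ) / p n) atTop (𝓝 γ₀)) (hℓ : LossAssumptions ℓ C s)
    (hlam : 0 < lam) (hν : 0 < ν) (hr : ∀ n, RegularizerAssumptions (r n) ν (Crr n))
    (hCX : 0 < CX) (hP : ∀ n, DataAssumptions (P n) CX s (Cy n) (q n) Cys) (c : ℝ) :
    ∃ 𝒳 : ∀ n, Set (Dataset n (p n)), (∀ n, MeasurableSet (𝒳 n)) ∧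
      (∀ n, 1 - failureBound n (p n) (q n) c ≤ (datasetLaw n (P n)).real (𝒳 n)) ∧
      ∀ᶠ n in atTop, ∀ D ∈ 𝒳 n,
        IsTypical ℓ (r n) C s lam ν CX (γ₀ + 6) (2 + |c|) |Cy n| D := by
  have key : ∀ n, ∃ X : Set (Dataset n (p n)), MeasurableSet X ∧
      1 - failureBound n (p n) (q n) c ≤ (datasetLaw n (P n)).real X ∧
      (0 < p n ∧ 3 ≤ n ∧ (n : ℝ) / p n ≤ γ₀ + 1 ∧
        3 * (2 * (n : ℝ) + p n) * Real.exp (-((2 + |c|) * Real.log n)) ≤ 14 * (n : ℝ) ^ (1 - c) →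
        ∀ D ∈ X, IsTypical ℓ (r n) C s lam ν CX (γ₀ + 6) (2 + |c|) |Cy n| D) := by
    intro n
    have := (hP n).isProbabilityMeasure_datasetLaw n
    have hq := (hP n).tail_nonneg
    by_cases h : 0 < p n ∧ 3 ≤ n ∧ (n : ℝ) / p n ≤ γ₀ + 1 ∧
        3 * (2 * (n : ℝ) + p n) * Real.exp (-((2 + |c|) * Real.log n)) ≤ 14 * (n : ℝ) ^ (1 - c)
    · obtain ⟨hp, hn, hT, hexp⟩ := h
      have hle := measure_not_isTame_le (hP n) hℓ (hr n) hlam hν hCX hp hn (T := γ₀ + 6)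
        (by linarith) (a := 2 + |c|) (by linarith [abs_nonneg c])
      set B : Set (Dataset n (p n)) :=
        {D | ¬ IsTypical ℓ (r n) C s lam ν CX (γ₀ + 6) (2 + |c|) |Cy n| D}
      -- The complement of a measurable hull of the exceptional set is measurable and has the right
      -- probability, without any measurability of `IsTypical`.
      refine ⟨(toMeasurable (datasetLaw n (P n)) B)ᶜ, (measurableSet_toMeasurable _ _).compl, ?_,
        fun _ D hD => ?_⟩
      · rw [probReal_compl_eq_one_sub (measurableSet_toMeasurable _ _)]
        refine sub_le_sub_left ?_ 1
        refine ENNReal.toReal_le_of_le_ofReal (failureBound_nonneg hq c) ?_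
        rw [measure_toMeasurable]
        refine hle.trans ?_
        rw [← ENNReal.ofReal_add (by positivity) (by positivity),
          ← ENNReal.ofReal_add (by positivity) (by positivity)]
        refine ENNReal.ofReal_le_ofReal ?_
        have h1 : 0 ≤ (n : ℝ) * Real.exp (-(p n : ℝ) / 2) := by positivity
        have h2 := Real.exp_pos (-(p n : ℝ))
        have h3 := Real.exp_pos (-(1 - Real.log 2) * p n)
        unfold failureBound
        linarith
      · by_contra hD'
        exact hD (subset_toMeasurable _ _ hD')
    · refine ⟨Set.univ, MeasurableSet.univ, ?_, fun h' => absurd h' h⟩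
      rw [probReal_univ]
      linarith [failureBound_nonneg (n := n) (p := p n) hq c]
  choose 𝒳 hmeas hprob htyp using key
  refine ⟨𝒳, hmeas, hprob, ?_⟩
  filter_upwards [eventually_proportional hγ₀ hPHAS, eventually_ge_atTop 3,
    eventually_failure_le hγ₀ hPHAS c] with n ⟨h1, h2, _⟩ h3 h4
  exact htyp n ⟨h1, h3, h2, h4⟩

lemma tendsto_failureBound (hγ₀ : 0 < γ₀)
    (hPHAS : Tendsto (fun n : ℕ => (n : ℝ) / p n) atTop (𝓝 γ₀))
    (hq : q =o[atTop] fun n : ℕ => (n : ℝ)⁻¹) {c : ℝ} (hc : 1 < c) :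
    Tendsto (fun n => failureBound n (p n) (q n) c) atTop (𝓝 0) := by
  have hp := tendsto_dimension hγ₀ hPHAS
  have h1 : Tendsto (fun n : ℕ => ((n : ℝ) + 1) * q n) atTop (𝓝 0) := by
    have hnq : Tendsto (fun n : ℕ => q n / (n : ℝ)⁻¹) atTop (𝓝 0) := hq.tendsto_div_nhds_zero
    have hq0 : Tendsto q atTop (𝓝 0) := hq.trans_tendsto tendsto_inv_atTop_nhds_zero_nat
    simpa [div_inv_eq_mul, mul_comm, add_mul, mul_add] using hnq.add hq0
  have h2 : Tendsto (fun n : ℕ => 14 * (n : ℝ) ^ (1 - c)) atTop (𝓝 0) := by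
    have := ((tendsto_rpow_neg_atTop (sub_pos.mpr hc)).comp
      tendsto_natCast_atTop_atTop).const_mul 14
    simpa [Function.comp_def] using this
  have h3 : Tendsto (fun n : ℕ => (n : ℝ) * Real.exp (-(p n : ℝ) / 2)) atTop (𝓝 0) := by
    have h := ((Real.tendsto_pow_mul_exp_neg_atTop_nhds_zero 1).comp
      (hp.atTop_div_const two_pos)).const_mul 2
    have h' := hPHAS.mul h
    rw [mul_zero, mul_zero] at h'
    refine h'.congr' ?_
    filter_upwards [eventually_proportional hγ₀ hPHAS] with n ⟨hn, _⟩
    have : (p n : ℝ) ≠ 0 := by exact_mod_cast hn.ne'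
    simp only [Function.comp_apply, pow_one, neg_div]
    field_simp
  have h4 : Tendsto (fun n : ℕ => 2 * Real.exp (-(p n : ℝ))) atTop (𝓝 0) := by
    simpa [Function.comp_def] using (Real.tendsto_exp_neg_atTop_nhds_zero.comp hp).const_mul 2
  have h5 : Tendsto (fun n : ℕ => Real.exp (-(1 - Real.log 2) * p n)) atTop (𝓝 0) := by
    have hlog : 0 < 1 - Real.log 2 := by linarith [Real.log_two_lt_d9]
    have := Real.tendsto_exp_neg_atTop_nhds_zero.comp (hp.const_mul_atTop hlog)
    exact this.congr fun n => by rw [Function.comp_apply, neg_mul]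
  simpa [failureBound] using (((h1.add h2).add h3).add h4).add h5

/-- For large `n` the exceptional event lies in the complement of `𝒳 n`, so monotonicity of the
measure suffices and the event need not be measurable. -/
lemma VanishesOn.vanishesInProbability {m : ℕ → ℕ} {𝒳 : ∀ n, Set (Dataset n (p n))}
    {G : ∀ n, Dataset n (p n) → Finset (Fin n) → ℝ≥0∞} (hG : VanishesOn m 𝒳 G)
    (hγ₀ : 0 < γ₀) (hPHAS : Tendsto (fun n : ℕ => (n : ℝ) / p n) atTop (𝓝 γ₀))
    (hq : q =o[atTop] fun n : ℕ => (n : ℝ)⁻¹)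
    (hP : ∀ n, DataAssumptions (P n) CX s (Cy n) (q n) Cys) {c : ℝ} (hc : 1 < c)
    (hmeas : ∀ n, MeasurableSet (𝒳 n))
    (hprob : ∀ n, 1 - failureBound n (p n) (q n) c ≤ (datasetLaw n (P n)).real (𝒳 n)) :
    VanishesInProbability m P G := by
  intro η hη
  have h0 := ENNReal.tendsto_ofReal (tendsto_failureBound hγ₀ hPHAS hq hc)
  rw [ENNReal.ofReal_zero] at h0
  refine tendsto_of_tendsto_of_tendsto_of_le_of_le' tendsto_const_nhds h0
    (Eventually.of_forall fun n => zero_le) ?_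
  filter_upwards [hG η hη] with n hn
  have := (hP n).isProbabilityMeasure_datasetLaw n
  refine (measure_mono (t := (𝒳 n)ᶜ) ?_).trans ?_
  · rintro D ⟨M, hM, hlt⟩ hD
    exact absurd (hn D hD M hM) (not_le.mpr hlt)
  · refine (ENNReal.le_ofReal_iff_toReal_le (measure_ne_top _ _)
      (failureBound_nonneg (hP n).tail_nonneg c)).mpr ?_
    have h := probReal_compl_eq_one_sub (μ := datasetLaw n (P n)) (hmeas n)
    rw [measureReal_def] at h
    rw [h]
    linarith [hprob n]

end Typical

/-! ### The divergence on typical data sets -/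

section Divergence

variable {C CX Cys : ℝ} {k : ℕ}

lemma perturbationConst_nonneg (hCX : 0 ≤ CX) (k : ℕ) : 0 ≤ perturbationConst CX k := by
  unfold perturbationConst
  positivity

lemma divergenceFactor_mono (hC : 0 ≤ C) (hCX : 0 ≤ CX) (F : ℝ) {ρ ρ' : ℝ} (hρ : 0 ≤ ρ)
    (h : ρ ≤ ρ') : divergenceFactor C CX Cys k F ρ ≤ divergenceFactor C CX Cys k F ρ' := by
  have := perturbationConst_nonneg hCX k
  unfold divergenceFactor
  gcongr

lemma divergenceFactor_nonneg (hC : 0 ≤ C) (hCX : 0 ≤ CX) {F ρ : ℝ} (hF : 0 ≤ F) (hρ : 0 ≤ ρ) :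
    0 ≤ divergenceFactor C CX Cys k F ρ := by
  have := perturbationConst_nonneg hCX k
  have := perturbationConst_nonneg hCX 1
  unfold divergenceFactor
  positivity

lemma isPolylog_divergenceFactor {F ρ : ℕ → ℝ} (hF : IsPolylog F) (hρ : IsPolylog ρ) :
    IsPolylog fun n => divergenceFactor C CX Cys k (F n) (ρ n) := by
  have h1 := (((hF.const_mul 4).pow k).const_mul (√2 * k.factorial)).const_mul (4 ^ k)
  have h2 := ((hρ.pow (2 * k)).const_mul (perturbationConst CX k)).const_mul (4 ^ k)
  exact (((((isPolylog_const (4 + |Cys|)).add h1).add h2).const_mul 4).add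
    (isPolylog_const (perturbationConst CX 1))).const_mul (C / 2)

/-- The size of the perturbation of a linear predictor by noise of scale `e / ε`, together with
an error of size `e` of the estimator. -/
def perturbationSize (p : ℕ) (ε e : ℝ) : ℝ := (2 * √(p : ℝ) / ε + 1 / √(p : ℝ)) * e

lemma gedRate_eq (p m : ℕ) (ε s e : ℝ) :
    gedRate p m ε s e = perturbationSize p ε e * √(2 * m + 2 * s) := rfl

lemma perturbationSize_mono {p : ℕ} {ε e e' : ℝ} (hε : 0 < ε) (h : e ≤ e') :
    perturbationSize p ε e ≤ perturbationSize p ε e' := by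
  unfold perturbationSize
  gcongr

lemma perturbationSize_nonneg {p : ℕ} {ε e : ℝ} (hε : 0 < ε) (he : 0 ≤ e) :
    0 ≤ perturbationSize p ε e := by
  unfold perturbationSize
  positivity

lemma perturbationSize_le_gedRate {p m : ℕ} {ε s e : ℝ} (hε : 0 < ε) (he : 0 ≤ e) (hs : 0 < s)
    (hm : 1 ≤ m) : perturbationSize p ε e ≤ gedRate p m ε s e := by
  have hm' : (1 : ℝ) ≤ m := by exact_mod_cast hm
  rw [gedRate_eq]
  refine le_mul_of_one_le_right (perturbationSize_nonneg hε he) (Real.one_le_sqrt.mpr ?_)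
  linarith

variable {n p : ℕ} {ℓ : ℝ → ℝ → ℝ} {r : Fin p → ℝ → ℝ} {s lam ν Cy q Crr Y ε e : ℝ}
  {P : Measure (Obs p)} {D : Dataset n p}

/-- With rate `κ = ε / e`, the value `ρ = perturbationSize p ε e` satisfies `√p * ρ = 2 p e / ε +
e`, which dominates both the noise scale `p / κ` and the error `e` of the estimator. -/
lemma ged_le_of_norm_sub_le (hP : DataAssumptions P CX s Cy q Cys) (hℓ : LossAssumptions ℓ C s)
    (hr : RegularizerAssumptions r ν Crr) (hlam : 0 < lam) (hν : 0 < ν) (hCX : 0 < CX)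
    (hp : 0 < p) (he : 0 < e) (hε : 0 < ε) (hk : s ≤ k) (hY : 0 ≤ Y) (hy : ∀ i, |(D i).1| ≤ Y)
    {t : ℕ} {M : Finset (Fin n)}
    (hle : ‖newtonEstimator ℓ r lam D M t - estimator ℓ r lam D M‖ ≤ e) :
    ged ℓ r lam P (ε / e) t D M ≤ ENNReal.ofReal (perturbationSize p ε e *
      divergenceFactor C CX Cys k (energyBound C s lam ν CX Y n p) (perturbationSize p ε e)) := by
  have hp' : (0 : ℝ) < p := Nat.cast_pos.mpr hp
  have hsp : 0 < √(p : ℝ) := Real.sqrt_pos.mpr hp'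
  have hmul : √(p : ℝ) * perturbationSize p ε e = 2 * (p * e / ε) + e := by
    have := Real.sq_sqrt hp'.le
    rw [perturbationSize]
    field_simp
    rw [this]
    ring
  have hpe : 0 < p * e / ε := by positivity
  refine lintegral_abs_loss_sub_le hP hℓ hCX hp (div_pos hε he) ?_ ?_ ?_ ?_ hk
  · unfold perturbationSize
    positivity
  · rw [hmul]
    linarith
  · rw [hmul, div_div_eq_mul_div]
    linarith
  · rw [energyBound]
    refine mul_le_mul_of_nonneg_left ?_ (by positivity)
    have h := sq_norm_estimator_le hℓ hr hlam hν hY hy M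
    rw [div_mul_eq_mul_div, le_div_iff₀ (by positivity)]
    linarith

end Divergence

/-! ### The perturbation scale as a power of a polylogarithmic factor times `√(m³ / n)` -/

section Gain

/-- The polylogarithmic part of the perturbation scale. -/
def scaleGain (C₁ C₂ lam ν : ℝ) : ℝ := C₁ * √(C₂ / (2 * lam * ν))

lemma scaleGain_nonneg {C₁ C₂ lam ν : ℝ} (h₁ : 0 ≤ C₁) : 0 ≤ scaleGain C₁ C₂ lam ν :=
  mul_nonneg h₁ (Real.sqrt_nonneg _)

lemma isPolylog_scaleGain {C₁ C₂ : ℕ → ℝ} {lam ν : ℝ} (h₁ : IsPolylog C₁) (h₂ : IsPolylog C₂) :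
    IsPolylog fun n => scaleGain (C₁ n) (C₂ n) lam ν :=
  h₁.mul (h₂.div_const _).sqrt

variable {C₁ C₂ lam ν : ℝ} {m n : ℕ}

lemma noiseScale_succ_eq (hC₂ : 0 ≤ C₂) (hlam : 0 < lam) (hν : 0 < ν) (t : ℕ) :
    noiseScale C₁ C₂ lam ν m n (t + 1) =
      (scaleGain C₁ C₂ lam ν * √((m : ℝ) ^ 3 / n)) ^ 2 ^ t := by
  rw [noiseScale_succ hC₂ hlam hν, noiseScale_one, scaleGain, mul_div_mul_comm,
    Real.sqrt_mul (by positivity), mul_assoc C₁]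

lemma le_scaleGain (hlam : 0 < lam) (hν : 0 < ν) (h₁ : 0 ≤ C₁) (h₂ : 2 * lam * ν ≤ C₂) :
    C₁ ≤ scaleGain C₁ C₂ lam ν :=
  le_mul_of_one_le_right h₁ (Real.one_le_sqrt.mpr ((one_le_div (by positivity)).mpr h₂))

lemma mul_sqrt_eq_mul_sqrt_div (hn : 0 < n) :
    (m : ℝ) * √m = √(n : ℝ) * √((m : ℝ) ^ 3 / n) := by
  have hn' : (0 : ℝ) < n := Nat.cast_pos.mpr hn
  rw [← Real.sqrt_mul hn'.le, mul_div_cancel₀ _ hn'.ne', pow_succ, Real.sqrt_mul (by positivity),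
    Real.sqrt_sq (by positivity)]

end Gain

/-! ### Thresholds for the perturbation scale and the divergence in terms of it -/

section Rates

variable {p m : ℕ → ℕ} {γ₀ C s lam ν CX Cys ε a T δ : ℝ} {ℓ : ℝ → ℝ → ℝ}
  {r : ∀ n, Fin (p n) → ℝ → ℝ} {P : ∀ n, Measure (Obs (p n))} {Cy q Crr C₁ C₂ : ℕ → ℝ}

/-- The first threshold for the perturbation scale. -/
def scaleThreshold (C s lam ν CX T a : ℝ) (Y Crr : ℕ → ℝ) (p : ℕ → ℕ) (n : ℕ) : ℝ :=
  newtonFactor C s lam ν (designBound CX T) (Y n)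
      (leaveOneOutBound C s lam ν CX a (Y n) n (p n)) (Crr n) *
    (√2 * (influenceBound lam ν CX T a n (p n) * √n)) + 1

lemma one_le_designBound (CX T : ℝ) : 1 ≤ designBound CX T := le_max_left _ _

lemma leaveOneOutBound_nonneg (Y : ℝ) (n p : ℕ) : 0 ≤ leaveOneOutBound C s lam ν CX a Y n p :=
  Real.sqrt_nonneg _

lemma influenceBound_nonneg (hlam : 0 < lam) (hν : 0 < ν) (n p : ℕ) :
    0 ≤ influenceBound lam ν CX T a n p := by
  have := one_le_designBound CX T
  unfold influenceBound
  positivity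

lemma isPolylog_scaleThreshold (hC : 0 < C) (hs : 0 < s) (hlam : 0 < lam) (hν : 0 < ν)
    (hPHAS : Tendsto (fun n : ℕ => (n : ℝ) / p n) atTop (𝓝 γ₀)) {Y : ℕ → ℝ} (hY : IsPolylog Y)
    (hY0 : ∀ n, 0 ≤ Y n) (hCrr : IsPolylog Crr) :
    IsPolylog (scaleThreshold C s lam ν CX T a Y Crr p) :=
  ((isPolylog_newtonFactor hC hs hlam hν (one_le_designBound CX T) hY
    (isPolylog_leaveOneOutBound hs hPHAS hY hY0) hCrr hY0
    fun n => leaveOneOutBound_nonneg (Y n) n (p n)).mul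
    ((isPolylog_influenceBound hPHAS T).const_mul √2)).add (isPolylog_const 1)

lemma one_le_scaleThreshold (hC : 0 < C) (hlam : 0 < lam) (hν : 0 < ν) {Y : ℕ → ℝ}
    (hY0 : ∀ n, 0 ≤ Y n) (n : ℕ) : 1 ≤ scaleThreshold C s lam ν CX T a Y Crr p n := by
  have h1 := newtonFactor_nonneg (s := s) (Crr := Crr n) hC hlam hν (one_le_designBound CX T)
    (hY0 n) (leaveOneOutBound_nonneg (C := C) (s := s) (lam := lam) (ν := ν) (CX := CX) (a := a)
      (Y n) n (p n))
  have h2 := influenceBound_nonneg (CX := CX) (T := T) (a := a) hlam hν n (p n)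
  have h3 : 0 ≤ √2 * (influenceBound lam ν CX T a n (p n) * √n) := by positivity
  unfold scaleThreshold
  linarith [mul_nonneg h1 h3]

/-- If `m ^ 3` is polynomially smaller than `n`, the divergence of the perturbed Newton estimator
on typical data sets is of the order of the size of the perturbation. -/
theorem eventually_ged_le (hγ₀ : 0 < γ₀)
    (hPHAS : Tendsto (fun n : ℕ => (n : ℝ) / p n) atTop (𝓝 γ₀)) (hm : ∀ n, 1 ≤ m n)
    (hℓ : LossAssumptions ℓ C s) (hlam : 0 < lam) (hν : 0 < ν) (hCrr : IsPolylog Crr)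
    (hr : ∀ n, RegularizerAssumptions (r n) ν (Crr n)) (hCX : 0 < CX) (hCy : IsPolylog Cy)
    (hP : ∀ n, DataAssumptions (P n) CX s (Cy n) (q n) Cys)
    (h₁ : IsPolylog C₁) (h₂ : IsPolylog C₂)
    (hge : ∀ᶠ n in atTop,
      scaleThreshold C s lam ν CX T a (fun n => |Cy n|) Crr p n ≤ C₁ n ∧ 2 * lam * ν ≤ C₂ n)
    (hε : 0 < ε) (hδ : 0 < δ)
    (hreg : ∀ᶠ n : ℕ in atTop, (m n : ℝ) ^ 3 / n ≤ (n : ℝ) ^ (-δ)) :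
    ∀ᶠ n in atTop, scaleGain (C₁ n) (C₂ n) lam ν * √((m n : ℝ) ^ 3 / n) ≤ 1 ∧
      ∀ D : Dataset n (p n), IsTypical ℓ (r n) C s lam ν CX T a |Cy n| D →
      ∀ M : Finset (Fin n), M.card ≤ m n → ∀ t : ℕ,
      ged ℓ (r n) lam (P n) (ε / noiseScale (C₁ n) (C₂ n) lam ν (m n) n (t + 1)) (t + 1) D M ≤
        ENNReal.ofReal
          (perturbationSize (p n) ε (noiseScale (C₁ n) (C₂ n) lam ν (m n) n (t + 1)) *
          divergenceFactor C CX Cys ⌈s⌉₊ (energyBound C s lam ν CX |Cy n| n (p n))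
            (perturbationSize (p n) ε (noiseScale (C₁ n) (C₂ n) lam ν (m n) n (t + 1)))) := by
  have hY0 : ∀ n, 0 ≤ |Cy n| := fun n => abs_nonneg _
  -- Since `θ * √n` is polylogarithmic, the smallness condition on the chain of removals reads
  -- polylog times `√(m³ / n)`, which tends to zero.
  have hchain := (((isPolylog_chainFactor hℓ.C_pos hℓ.s_pos hlam hν (one_le_designBound CX T)
    hCy.abs (isPolylog_leaveOneOutBound (C := C) (lam := lam) (ν := ν) (CX := CX) (a := a)
    hℓ.s_pos hPHAS hCy.abs hY0) hCrr hY0 fun n => leaveOneOutBound_nonneg |Cy n| n (p n)).mul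
    ((isPolylog_influenceBound (lam := lam) (ν := ν) (CX := CX) (a := a) hPHAS T).const_mul
      √2)).tendsto_mul_sqrt hδ hreg).eventually_le_const zero_lt_one
  have hgain := ((isPolylog_scaleGain (lam := lam) (ν := ν) h₁ h₂).tendsto_mul_sqrt hδ
    hreg).eventually_le_const zero_lt_one
  filter_upwards [hchain, hgain, hge, eventually_proportional hγ₀ hPHAS,
    eventually_gt_atTop 0] with n hchain hgain hge hp hn
  obtain ⟨hC₁, hC₂⟩ := hge
  refine ⟨hgain, fun D hD M hM t => ?_⟩
  have hn' : (0 : ℝ) < n := Nat.cast_pos.mpr hn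
  have hm' : (0 : ℝ) < m n := Nat.cast_pos.mpr (hm n)
  have hC₁1 : 1 ≤ C₁ n := (one_le_scaleThreshold hℓ.C_pos hlam hν hY0 n).trans hC₁
  have hC₁G := le_scaleGain hlam hν (zero_le_one.trans hC₁1) hC₂
  have hC₂0 : 0 ≤ C₂ n := le_trans (by positivity) hC₂
  have hx : 0 < √((m n : ℝ) ^ 3 / n) := by positivity
  have hθ := influenceBound_nonneg (CX := CX) (T := T) (a := a) hlam hν n (p n)
  have hA := leaveOneOutBound_nonneg (C := C) (s := s) (lam := lam) (ν := ν) (CX := CX) (a := a)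
    |Cy n| n (p n)
  have hF := newtonFactor_nonneg (s := s) (Crr := Crr n) hℓ.C_pos hlam hν
    (one_le_designBound CX T) (hY0 n) hA
  -- The first Newton error is at most the perturbation scale for one step: this is what
  -- `scaleThreshold` and the bound `2 * lam * ν ≤ C₂` are made for.
  have hrate : newtonFactor C s lam ν (designBound CX T) |Cy n|
      (leaveOneOutBound C s lam ν CX a |Cy n| n (p n)) (Crr n) *
      (√2 * influenceBound lam ν CX T a n (p n) * (m n * √(m n))) ≤
      scaleGain (C₁ n) (C₂ n) lam ν * √((m n : ℝ) ^ 3 / n) := by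
    rw [mul_sqrt_eq_mul_sqrt_div (m := m n) hn]
    calc _ = (scaleThreshold C s lam ν CX T a (fun n => |Cy n|) Crr p n - 1) *
          √((m n : ℝ) ^ 3 / n) := by rw [scaleThreshold]; ring
      _ ≤ _ := mul_le_mul_of_nonneg_right (by linarith) hx.le
  refine ged_le_of_norm_sub_le (hP n) hℓ (hr n) hlam hν hCX hp.1 ?_ hε (Nat.le_ceil s) (hY0 n)
    hD.response_le ?_
  · rw [noiseScale_succ_eq hC₂0 hlam hν]
    have : 0 < scaleGain (C₁ n) (C₂ n) lam ν := by linarith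
    positivity
  · rw [noiseScale_succ_eq hC₂0 hlam hν]
    refine (IsTame.norm_newtonEstimator_sub_le hD hℓ (hr n) hlam hν (one_le_designBound CX T)
      (hY0 n) hA hθ (hm n) ?_ (hrate.trans hgain) hM t).trans ?_
    · rw [mul_sqrt_eq_mul_sqrt_div (m := m n) hn]
      refine le_of_eq_of_le ?_ hchain
      ring
    · exact pow_le_pow_left₀ (by positivity) hrate _

end Rates

/-! ### The main estimates -/

section Rates

lemma sq_le_rpow_of_pow_le {x y : ℝ} {n N : ℕ} (hN : N ≠ 0) (hx : 0 ≤ x)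
    (h : x ^ N ≤ (n : ℝ) ^ (-y)) : x ^ 2 ≤ (n : ℝ) ^ (-(2 * y / N)) := by
  have hn' : (0 : ℝ) ≤ n := Nat.cast_nonneg n
  have hN' : (N : ℝ) ≠ 0 := Nat.cast_ne_zero.mpr hN
  have h1 : x ≤ (n : ℝ) ^ (-(y / N)) := by
    refine le_of_pow_le_pow_left₀ hN (Real.rpow_nonneg hn' _) (h.trans_eq ?_)
    rw [← Real.rpow_natCast, ← Real.rpow_mul hn']
    congr 1
    field_simp
  refine (pow_le_pow_left₀ hx h1 2).trans_eq ?_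
  rw [← Real.rpow_natCast, ← Real.rpow_mul hn']
  congr 1
  push_cast
  ring

variable {p m : ℕ → ℕ} {γ₀ s lam ν ε : ℝ} {C₁ C₂ : ℕ → ℝ}

/-- If the rate of some number of steps is polylogarithmic, then `m ^ 3` is polynomially smaller
than `n`. -/
lemma eventually_cube_div_le_of_isPolylog_gedRate (hγ₀ : 0 < γ₀)
    (hPHAS : Tendsto (fun n : ℕ => (n : ℝ) / p n) atTop (𝓝 γ₀)) (hm : ∀ n, 1 ≤ m n)
    (hs : 0 < s) (hlam : 0 < lam) (hν : 0 < ν)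
    (hge : ∀ᶠ n in atTop, 1 ≤ C₁ n ∧ 2 * lam * ν ≤ C₂ n) (hε : 0 < ε) {t : ℕ}
    (h : IsPolylog fun n =>
      gedRate (p n) (m n) ε s (noiseScale (C₁ n) (C₂ n) lam ν (m n) n (t + 1))) :
    ∀ᶠ n : ℕ in atTop, (m n : ℝ) ^ 3 / n ≤ (n : ℝ) ^ (-(2 * (1 / 4) / (2 ^ t : ℕ)) : ℝ) := by
  -- The constant converts the term `2 √p / ε` of the rate into at least `√n`. The exponent `1 / 4`
  -- is half of that of `√n`: a polylogarithmic bound for `√n * x` thus leaves `x ≤ n^(-1/4)`.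
  have hlim := ((h.const_mul (ε * √(γ₀ + 1) / 2)).tendsto_mul_rpow_neg (δ := 1 / 4)
    (by norm_num)).eventually_le_const zero_lt_one
  filter_upwards [hlim, hge, eventually_proportional hγ₀ hPHAS, eventually_gt_atTop 0]
    with n hlim hge hp hn
  obtain ⟨hC₁, hC₂⟩ := hge
  have hn' : (0 : ℝ) < n := Nat.cast_pos.mpr hn
  have hp' : (0 : ℝ) < p n := Nat.cast_pos.mpr hp.1
  have hx : 0 ≤ (m n : ℝ) ^ 3 / n := by positivity
  have hG : 1 ≤ scaleGain (C₁ n) (C₂ n) lam ν :=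
    hC₁.trans (le_scaleGain hlam hν (by linarith) hC₂)
  have hC₂0 : 0 ≤ C₂ n := le_trans (by positivity) hC₂
  set x := √((m n : ℝ) ^ 3 / n) with hxdef
  have hx0 : 0 ≤ x := Real.sqrt_nonneg _
  have hscale : x ^ 2 ^ t ≤ noiseScale (C₁ n) (C₂ n) lam ν (m n) n (t + 1) := by
    rw [noiseScale_succ_eq hC₂0 hlam hν]
    exact pow_le_pow_left₀ hx0 (le_mul_of_one_le_left hx0 hG) _
  have hx2 : 0 ≤ x ^ 2 ^ t := by positivity
  have hsq : √(n : ℝ) ≤ √(γ₀ + 1) * √(p n) := by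
    rw [← Real.sqrt_mul (by positivity)]
    exact Real.sqrt_le_sqrt ((div_le_iff₀ hp').mp hp.2.1)
  have hlower : √(n : ℝ) * x ^ 2 ^ t ≤ ε * √(γ₀ + 1) / 2 *
      gedRate (p n) (m n) ε s (noiseScale (C₁ n) (C₂ n) lam ν (m n) n (t + 1)) := by
    calc √(n : ℝ) * x ^ 2 ^ t ≤ √(γ₀ + 1) * √(p n) * x ^ 2 ^ t := by gcongr
      _ = ε * √(γ₀ + 1) / 2 * (2 * √(p n) / ε * x ^ 2 ^ t) := by field_simp
      _ ≤ ε * √(γ₀ + 1) / 2 * (perturbationSize (p n) ε (x ^ 2 ^ t)) := by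
        unfold perturbationSize
        gcongr
        exact le_add_of_nonneg_right (by positivity)
      _ ≤ ε * √(γ₀ + 1) / 2 * (perturbationSize (p n) ε
          (noiseScale (C₁ n) (C₂ n) lam ν (m n) n (t + 1))) := by
        gcongr
        exact perturbationSize_mono hε hscale
      _ ≤ _ := by
        gcongr
        exact perturbationSize_le_gedRate hε (hx2.trans hscale) hs (hm n)
  have hpow : x ^ 2 ^ t ≤ (n : ℝ) ^ (-(1 / 4) : ℝ) := by
    have hq : 0 < (n : ℝ) ^ (-(1 / 4) : ℝ) := Real.rpow_pos_of_pos hn' _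
    have h1 := (mul_le_mul_of_nonneg_right hlower hq.le).trans hlim
    have h2 : √(n : ℝ) * (n : ℝ) ^ (-(1 / 4) : ℝ) * (n : ℝ) ^ (-(1 / 4) : ℝ) = 1 := by
      rw [Real.sqrt_eq_rpow, ← Real.rpow_add hn', ← Real.rpow_add hn']
      norm_num
    calc x ^ 2 ^ t = (√(n : ℝ) * (n : ℝ) ^ (-(1 / 4) : ℝ) * (n : ℝ) ^ (-(1 / 4) : ℝ)) *
          x ^ 2 ^ t := by rw [h2, one_mul]
      _ = √(n : ℝ) * x ^ 2 ^ t * (n : ℝ) ^ (-(1 / 4) : ℝ) * (n : ℝ) ^ (-(1 / 4) : ℝ) := by ring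
      _ ≤ 1 * (n : ℝ) ^ (-(1 / 4) : ℝ) := by gcongr
      _ = _ := one_mul _
  have := sq_le_rpow_of_pow_le (pow_ne_zero t two_ne_zero) hx0 hpow
  rwa [hxdef, Real.sq_sqrt hx] at this

/-- The factor `√p` of the Laplace noise is of order `√n`, and the perturbation scale is `√(m³ / n)
^ 2 ^ t` up to a polylogarithmic factor, so the product is the quantity in the hypothesis. -/
lemma IsPolylog.perturbationSize_le {t : ℕ} {δ : ℝ} (hγ₀ : 0 < γ₀)
    (hPHAS : Tendsto (fun n : ℕ => (n : ℝ) / p n) atTop (𝓝 γ₀))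
    (hlam : 0 < lam) (hν : 0 < ν) (h₁ : IsPolylog C₁) (h₂ : IsPolylog C₂)
    (hge : ∀ᶠ n in atTop, 1 ≤ C₁ n ∧ 2 * lam * ν ≤ C₂ n) (hε : 0 < ε)
    (h : ∀ᶠ n : ℕ in atTop, √(n : ℝ) * √((m n : ℝ) ^ 3 / n) ^ 2 ^ t ≤ (n : ℝ) ^ (-δ)) :
    ∃ g : ℕ → ℝ, IsPolylog g ∧ ∀ᶠ n : ℕ in atTop,
      perturbationSize (p n) ε (noiseScale (C₁ n) (C₂ n) lam ν (m n) n (t + 1)) ≤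
        g n * (n : ℝ) ^ (-δ) := by
  refine ⟨fun n => (2 * √(2 / γ₀) / ε + 1) * scaleGain (C₁ n) (C₂ n) lam ν ^ 2 ^ t,
    ((isPolylog_scaleGain h₁ h₂).pow _).const_mul _, ?_⟩
  filter_upwards [h, hge, eventually_proportional hγ₀ hPHAS, eventually_gt_atTop 0]
    with n h hge hp hn
  obtain ⟨hC₁, hC₂⟩ := hge
  have hp1 : (1 : ℝ) ≤ p n := by exact_mod_cast hp.1
  have hn1 : (1 : ℝ) ≤ n := by exact_mod_cast hn
  have hG : 1 ≤ scaleGain (C₁ n) (C₂ n) lam ν :=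
    hC₁.trans (le_scaleGain hlam hν (by linarith) hC₂)
  have hC₂0 : 0 ≤ C₂ n := le_trans (by positivity) hC₂
  have hsq : √(p n : ℝ) ≤ √(2 / γ₀) * √n := by
    rw [← Real.sqrt_mul (by positivity)]
    exact Real.sqrt_le_sqrt hp.2.2
  have hsn : 1 ≤ √(n : ℝ) := Real.one_le_sqrt.mpr hn1
  have hsp : 1 / √(p n : ℝ) ≤ 1 := (div_le_one (by positivity)).mpr (Real.one_le_sqrt.mpr hp1)
  rw [noiseScale_succ_eq hC₂0 hlam hν, perturbationSize, mul_pow]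
  have hx : 0 ≤ √((m n : ℝ) ^ 3 / n) ^ 2 ^ t := by positivity
  calc _ ≤ (2 * (√(2 / γ₀) * √n) / ε + √n) * (scaleGain (C₁ n) (C₂ n) lam ν ^ 2 ^ t *
        √((m n : ℝ) ^ 3 / n) ^ 2 ^ t) := by
        gcongr
        exact hsp.trans hsn
    _ = (2 * √(2 / γ₀) / ε + 1) * scaleGain (C₁ n) (C₂ n) lam ν ^ 2 ^ t *
        (√n * √((m n : ℝ) ^ 3 / n) ^ 2 ^ t) := by ring
    _ ≤ _ := by gcongr

/-- The consequences of the criterion for the number of steps. -/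
lemma rates_of_stepThreshold_lt {m n t : ℕ} (hn : 2 ≤ n)
    (hα : removalExponent m n < 1 / 3) (ht : stepThreshold (removalExponent m n) < t) :
    2 ≤ t ∧ (m : ℝ) ^ 3 / n ≤ (n : ℝ) ^ (-((2 : ℝ) ^ (t - 1))⁻¹) ∧
      √(n : ℝ) * √((m : ℝ) ^ 3 / n) ^ 2 ^ (t - 1) ≤ (n : ℝ) ^ (-(1 / 28) : ℝ) := by
  have hn1 : (1 : ℝ) < n := by exact_mod_cast hn
  have hn0 : (0 : ℝ) < n := by linarith
  have hlog : 0 < Real.log n := Real.log_pos hn1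
  set α := removalExponent m n with hαdef
  have hα0 : 0 ≤ α := div_nonneg (Real.log_nonneg (by linarith [Nat.cast_nonneg (α := ℝ) m]))
    hlog.le
  have hα3 : 0 < 1 - 3 * α := by linarith
  have hq1 : 1 ≤ (α + 1) / (1 - 3 * α) := (one_le_div hα3).mpr (by linarith)
  have hlogb : 0 ≤ Real.logb 2 ((α + 1) / (1 - 3 * α)) := Real.logb_nonneg one_lt_two hq1
  unfold stepThreshold at ht
  have ht2 : 2 ≤ t := by
    have : (1 : ℝ) < t := by linarith
    exact_mod_cast this
  obtain ⟨k, rfl⟩ : ∃ k, t = k + 2 := ⟨t - 2, by omega⟩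
  rw [show k + 2 - 1 = k + 1 by omega]
  -- The criterion `t > T` without logarithms, with `t - 1 = k + 1`.
  have hpow : α + 1 < 2 ^ (k + 1) * (1 - 3 * α) := by
    rw [← div_lt_iff₀ hα3, ← Real.rpow_natCast,
      ← Real.logb_lt_iff_lt_rpow one_lt_two (by linarith)]
    push_cast at ht ⊢
    linarith
  have h2k : (2 : ℝ) ≤ 2 ^ (k + 1) := by
    rw [pow_succ]
    linarith [one_le_pow₀ (n := k) (one_le_two (α := ℝ))]
  have hmα : (m : ℝ) ≤ (n : ℝ) ^ α := by
    have : (n : ℝ) ^ α = m + 1 := by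
      rw [Real.rpow_def_of_pos hn0, hαdef, removalExponent, mul_div_cancel₀ _ hlog.ne',
        Real.exp_log (by positivity)]
    linarith
  have hdiv : (m : ℝ) ^ 3 / n ≤ (n : ℝ) ^ (-(1 - 3 * α)) := by
    rw [show -(1 - 3 * α) = α * (3 : ℕ) - 1 by push_cast; ring, Real.rpow_sub_one hn0.ne',
      Real.rpow_mul hn0.le, Real.rpow_natCast]
    gcongr
  refine ⟨ht2, hdiv.trans (Real.rpow_le_rpow_of_exponent_le hn1.le (neg_le_neg ?_)), ?_⟩
  · rw [inv_le_iff_one_le_mul₀ (by positivity)]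
    linarith
  · have hsqrt : √((m : ℝ) ^ 3 / n) ≤ (n : ℝ) ^ (-(1 - 3 * α) / 2) := by
      refine Real.sqrt_le_iff.mpr ⟨by positivity, hdiv.trans_eq ?_⟩
      rw [← Real.rpow_natCast, ← Real.rpow_mul hn0.le]
      congr 1
      push_cast
      ring
    calc √(n : ℝ) * √((m : ℝ) ^ 3 / n) ^ 2 ^ (k + 1)
        ≤ √(n : ℝ) * ((n : ℝ) ^ (-(1 - 3 * α) / 2)) ^ 2 ^ (k + 1) := by gcongr
      _ = (n : ℝ) ^ (1 / 2 + -(1 - 3 * α) / 2 * 2 ^ (k + 1)) := by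
        rw [Real.sqrt_eq_rpow, ← Real.rpow_natCast (_ ^ _) (2 ^ (k + 1)), ← Real.rpow_mul hn0.le,
          ← Real.rpow_add hn0]
        push_cast
        rfl
      _ ≤ _ := by
        refine Real.rpow_le_rpow_of_exponent_le hn1.le ?_
        -- The criterion makes the exponent less than `-α / 2`, which degenerates when `α` is small.
        -- Then `2 ^ (k + 1) ≥ 2` gives `-1 / 2 + 3 α` instead. Splitting at `α = 1 / 14` leaves at
        -- most `-1 / 28` in both cases.
        rcases le_total (1 / 14) α with h | h
        · linarith
        · nlinarith

/-- Since `m ≥ 1`, the exponent `α` is strictly positive, so the argument of the logarithm exceeds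
`1`. -/
lemma one_lt_stepThreshold {m n : ℕ} (hn : 2 ≤ n) (hm : 1 ≤ m)
    (hα : removalExponent m n < 1 / 3) : 1 < stepThreshold (removalExponent m n) := by
  have hα0 : 0 < removalExponent m n := by
    have hm' : (1 : ℝ) ≤ m := by exact_mod_cast hm
    exact div_pos (Real.log_pos (by linarith)) (Real.log_pos (by exact_mod_cast hn))
  have h : 1 < (removalExponent m n + 1) / (1 - 3 * removalExponent m n) :=
    (one_lt_div (by linarith)).mpr (by linarith)
  unfold stepThreshold
  linarith [Real.logb_pos one_lt_two h]

/-- For bounded `m` the exponent tends to zero, and `T < 2` means `(1 + α) / (1 - 3 α) < 2`, that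
is, `α < 1 / 7`. -/
lemma eventually_stepThreshold_lt_two {B : ℕ} (hB : ∀ n, m n ≤ B) :
    ∀ᶠ n : ℕ in atTop, removalExponent (m n) n < 1 / 3 ∧
      stepThreshold (removalExponent (m n) n) < (2 : ℕ) := by
  have hlim : Tendsto (fun n : ℕ => Real.log (B + 1) / Real.log n) atTop (𝓝 0) :=
    (Real.tendsto_log_atTop.comp tendsto_natCast_atTop_atTop).const_div_atTop _
  filter_upwards [hlim.eventually_lt_const (show (0 : ℝ) < 1 / 7 by norm_num),
    eventually_ge_atTop 2] with n h hn
  have hlog : 0 < Real.log n := Real.log_pos (by exact_mod_cast hn)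
  have hmB : (m n : ℝ) ≤ B := by exact_mod_cast hB n
  have hα : removalExponent (m n) n < 1 / 7 := by
    refine lt_of_le_of_lt ?_ h
    unfold removalExponent
    gcongr
  have hα0 : 0 ≤ removalExponent (m n) n :=
    div_nonneg (Real.log_nonneg (by linarith [Nat.cast_nonneg (α := ℝ) (m n)])) hlog.le
  have hα3 : 0 < 1 - 3 * removalExponent (m n) n := by linarith
  refine ⟨by linarith, ?_⟩
  have hb : Real.logb 2 ((removalExponent (m n) n + 1) / (1 - 3 * removalExponent (m n) n)) < 1 := by
    rw [Real.logb_lt_iff_lt_rpow one_lt_two (by positivity), Real.rpow_one, div_lt_iff₀ hα3]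
    linarith
  unfold stepThreshold
  push_cast
  linarith

end Rates

/-! ### The rate of the divergence and its convergence to zero -/

section Conclusions

variable {p m : ℕ → ℕ} {γ₀ C s lam ν CX Cys ε a T : ℝ} {ℓ : ℝ → ℝ → ℝ}
  {r : ∀ n, Fin (p n) → ℝ → ℝ} {P : ∀ n, Measure (Obs (p n))} {Cy q Crr C₁ C₂ : ℕ → ℝ}
  {𝒳 : ∀ n, Set (Dataset n (p n))}

/-- The scale is a power `2 ^ (t - 1)` of a base that is eventually at most `1`, hence decreasing in
`t`. The divergence factor evaluated at `t₀` therefore serves all later `t`, which is why `L`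
depends neither on `t` nor on `M`. -/
theorem exists_isPolylog_ged_le (hγ₀ : 0 < γ₀)
    (hPHAS : Tendsto (fun n : ℕ => (n : ℝ) / p n) atTop (𝓝 γ₀)) (hm : ∀ n, 1 ≤ m n)
    (hℓ : LossAssumptions ℓ C s) (hlam : 0 < lam) (hν : 0 < ν) (hCrr : IsPolylog Crr)
    (hr : ∀ n, RegularizerAssumptions (r n) ν (Crr n)) (hCX : 0 < CX) (hCy : IsPolylog Cy)
    (hP : ∀ n, DataAssumptions (P n) CX s (Cy n) (q n) Cys)
    (h₁ : IsPolylog C₁) (h₂ : IsPolylog C₂)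
    (hge : ∀ᶠ n in atTop,
      scaleThreshold C s lam ν CX T a (fun n => |Cy n|) Crr p n ≤ C₁ n ∧ 2 * lam * ν ≤ C₂ n)
    (hε : 0 < ε) (htyp : ∀ᶠ n in atTop, ∀ D ∈ 𝒳 n, IsTypical ℓ (r n) C s lam ν CX T a |Cy n| D)
    {t₀ : ℕ} (ht₀ : 1 ≤ t₀) (hrate : IsPolylog fun n =>
      gedRate (p n) (m n) ε s (noiseScale (C₁ n) (C₂ n) lam ν (m n) n t₀)) :
    ∃ L : ℕ → ℝ, IsPolylog L ∧ ∀ᶠ n in atTop, ∀ D ∈ 𝒳 n, ∀ M : Finset (Fin n), M.card ≤ m n →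
      ∀ t ≥ t₀, ged ℓ (r n) lam (P n) (ε / noiseScale (C₁ n) (C₂ n) lam ν (m n) n t) t D M ≤
        ENNReal.ofReal
          (gedRate (p n) (m n) ε s (noiseScale (C₁ n) (C₂ n) lam ν (m n) n t) * L n) := by
  obtain ⟨k, rfl⟩ : ∃ k, t₀ = k + 1 := ⟨t₀ - 1, by omega⟩
  have hge1 : ∀ᶠ n in atTop, 1 ≤ C₁ n ∧ 2 * lam * ν ≤ C₂ n := hge.mono fun n h =>
    ⟨(one_le_scaleThreshold hℓ.C_pos hlam hν (fun n => abs_nonneg (Cy n)) n).trans h.1, h.2⟩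
  have hnn : ∀ᶠ n in atTop, ∀ t, 0 ≤ noiseScale (C₁ n) (C₂ n) lam ν (m n) n (t + 1) := by
    filter_upwards [hge1] with n ⟨hC₁, hC₂⟩ t
    have hC₂0 : 0 ≤ C₂ n := le_trans (by positivity) hC₂
    have := scaleGain_nonneg (C₂ := C₂ n) (lam := lam) (ν := ν) (zero_le_one.trans hC₁)
    rw [noiseScale_succ_eq hC₂0 hlam hν]
    positivity
  have hreg := eventually_cube_div_le_of_isPolylog_gedRate hγ₀ hPHAS hm hℓ.s_pos hlam hν hge1 hε
    hrate
  have hsize : IsPolylog fun n =>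
      perturbationSize (p n) ε (noiseScale (C₁ n) (C₂ n) lam ν (m n) n (k + 1)) := by
    refine hrate.of_le ?_
    filter_upwards [hnn] with n hn
    have h := perturbationSize_le_gedRate (p := p n) hε (hn k) hℓ.s_pos (hm n)
    have h0 := perturbationSize_nonneg (p := p n) hε (hn k)
    rwa [abs_of_nonneg h0, abs_of_nonneg (h0.trans h)]
  refine ⟨_, isPolylog_divergenceFactor (C := C) (CX := CX) (Cys := Cys) (k := ⌈s⌉₊)
    (isPolylog_energyBound (C := C) (lam := lam) (ν := ν) (CX := CX) hℓ.s_pos hPHAS hCy.abs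
      fun n => abs_nonneg (Cy n)) hsize, ?_⟩
  filter_upwards [eventually_ged_le hγ₀ hPHAS hm hℓ hlam hν hCrr hr hCX hCy hP h₁ h₂ hge hε
    (by positivity) hreg, htyp, hge1, hnn] with n hmain htyp hge1 hnn D hD M hM t ht
  obtain ⟨j, rfl⟩ : ∃ j, t = j + 1 := ⟨t - 1, by omega⟩
  obtain ⟨hC₁, hC₂⟩ := hge1
  have hC₂0 : 0 ≤ C₂ n := le_trans (by positivity) hC₂
  have hG := scaleGain_nonneg (C₂ := C₂ n) (lam := lam) (ν := ν) (zero_le_one.trans hC₁)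
  have hmono : noiseScale (C₁ n) (C₂ n) lam ν (m n) n (j + 1) ≤
      noiseScale (C₁ n) (C₂ n) lam ν (m n) n (k + 1) := by
    rw [noiseScale_succ_eq hC₂0 hlam hν, noiseScale_succ_eq hC₂0 hlam hν]
    exact pow_le_pow_of_le_one (by positivity) hmain.1
      (pow_le_pow_right₀ one_le_two (by omega))
  have hρ := perturbationSize_nonneg (p := p n) hε (hnn j)
  have hF := energyBound_nonneg (s := s) hℓ.C_pos hlam hν hCX (abs_nonneg (Cy n)) n (p n)
  refine (hmain.2 D (htyp D hD) M hM j).trans (ENNReal.ofReal_le_ofReal ?_)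
  exact mul_le_mul (perturbationSize_le_gedRate hε (hnn j) hℓ.s_pos (hm n))
    (divergenceFactor_mono hℓ.C_pos.le hCX.le _ hρ (perturbationSize_mono hε hmono))
    (divergenceFactor_nonneg hℓ.C_pos.le hCX.le hF hρ)
    (hρ.trans (perturbationSize_le_gedRate hε (hnn j) hℓ.s_pos (hm n)))

/-- The perturbation size is a polylogarithmic factor times `n^(-1/28)`; once it is below `1`, the
divergence factor is at most its value at `1`, which is polylogarithmic. -/
theorem vanishesOn_ged (hγ₀ : 0 < γ₀)
    (hPHAS : Tendsto (fun n : ℕ => (n : ℝ) / p n) atTop (𝓝 γ₀)) (hm : ∀ n, 1 ≤ m n)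
    (hℓ : LossAssumptions ℓ C s) (hlam : 0 < lam) (hν : 0 < ν) (hCrr : IsPolylog Crr)
    (hr : ∀ n, RegularizerAssumptions (r n) ν (Crr n)) (hCX : 0 < CX) (hCy : IsPolylog Cy)
    (hP : ∀ n, DataAssumptions (P n) CX s (Cy n) (q n) Cys)
    (h₁ : IsPolylog C₁) (h₂ : IsPolylog C₂)
    (hge : ∀ᶠ n in atTop,
      scaleThreshold C s lam ν CX T a (fun n => |Cy n|) Crr p n ≤ C₁ n ∧ 2 * lam * ν ≤ C₂ n)
    (hε : 0 < ε) (htyp : ∀ᶠ n in atTop, ∀ D ∈ 𝒳 n, IsTypical ℓ (r n) C s lam ν CX T a |Cy n| D)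
    {t : ℕ} (ht : ∀ᶠ n in atTop, removalExponent (m n) n < 1 / 3 ∧
      stepThreshold (removalExponent (m n) n) < t) :
    VanishesOn m 𝒳 fun n => ged ℓ (r n) lam (P n)
      (ε / noiseScale (C₁ n) (C₂ n) lam ν (m n) n t) t := by
  have hge1 : ∀ᶠ n in atTop, 1 ≤ C₁ n ∧ 2 * lam * ν ≤ C₂ n := hge.mono fun n h =>
    ⟨(one_le_scaleThreshold hℓ.C_pos hlam hν (fun n => abs_nonneg (Cy n)) n).trans h.1, h.2⟩
  have hrates := (ht.and (eventually_ge_atTop 2)).mono fun n h =>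
    rates_of_stepThreshold_lt h.2 h.1.1 h.1.2
  obtain ⟨-, ht2, -⟩ := hrates.exists
  obtain ⟨k, rfl⟩ : ∃ k, t = k + 1 := ⟨t - 1, by omega⟩
  rw [add_tsub_cancel_right] at hrates
  obtain ⟨g, hg, hgle⟩ := IsPolylog.perturbationSize_le hγ₀ hPHAS hlam hν h₁ h₂ hge1 hε
    (hrates.mono fun n h => h.2.2)
  have hF := isPolylog_energyBound (C := C) (lam := lam) (ν := ν) (CX := CX) hℓ.s_pos hPHAS
    hCy.abs fun n => abs_nonneg (Cy n)
  have hsmall := (hg.tendsto_mul_rpow_neg (δ := 1 / 28) (by norm_num)).eventually_le_const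
    zero_lt_one
  have hlim := (hg.mul (isPolylog_divergenceFactor (C := C) (CX := CX) (Cys := Cys) (k := ⌈s⌉₊)
    hF (isPolylog_const 1))).tendsto_mul_rpow_neg (δ := 1 / 28) (by norm_num)
  intro η hη
  filter_upwards [eventually_ged_le hγ₀ hPHAS hm hℓ hlam hν hCrr hr hCX hCy hP h₁ h₂ hge hε
    (by positivity) (hrates.mono fun n h => h.2.1), htyp, hge1, hgle, hsmall,
    hlim.eventually_le_const hη] with n hmain htyp hge1 hgle hsmall hlim D hD M hM
  obtain ⟨hC₁, hC₂⟩ := hge1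
  have hC₂0 : 0 ≤ C₂ n := le_trans (by positivity) hC₂
  have hG := scaleGain_nonneg (C₂ := C₂ n) (lam := lam) (ν := ν) (zero_le_one.trans hC₁)
  have hscale : 0 ≤ noiseScale (C₁ n) (C₂ n) lam ν (m n) n (k + 1) := by
    rw [noiseScale_succ_eq hC₂0 hlam hν]
    positivity
  have hρ := perturbationSize_nonneg (p := p n) hε hscale
  have hF := energyBound_nonneg (s := s) hℓ.C_pos hlam hν hCX (abs_nonneg (Cy n)) n (p n)
  refine (hmain.2 D (htyp D hD) M hM k).trans (ENNReal.ofReal_le_ofReal (le_trans ?_ hlim))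
  rw [mul_right_comm]
  exact mul_le_mul hgle
    (divergenceFactor_mono hℓ.C_pos.le hCX.le _ hρ (hgle.trans hsmall))
    (divergenceFactor_nonneg hℓ.C_pos.le hCX.le hF hρ) (hρ.trans hgle)

end Conclusions

end Unlearning

end

open Unlearning in
theorem mainTheorem2
    (p m : ℕ → ℕ) (γ₀ : ℝ) (hγ₀ : 0 < γ₀)
    (hPHAS : Tendsto (fun n : ℕ => (n : ℝ) / p n) atTop (𝓝 γ₀))
    (hm : ∀ n, 1 ≤ m n)
    (ℓ : ℝ → ℝ → ℝ) (C s : ℝ) (hℓ : LossAssumptions ℓ C s)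
    (lam ν : ℝ) (hlam : 0 < lam) (hν : 0 < ν)
    (r : ∀ n, Fin (p n) → ℝ → ℝ) (Crr : ℕ → ℝ) (hCrr : IsPolylog Crr)
    (hr : ∀ n, RegularizerAssumptions (r n) ν (Crr n))
    (P : ∀ n, Measure (Obs (p n))) (CX Cys : ℝ) (hCX : 0 < CX)
    (Cy q : ℕ → ℝ) (hCy : IsPolylog Cy) (hq : q =o[atTop] fun n : ℕ => (n : ℝ)⁻¹)
    (hP : ∀ n, DataAssumptions (P n) CX s (Cy n) (q n) Cys)
    (c : ℝ) :
    ∃ (c₁ c₂ : ℕ → ℝ) (𝒳 : ∀ n, Set (Dataset n (p n))),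
      IsPolylog c₁ ∧ IsPolylog c₂ ∧ (∀ n, 0 < c₁ n ∧ 0 < c₂ n) ∧
      (∀ n, MeasurableSet (𝒳 n)) ∧
      (∀ n : ℕ, 1 - ((n : ℝ) + 1) * q n - 14 * (n : ℝ) ^ (1 - c) - n * Real.exp (-(p n : ℝ) / 2)
          - 2 * Real.exp (-(p n : ℝ)) - Real.exp (-(1 - Real.log 2) * p n) ≤
        (datasetLaw n (P n)).real (𝒳 n)) ∧
      (∀ C₁ C₂ : ℕ → ℝ, IsPolylog C₁ → IsPolylog C₂ →
        (∀ᶠ n in atTop, c₁ n ≤ C₁ n ∧ c₂ n ≤ C₂ n) →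
        ∀ ε > (0 : ℝ),
        (∀ t₀ : ℕ, 1 ≤ t₀ → IsPolylog (fun n => gedRate (p n) (m n) ε s
            (noiseScale (C₁ n) (C₂ n) lam ν (m n) n t₀)) →
          ∃ L : ℕ → ℝ, IsPolylog L ∧
            ∀ᶠ n in atTop, ∀ D ∈ 𝒳 n, ∀ M : Finset (Fin n), M.card ≤ m n → ∀ t ≥ t₀,
              ged ℓ (r n) lam (P n) (ε / noiseScale (C₁ n) (C₂ n) lam ν (m n) n t) t D M ≤
                ENNReal.ofReal (gedRate (p n) (m n) ε s (noiseScale (C₁ n) (C₂ n) lam ν (m n) n t) * L n)) ∧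
        (∀ t : ℕ,
          (∀ᶠ n in atTop, removalExponent (m n) n < 1 / 3 ∧
            stepThreshold (removalExponent (m n) n) < t) →
          VanishesOn m 𝒳 (fun n => ged ℓ (r n) lam (P n)
              (ε / noiseScale (C₁ n) (C₂ n) lam ν (m n) n t) t) ∧
          (1 < c → VanishesInProbability m P (fun n => ged ℓ (r n) lam (P n)
              (ε / noiseScale (C₁ n) (C₂ n) lam ν (m n) n t) t))) ∧
        ((∃ B : ℕ, ∀ n, m n ≤ B) →
          VanishesOn m 𝒳 (fun n => ged ℓ (r n) lam (P n)
              (ε / noiseScale (C₁ n) (C₂ n) lam ν (m n) n 2) 2) ∧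
          (1 < c → VanishesInProbability m P (fun n => ged ℓ (r n) lam (P n)
              (ε / noiseScale (C₁ n) (C₂ n) lam ν (m n) n 2) 2)))) ∧
      (∀ n : ℕ, 2 ≤ n → removalExponent (m n) n < 1 / 3 →
        1 < stepThreshold (removalExponent (m n) n))
      := by
  obtain ⟨𝒳, hmeas, hprob, htyp⟩ := exists_typical_sets hγ₀ hPHAS hℓ hlam hν hr hCX hP c
  have hY0 : ∀ n, 0 ≤ |Cy n| := fun n => abs_nonneg _
  -- The value `γ₀ + 6` accommodates `n / p ≤ γ₀ + 1` in the net argument, and `2 + |c|` is the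
  -- exponent of the union bound. With `C₂ ≥ 2 * lam * ν`, the scale is at least `C₁ √(m³ / n)`
  -- after one step.
  refine ⟨scaleThreshold C s lam ν CX (γ₀ + 6) (2 + |c|) (fun n => |Cy n|) Crr p,
    fun _ => 2 * lam * ν, 𝒳,
    isPolylog_scaleThreshold hℓ.C_pos hℓ.s_pos hlam hν hPHAS hCy.abs hY0 hCrr, isPolylog_const _,
    fun n => ⟨zero_lt_one.trans_le (one_le_scaleThreshold hℓ.C_pos hlam hν hY0 n), by positivity⟩,
    hmeas, fun n => ?_, fun C₁ C₂ h₁ h₂ hge ε hε => ?_,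
    fun n hn hα => one_lt_stepThreshold hn (hm n) hα⟩
  · have h := hprob n
    unfold failureBound at h
    linarith
  have main : ∀ t : ℕ, (∀ᶠ n in atTop, removalExponent (m n) n < 1 / 3 ∧
      stepThreshold (removalExponent (m n) n) < t) →
      VanishesOn m 𝒳 (fun n => ged ℓ (r n) lam (P n)
        (ε / noiseScale (C₁ n) (C₂ n) lam ν (m n) n t) t) ∧
      (1 < c → VanishesInProbability m P (fun n => ged ℓ (r n) lam (P n)
        (ε / noiseScale (C₁ n) (C₂ n) lam ν (m n) n t) t)) := fun t ht => by
    have h := vanishesOn_ged hγ₀ hPHAS hm hℓ hlam hν hCrr hr hCX hCy hP h₁ h₂ hge hε htyp ht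
    exact ⟨h, fun hc => h.vanishesInProbability hγ₀ hPHAS hq hP hc hmeas hprob⟩
  exact ⟨fun t₀ ht₀ hrate => exists_isPolylog_ged_le hγ₀ hPHAS hm hℓ hlam hν hCrr hr hCX hCy hP
    h₁ h₂ hge hε htyp ht₀ hrate, main, fun ⟨_, hB⟩ => main 2 (eventually_stepThreshold_lt_two hB)⟩
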